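/- **Setting.** Let $\mathcal B$ be a quaternion division algebra over $\mathbb Q$, generated by $i,j$ with $i^2=a$, $j^2=b$, $ij=-ji$ ($a,b\in\mathbb Q$), which is indefinite, and fix an isomorphism $\mathcal B\otimes_{\mathbb Q}\mathbb R\simeq M_2(\mathbb R)$, so that $\mathcal B\subset M_2(\mathbb R)$. Let $\Lambda\simeq\mathbb Z^4$ be a lattice in $\mathcal B$ and let $\alpha\neq 0$ be a real number such that $N=\begin{pmatrix}0&\alpha\\-\alpha&0\end{pmatrix}\in\mathcal B$ and $\mathrm{tr}(\Lambda N\Lambda^t)\subset\mathbb Z$. Put $\Lambda'=\Lambda\cdot\mathrm{diag}(1,\alpha)\subset M_2(\mathbb R)$, and let $\Gamma$ be a torsion-free subgroup of finite index in the stabilizer $\{\gamma\in \mathrm{SL}(2,\mathbb R)\mid \Lambda'\gamma=\Lambda'\}$. The semi-direct product $\Gamma\ltimes\Lambda'$ acts freely and properly discontinuously on $\mathcal H\times\mathbb C^2$ ($\mathcal H$ the upper half plane) by $$(\gamma,\lambda)\cdot(\tau,z_1,z_2)=\Big(\tfrac{a\tau+b}{c\tau+d},\ \tfrac{z_1+m\tau+n}{c\tau+d},\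 \tfrac{z_2+k\tau+l}{c\tau+d}\Big),\qquad \gamma=\begin{pmatrix}a&b\\c&d\end{pmatrix},\ \lambda=\begin{pmatrix}m&n\\k&l\end{pmatrix}.$$ The quotient $M$, with the map $M\to\Sigma=\mathcal H/\Gamma$ induced by $(\tau,z_1,z_2)\mapsto\tau$, is called a Kuga–Shimura projective threefold over the Shimura curve $\Sigma$. Let $K_\Sigma^{1/2}$ be the square root of the canonical bundle $K_\Sigma$ given by the factor of automorphy $c\tau+d$; thus $H^0(\Sigma,K_\Sigma^{3/2})$ is the space of holomorphic functions $f$ on $\mathcal H$ with $f(\gamma\tau)=(c\tau+d)^3f(\tau)$ for $\gamma\in\Gamma$ (that is, $f\,d\tau^{3/2}$ descends to $\Sigma$). A holomorphic projective connection on $M$ is a collection $(U_i,\nabla_i)_{i\in I}$, where the $U_i$ are open subsets that cover $M$ and $\nabla_i$ is a torsion-free holomorphic affine connection on $U_i$, such that on each $U_i\cap U_j$ the connections $\nabla_i$ and $\nabla_j$ are projectively equivalent, i.e. $\nabla_{i,X}Y=\nabla_{j,X}Y+\theta(X)Y+\theta(Y)X$ for a holomorphic one-form $\theta$ on $U_i\cap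 U_j$. Two holomorphic projective connections are projectively equivalent if their union is a holomorphic projective connection. A holomorphic projective connection is flat if it is projectively equivalent to some $(U_i,\nabla_i)_{i\in I}$ such that each $\nabla_i$ is taken to the standard connection of $\mathbb C^3$ by a holomorphic coordinate function on $U_i$. A fiber $F$ is totally geodesic if, for each local representative $\nabla_i$, $\nabla_{i,v}Y$ is tangent to $F$ whenever $v$ is a vector tangent to $F$ and $Y$ is a vector field that is tangent to $F$ along $F$. **Theorem.** Let $M\to\Sigma$ be a Kuga–Shimura projective threefold. (i) The set of projective equivalence classes of holomorphic projective connections on $M$ is a (nonempty) affine space for the complex vector space $H^0(\Sigma,K_\Sigma^{3/2})^2$. Here $(A,B)$ acts by adding to the local representatives the tensor $\Theta_{A,B}$ on $M$ induced by the invariant tensor $d\tau\otimes d\tau\otimes\big(A(\tau)\frac{\partial}{\partial z_1}+B(\tau)\frac{\partial}{\partial z_2}\big)$ on $\mathcal H\times\mathbb C^2$. (ii) Every holomorphic projective connection on $M$ is flat, and the fibers of $M\to\Sigma$ are totally geodesic for every holomorphic projective connection on $M$. -/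

import Mathlib

open scoped Manifold ContDiff MatrixGroups Topology UpperHalfPlane TensorProduct

/-! ### Quotients of complex manifolds -/

section OrbitQuotient
variable {E H M G : Type*} [NormedAddCommGroup E] [NormedSpace ℂ E] [TopologicalSpace H]
  (I : ModelWithCorners ℂ E H) [TopologicalSpace M] [ChartedSpace H M]
  [Group G] [MulAction G M]
  [ProperlyDiscontinuousSMul G M] [ContinuousConstSMul G M] [IsCancelSMul G M]
  [T2Space M] [LocallyCompactSpace M]

/-- The quotient of a complex manifold by a free and properly discontinuous action by holomorphic maps
is a complex manifold, for the charted space structure for which the projection is a local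
isomorphism. -/
theorem isManifold_orbitQuotient [IsManifold I ω M]
    (h : ∀ g : G, ContMDiff I I ω (fun x : M => g • x)) :
    IsManifold I ω (MulAction.orbitRel.Quotient G M) := by
  have hq := isQuotientCoveringMap_quotientMk_of_properlyDiscontinuousSMul (G := G) (E := M)
  have hl : IsLocalHomeomorph (Quotient.mk (MulAction.orbitRel G M)) :=
    hq.isCoveringMap.isLocalHomeomorph
  apply isManifold_of_contDiffOn
  have key : ∀ a b : M, ContDiffOn ℂ ω
      (I ∘ ((hl.localInverseAt a).trans (chartAt H a)).symm.trans
        ((hl.localInverseAt b).trans (chartAt H b)) ∘ I.symm)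
      (I.symm ⁻¹' (((hl.localInverseAt a).trans (chartAt H a)).symm.trans
        ((hl.localInverseAt b).trans (chartAt H b))).source ∩ Set.range I) := by
    rintro a b _ ⟨hu, y, rfl⟩
    simp only [Set.mem_preimage, I.left_inv, OpenPartialHomeomorph.trans_source,
      OpenPartialHomeomorph.trans_symm_eq_symm_trans_symm, OpenPartialHomeomorph.symm_source,
      OpenPartialHomeomorph.coe_trans, Set.mem_inter_iff,
      Function.comp_apply, IsLocalHomeomorph.localInverseAt_symm] at hu
    obtain ⟨⟨hy, hx⟩, hs, ht⟩ := hu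
    set x := (chartAt H a).symm y with hxdef
    set p : MulAction.orbitRel.Quotient G M := Quotient.mk _ x with hp
    have h2 : (Quotient.mk (MulAction.orbitRel G M) (hl.localInverseAt b p)) = p :=
      hl.apply_localInverseAt_of_mem hs
    obtain ⟨g, hg⟩ : hl.localInverseAt b p ∈ MulAction.orbit G x := Quotient.exact h2
    have hg' : g • x = hl.localInverseAt b p := hg
    have hcont : ContinuousAt (fun z : M => g • z) x := (continuous_const_smul g).continuousAt
    have hev : ∀ᶠ z in 𝓝 x, hl.localInverseAt b (Quotient.mk _ z) = g • z := by
      have e1 : ∀ᶠ z in 𝓝 x, g • z ∈ (hl.localInverseAt b).target := by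
        apply hcont
        change _ ∈ 𝓝 (g • x)
        rw [hg']
        exact (hl.localInverseAt b).open_target.mem_nhds ((hl.localInverseAt b).map_source hs)
      filter_upwards [e1] with z hz
      have h3 : (Quotient.mk (MulAction.orbitRel G M) (g • z)) = Quotient.mk _ z :=
        Quotient.sound ⟨g, rfl⟩
      rw [← h3]
      have := (hl.localInverseAt b).right_inv hz
      rwa [hl.localInverseAt_symm] at this
    have hF : ContMDiffAt I I ω ((chartAt H b) ∘ (fun z : M => g • z) ∘ (chartAt H a).symm) y := by
      have c1 : ContMDiffAt I I ω (chartAt H a).symm y :=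
        (contMDiffOn_chart_symm (n := ω)).contMDiffAt ((chartAt H a).open_target.mem_nhds hy)
      have c3 : ContMDiffAt I I ω (chartAt H b) (g • x) := by
        rw [hg']
        exact (contMDiffOn_chart (n := ω)).contMDiffAt ((chartAt H b).open_source.mem_nhds ht)
      exact c3.comp y ((h g).contMDiffAt.comp y c1)
    have hF' := (contMDiffAt_iff.1 hF).2
    simp only [chartAt_self_eq, mfld_simps] at hF'
    refine (hF'.mono Set.inter_subset_right).congr_of_eventuallyEq ?_ ?_
    · have hc : Filter.Tendsto (fun u => (chartAt H a).symm (I.symm u)) (𝓝 (I y)) (𝓝 x) := by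
        have : ContinuousAt (chartAt H a).symm (I.symm (I y)) := by
          rw [I.left_inv]; exact (chartAt H a).continuousAt_symm hy
        have := this.comp I.continuous_symm.continuousAt
        simpa [ContinuousAt, Function.comp_def] using this
      filter_upwards [nhdsWithin_le_nhds (hc.eventually hev)] with u hu
      simp [Function.comp_def, hu]
    · simp [Function.comp_def, ← hxdef, hg', hp]
  rintro _ _ ⟨p, rfl⟩ ⟨p', rfl⟩
  exact key _ _

end OrbitQuotient

/-! ### The quaternionic lattice and its stabilizer -/

/-- An indefinite quaternion division algebra `B = (a, b)` over `ℚ`, with `i² = a`, `j² = b`,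
`ij = -ji`, an identification of `B ⊗ ℝ` with the real `2 × 2` matrices, a lattice `Λ ≅ ℤ⁴` in `B`
(the `ℤ`-span of a `ℚ`-basis), and a nonzero antisymmetric matrix `M = (0, α; -α, 0)` in `B` with
`tr (Λ M Λᵗ) ⊆ ℤ`. -/
structure QuaternionicLattice where
  a : ℚ
  b : ℚ
  isUnit_of_ne_zero : ∀ x : QuaternionAlgebra ℚ a 0 b, x ≠ 0 → IsUnit x
  split : (ℝ ⊗[ℚ] QuaternionAlgebra ℚ a 0 b) ≃ₐ[ℝ] Matrix (Fin 2) (Fin 2) ℝ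
  basis : Module.Basis (Fin 4) ℚ (QuaternionAlgebra ℚ a 0 b)
  α : ℝ
  α_ne_zero : α ≠ 0
  antisymm_mem : ∃ μ : QuaternionAlgebra ℚ a 0 b, split (1 ⊗ₜ μ) = !![0, α; -α, 0]
  trace_integral : ∀ x ∈ Submodule.span ℤ (Set.range basis),
    ∀ y ∈ Submodule.span ℤ (Set.range basis), ∃ n : ℤ,
      (split (1 ⊗ₜ x) * !![0, α; -α, 0] * (split (1 ⊗ₜ y)).transpose).trace = n

namespace QuaternionicLattice
variable (D : QuaternionicLattice)

/-- `x ↦ x · diag(1, α)`, as a map from `B` to real matrices. -/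
noncomputable def period : (QuaternionAlgebra ℚ D.a 0 D.b) →+ Matrix (Fin 2) (Fin 2) ℝ where
  toFun x := D.split (1 ⊗ₜ x) * !![1, 0; 0, D.α]
  map_zero' := by simp
  map_add' x y := by simp [TensorProduct.tmul_add, add_mul]

/-- The lattice `Λ · diag(1, α)` of real matrices. The period of a matrix `X` of this lattice at `τ`
is the vector `X · (τ, 1)ᵗ` of `ℂ²`; for `X = λ · diag(1, α)` it is `λ · (τ, α)ᵗ`. -/
noncomputable def periodLattice : AddSubgroup (Matrix (Fin 2) (Fin 2) ℝ) :=
  (Submodule.span ℤ (Set.range D.basis)).toAddSubgroup.map D.period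

/-- The stabilizer of the lattice `Λ · diag(1, α)` in `SL(2, ℝ)` (acting by right multiplication). -/
def stab : Subgroup SL(2, ℝ) where
  carrier := {γ | ∀ X : Matrix (Fin 2) (Fin 2) ℝ, X * γ.1 ∈ D.periodLattice ↔ X ∈ D.periodLattice}
  one_mem' := by intro X; simp
  mul_mem' := by
    intro g h hg hh X
    rw [Matrix.SpecialLinearGroup.coe_mul, ← mul_assoc, hh, hg]
  inv_mem' := by
    intro g hg X
    rw [← hg, mul_assoc, ← Matrix.SpecialLinearGroup.coe_mul, inv_mul_cancel]
    simp

theorem exists_basis : ∃ b : Module.Basis (Fin 4) ℝ (Matrix (Fin 2) (Fin 2) ℝ),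
    (D.periodLattice : Set (Matrix (Fin 2) (Fin 2) ℝ)) = Submodule.span ℤ (Set.range b) := by
  let u : (Matrix (Fin 2) (Fin 2) ℝ)ˣ :=
    ⟨!![1, 0; 0, D.α], !![1, 0; 0, D.α⁻¹],
      by simp [Matrix.one_fin_two, D.α_ne_zero], by simp [Matrix.one_fin_two, D.α_ne_zero]⟩
  let e : Matrix (Fin 2) (Fin 2) ℝ ≃ₗ[ℝ] Matrix (Fin 2) (Fin 2) ℝ :=
    LinearEquiv.ofBijective (LinearMap.mulRight ℝ (u : Matrix (Fin 2) (Fin 2) ℝ))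
      ⟨fun x y h => by simpa using h, fun y => ⟨y * ((u⁻¹ : (Matrix (Fin 2) (Fin 2) ℝ)ˣ) : Matrix (Fin 2) (Fin 2) ℝ), by
        rw [LinearMap.mulRight_apply, mul_assoc, Units.inv_mul, mul_one]⟩⟩
  refine ⟨((D.basis.baseChange ℝ).map D.split.toLinearEquiv).map e, ?_⟩
  have h1 : D.periodLattice = (Submodule.span ℤ (Set.range
    (((D.basis.baseChange ℝ).map D.split.toLinearEquiv).map e))).toAddSubgroup := by
    have h2 : (Set.range (((D.basis.baseChange ℝ).map D.split.toLinearEquiv).map e))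
      = D.period.toIntLinearMap '' Set.range D.basis := by
      rw [← Set.range_comp]
      congr 1
      funext i
      simp only [Module.Basis.map_apply, Module.Basis.baseChange_apply]
      rfl
    rw [h2, Submodule.span_image]
    rfl
  rw [h1]; rfl

theorem finite_inter {s : Set (Matrix (Fin 2) (Fin 2) ℝ)} (hs : IsCompact s) :
    (s ∩ (D.periodLattice : Set (Matrix (Fin 2) (Fin 2) ℝ))).Finite := by
  obtain ⟨b, hb⟩ := D.exists_basis
  rw [hb]
  let : NormedAddCommGroup (Matrix (Fin 2) (Fin 2) ℝ) := Matrix.normedAddCommGroup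
  let : NormedSpace ℝ (Matrix (Fin 2) (Fin 2) ℝ) := Matrix.normedSpace
  have : ProperSpace (Matrix (Fin 2) (Fin 2) ℝ) := pi_properSpace
  exact ZSpan.setFinite_inter b hs.isBounded

instance : DiscreteTopology D.stab := by
  obtain ⟨b, hb⟩ := D.exists_basis
  have hbm : ∀ i, b i ∈ D.periodLattice := fun i => by
    rw [← SetLike.mem_coe, hb]; exact Submodule.subset_span ⟨i, rfl⟩
  -- a compact neighbourhood of `1` meets the group in finitely many elements
  have : LocallyCompactSpace (Matrix (Fin 2) (Fin 2) ℝ) :=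
    inferInstanceAs (LocallyCompactSpace (Fin 2 → Fin 2 → ℝ))
  have : LocallyCompactSpace SL(2, ℝ) :=
    Matrix.SpecialLinearGroup.isClosedEmbedding_val.locallyCompactSpace
  obtain ⟨K, hK, h1K⟩ := exists_compact_mem_nhds (1 : SL(2, ℝ))
  have hfin : (K ∩ (D.stab : Set SL(2, ℝ))).Finite := by
    have hf : ∀ i, ((fun γ : SL(2, ℝ) => b i * γ.1) '' K ∩ D.periodLattice).Finite :=
      fun i => D.finite_inter (hK.image (by fun_prop))
    refine Set.Finite.of_finite_image (f := fun γ : SL(2, ℝ) => fun i => b i * γ.1)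
      ((Set.Finite.pi' hf).subset ?_) ?_
    · rintro _ ⟨γ, ⟨hγ, hs⟩, rfl⟩ i
      exact ⟨⟨γ, hγ, rfl⟩, (hs _).2 (hbm i)⟩
    · intro γ _ γ' _ h
      have h' : LinearMap.mulRight ℝ γ.1 = LinearMap.mulRight ℝ γ'.1 :=
        b.ext fun i => congrFun h i
      have := LinearMap.congr_fun h' 1
      exact Subtype.ext (by simpa using this)
  have hfin' : (((↑) : D.stab → SL(2, ℝ)) ⁻¹' K).Finite :=
    Set.Finite.of_finite_image (hfin.subset (by rintro _ ⟨γ, hγ, rfl⟩; exact ⟨hγ, γ.2⟩))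
      Subtype.val_injective.injOn
  rw [discreteTopology_iff_isOpen_singleton_one]
  have hn : (((↑) : D.stab → SL(2, ℝ)) ⁻¹' K) ∈ 𝓝 (1 : D.stab) :=
    continuous_subtype_val.continuousAt (by simpa using h1K)
  exact isOpen_singleton_of_finite_mem_nhds _ hn hfin'
end QuaternionicLattice

/-! ### The Kuga-Shimura threefold -/

/-- The data that define a Kuga-Shimura projective threefold: a quaternionic lattice and a torsion-free
subgroup `Γ` of finite index in the stabilizer of `Λ · diag(1, α)` in `SL(2, ℝ)`. -/
structure KugaShimuraDatum extends QuaternionicLattice where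
  Γ : Subgroup SL(2, ℝ)
  Γ_le : Γ ≤ toQuaternionicLattice.stab
  finiteIndex : (Γ.subgroupOf toQuaternionicLattice.stab).FiniteIndex
  torsionFree : ∀ γ ∈ Γ, IsOfFinOrder γ → γ = 1

/-- The factor of automorphy `cτ + d`. -/
noncomputable def autFactor (γ : SL(2, ℝ)) (τ : ℍ) : ℂ := (γ.1 1 0 : ℂ) * τ + (γ.1 1 1 : ℂ)

theorem autFactor_eq (γ : SL(2, ℝ)) (τ : ℍ) :
    autFactor γ τ = UpperHalfPlane.denom (γ : GL (Fin 2) ℝ) τ := rfl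

theorem autFactor_ne_zero (γ : SL(2, ℝ)) (τ : ℍ) : autFactor γ τ ≠ 0 :=
  UpperHalfPlane.denom_ne_zero (γ : GL (Fin 2) ℝ) τ

theorem autFactor_mul (γ γ' : SL(2, ℝ)) (τ : ℍ) :
    autFactor (γ * γ') τ = autFactor γ (γ' • τ) * autFactor γ' τ := by
  have := UpperHalfPlane.coe_specialLinearGroup_apply γ' τ
  have h0 := autFactor_ne_zero γ' τ
  simp only [autFactor] at *
  rw [this]
  simp [Matrix.mul_apply, Fin.sum_univ_two] at *
  field_simp
  ring

namespace KugaShimuraDatum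
variable (D : KugaShimuraDatum)

/-- The universal cover `ℍ × ℂ²`, with coordinates `(τ, z₁, z₂)`. -/
abbrev Cover : Type := ℍ × ℂ × ℂ

/-- The semi-direct product of `Γ` and the lattice. -/
@[ext]
structure Grp where
  γ : D.Γ
  lam : D.periodLattice

variable {D} in
/-- Right multiplication of the lattice by an element of `Γ`. -/
def latticeMul (X : D.periodLattice) (γ : D.Γ) : D.periodLattice :=
  ⟨X.1 * γ.1.1, (D.Γ_le γ.2 X.1).2 X.2⟩

/-- The group law for which the formula below is an action. -/
noncomputable instance : Group D.Grp where
  mul g h := ⟨g.γ * h.γ, h.lam + latticeMul g.lam h.γ⟩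
  one := ⟨1, 0⟩
  inv g := ⟨g.γ⁻¹, -latticeMul g.lam g.γ⁻¹⟩
  mul_assoc g h k := by
    refine Grp.ext (mul_assoc _ _ _) (Subtype.ext ?_)
    change k.lam.1 + (h.lam.1 + g.lam.1 * h.γ.1.1) * k.γ.1.1 =
      (k.lam.1 + h.lam.1 * k.γ.1.1) + g.lam.1 * (h.γ.1 * k.γ.1).1
    rw [Matrix.SpecialLinearGroup.coe_mul, add_mul, mul_assoc, add_assoc]
  one_mul g := by
    refine Grp.ext (one_mul _) (Subtype.ext ?_)
    change g.lam.1 + 0 * g.γ.1.1 = _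
    simp
  mul_one g := by
    refine Grp.ext (mul_one _) (Subtype.ext ?_)
    change 0 + g.lam.1 * (1 : SL(2, ℝ)).1 = _
    simp
  inv_mul_cancel g := by
    refine Grp.ext (inv_mul_cancel _) (Subtype.ext ?_)
    change g.lam.1 + -(g.lam.1 * (g.γ.1⁻¹).1) * g.γ.1.1 = 0
    rw [neg_mul, mul_assoc, ← Matrix.SpecialLinearGroup.coe_mul, inv_mul_cancel]
    simp

/-- `(γ, λ) · (τ, z₁, z₂) = (γτ, (z₁ + mτ + n) / (cτ + d), (z₂ + kτ + l) / (cτ + d))` for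
`γ = (a, b; c, d)` and `λ = (m, n; k, l)`. -/
noncomputable instance : SMul D.Grp Cover where
  smul g x := (g.γ • x.1,
    (x.2.1 + ((g.lam.1 0 0 : ℂ) * x.1 + (g.lam.1 0 1 : ℂ))) / autFactor g.γ.1 x.1,
    (x.2.2 + ((g.lam.1 1 0 : ℂ) * x.1 + (g.lam.1 1 1 : ℂ))) / autFactor g.γ.1 x.1)

theorem smul_def (g : D.Grp) (x : Cover) : g • x = (g.γ • x.1,
    (x.2.1 + ((g.lam.1 0 0 : ℂ) * x.1 + (g.lam.1 0 1 : ℂ))) / autFactor g.γ.1 x.1,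
    (x.2.2 + ((g.lam.1 1 0 : ℂ) * x.1 + (g.lam.1 1 1 : ℂ))) / autFactor g.γ.1 x.1) := rfl

noncomputable instance : MulAction D.Grp Cover where
  one_smul x := by
    rw [smul_def]
    change ((1 : D.Γ) • x.1, (x.2.1 + (((0 : ℝ) : ℂ) * x.1 + ((0 : ℝ) : ℂ))) / autFactor 1 x.1,
      (x.2.2 + (((0 : ℝ) : ℂ) * x.1 + ((0 : ℝ) : ℂ))) / autFactor 1 x.1) = x
    simp [autFactor]
  mul_smul g h x := by
    have hd := autFactor_ne_zero h.γ.1 x.1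
    have hd' := autFactor_ne_zero g.γ.1 (h.γ.1 • x.1)
    have hh : ((h.γ.1 • x.1 : ℍ) : ℂ) =
        ((h.γ.1.1 0 0 : ℂ) * x.1 + (h.γ.1.1 0 1 : ℂ)) / autFactor h.γ.1 x.1 :=
      UpperHalfPlane.coe_specialLinearGroup_apply h.γ.1 x.1
    have key : ∀ (i : Fin 2) (z : ℂ),
        (z + ((((h.lam.1 + g.lam.1 * h.γ.1.1) i 0 : ℝ) : ℂ) * x.1 +
          (((h.lam.1 + g.lam.1 * h.γ.1.1) i 1 : ℝ) : ℂ))) / autFactor (g.γ.1 * h.γ.1) x.1 =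
        ((z + ((h.lam.1 i 0 : ℂ) * x.1 + (h.lam.1 i 1 : ℂ))) / autFactor h.γ.1 x.1 +
          ((g.lam.1 i 0 : ℂ) * (h.γ.1 • x.1 : ℍ) + (g.lam.1 i 1 : ℂ))) /
          autFactor g.γ.1 (h.γ.1 • x.1) := by
      intro i z
      rw [autFactor_mul, hh, div_eq_div_iff (mul_ne_zero hd' hd) hd']
      have h3 : (h.γ.1.1 1 0 : ℂ) * x.1 + (h.γ.1.1 1 1 : ℂ) = autFactor h.γ.1 x.1 := rfl
      simp only [Matrix.add_apply, Matrix.mul_apply, Fin.sum_univ_two]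
      push_cast
      field_simp
      rw [← h3]
      ring
    exact Prod.ext (mul_smul g.γ h.γ x.1) (Prod.ext (key 0 x.2.1) (key 1 x.2.2))

instance : DiscreteTopology D.Γ :=
  have : DiscreteTopology ((D.stab : Set SL(2, ℝ)) : Set SL(2, ℝ)) :=
    inferInstanceAs (DiscreteTopology D.stab)
  (Topology.IsEmbedding.inclusion D.Γ_le).discreteTopology

theorem contMDiff_autFactor (γ : SL(2, ℝ)) : ContMDiff 𝓘(ℂ) 𝓘(ℂ) ω (autFactor γ) :=
  UpperHalfPlane.contMDiff_denom (γ : GL (Fin 2) ℝ)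

theorem contMDiff_moebius (γ : D.Γ) : ContMDiff 𝓘(ℂ) 𝓘(ℂ) ω (fun τ : ℍ => γ • τ) :=
  UpperHalfPlane.contMDiff_smul (g := (γ.1 : GL (Fin 2) ℝ)) (by simp)

theorem contMDiff_smul (g : D.Grp) :
    ContMDiff (𝓘(ℂ).prod 𝓘(ℂ, ℂ × ℂ)) (𝓘(ℂ).prod 𝓘(ℂ, ℂ × ℂ)) ω (fun x : Cover => g • x) := by
  have h0 : ContMDiff (𝓘(ℂ).prod 𝓘(ℂ, ℂ × ℂ)) 𝓘(ℂ) ω (fun x : Cover => (x.1 : ℂ)) :=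
    UpperHalfPlane.contMDiff_coe.comp contMDiff_fst
  have hi : ContMDiff (𝓘(ℂ).prod 𝓘(ℂ, ℂ × ℂ)) 𝓘(ℂ) ω
      (fun x : Cover => (autFactor g.γ.1 x.1)⁻¹) :=
    (UpperHalfPlane.contMDiff_inv_denom (g.γ.1 : GL (Fin 2) ℝ)).comp contMDiff_fst
  have hz : ContMDiff (𝓘(ℂ).prod 𝓘(ℂ, ℂ × ℂ)) 𝓘(ℂ, ℂ × ℂ) ω (fun x : Cover => x.2) :=
    contMDiff_snd
  have h1 : ContMDiff (𝓘(ℂ).prod 𝓘(ℂ, ℂ × ℂ)) 𝓘(ℂ) ω (fun x : Cover => x.2.1) :=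
    (contDiff_fst.contMDiff).comp hz
  have h2 : ContMDiff (𝓘(ℂ).prod 𝓘(ℂ, ℂ × ℂ)) 𝓘(ℂ) ω (fun x : Cover => x.2.2) :=
    (contDiff_snd.contMDiff).comp hz
  refine ContMDiff.prodMk ((D.contMDiff_moebius g.γ).comp contMDiff_fst) ?_
  refine ContMDiff.prodMk_space ?_ ?_
  · simp only [div_eq_mul_inv]
    exact (h1.add ((contMDiff_const.mul h0).add contMDiff_const)).mul hi
  · simp only [div_eq_mul_inv]
    exact (h2.add ((contMDiff_const.mul h0).add contMDiff_const)).mul hi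

instance : ContinuousConstSMul D.Grp Cover where
  continuous_const_smul g := (D.contMDiff_smul g).continuous

theorem eq_one_of_smul_eq (γ : D.Γ) (τ : ℍ) (h : γ • τ = τ) : γ = 1 := by
  have hf := ProperlyDiscontinuousSMul.finite_disjoint_inter_image (Γ := D.Γ) (T := ℍ)
    (isCompact_singleton (x := τ)) (isCompact_singleton (x := τ))
  have hfin : IsOfFinOrder γ := by
    rw [← finite_powers]
    refine hf.subset ?_
    rintro _ ⟨n, rfl⟩
    have : γ ^ n • τ = τ := by
      induction n with
      | zero => simp
      | succ n ih => rw [pow_succ, mul_smul, h, ih]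
    simp [this]
  exact Subtype.ext (D.torsionFree _ γ.2 (by simpa using! (D.Γ.subtype.isOfFinOrder hfin)))

theorem period_eq (X Y : Matrix (Fin 2) (Fin 2) ℝ) (τ : ℍ)
    (h : ∀ i, (X i 0 : ℂ) * τ + (X i 1 : ℂ) = (Y i 0 : ℂ) * τ + (Y i 1 : ℂ)) : X = Y := by
  have him := τ.im_ne_zero
  have h0 : ∀ i, X i 0 = Y i 0 := fun i => by
    have := congrArg Complex.im (h i)
    simpa [him] using this
  have h1 : ∀ i, X i 1 = Y i 1 := fun i => by
    have := h i
    rw [h0] at this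
    exact_mod_cast add_left_cancel this
  ext i j
  fin_cases j
  exacts [h0 i, h1 i]

instance : IsCancelSMul D.Γ ℍ where
  left_cancel' g x y h := smul_left_cancel g h
  right_cancel' g h x e := by
    have : (h⁻¹ * g) • x = x := by rw [mul_smul, e, inv_smul_smul]
    exact (inv_mul_eq_one.1 (D.eq_one_of_smul_eq _ _ this)).symm

instance : IsCancelSMul D.Grp Cover where
  left_cancel' g x y h := smul_left_cancel g h
  right_cancel' g h x e := by
    have hγ : g.γ = h.γ := IsCancelSMul.right_cancel _ _ x.1 (congrArg Prod.fst e)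
    refine Grp.ext hγ (Subtype.ext (period_eq _ _ x.1 fun i => ?_))
    have h1 := congrArg (fun y : Cover => y.2.1) e
    have h2 := congrArg (fun y : Cover => y.2.2) e
    simp only [smul_def, hγ] at h1 h2
    rw [div_left_inj' (autFactor_ne_zero _ _)] at h1 h2
    fin_cases i
    exacts [add_left_cancel h1, add_left_cancel h2]

instance : ProperlyDiscontinuousSMul D.Grp Cover where
  finite_disjoint_inter_image {K L} hK hL := by
    have hΓ := ProperlyDiscontinuousSMul.finite_disjoint_inter_image (Γ := D.Γ) (T := ℍ)
      (hK.image continuous_fst) (hL.image continuous_fst)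
    -- the lattice part is a continuous function of the source point and of the target point
    let F : D.Γ → Cover × Cover → Matrix (Fin 2) (Fin 2) ℝ := fun γ p =>
      let w : ℂ × ℂ := autFactor γ.1 p.1.1 • p.2.2 - p.1.2
      !![w.1.im / p.1.1.im, w.1.re - w.1.im / p.1.1.im * p.1.1.re;
         w.2.im / p.1.1.im, w.2.re - w.2.im / p.1.1.im * p.1.1.re]
    have hF : ∀ γ, Continuous (F γ) := by
      intro γ
      have hj : Continuous (autFactor γ.1) := (contMDiff_autFactor γ.1).continuous
      have hi : Continuous fun p : Cover × Cover => p.1.1.im :=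
        UpperHalfPlane.continuous_im.comp (continuous_fst.comp continuous_fst)
      have hr : Continuous fun p : Cover × Cover => p.1.1.re :=
        UpperHalfPlane.continuous_re.comp (continuous_fst.comp continuous_fst)
      have hi0 : ∀ p : Cover × Cover, p.1.1.im ≠ 0 := fun p => p.1.1.im_ne_zero
      have hw : Continuous fun p : Cover × Cover => autFactor γ.1 p.1.1 • p.2.2 - p.1.2 := by
        fun_prop
      refine continuous_matrix fun i j => ?_
      fin_cases i <;> fin_cases j <;> simp only [F] <;> fun_prop (disch := assumption)
    have hfin : ∀ γ, (F γ '' (K ×ˢ L) ∩ D.periodLattice).Finite := fun γ =>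
      D.finite_inter ((hK.prod hL).image (hF γ))
    refine Set.Finite.of_finite_image (f := fun g : D.Grp => (g.γ, g.lam.1))
      ((hΓ.biUnion fun γ _ => (Set.finite_singleton γ).prod (hfin γ)).subset ?_) ?_
    · rintro _ ⟨g, hg, rfl⟩
      obtain ⟨_, ⟨x, hx, rfl⟩, hy⟩ := hg
      have hne : ((fun τ : ℍ => g.γ • τ) '' (Prod.fst '' K) ∩ Prod.fst '' L).Nonempty :=
        ⟨g.γ • x.1, ⟨x.1, ⟨x, hx, rfl⟩, rfl⟩, ⟨g • x, hy, rfl⟩⟩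
      refine Set.mem_biUnion (x := g.γ) hne ⟨rfl, ⟨(x, g • x), ⟨hx, hy⟩, ?_⟩, g.lam.2⟩
      have h0 := autFactor_ne_zero g.γ.1 x.1
      have him := x.1.im_ne_zero
      have hw : autFactor g.γ.1 x.1 • (g • x).2 - x.2 =
          ((g.lam.1 0 0 : ℂ) * x.1 + (g.lam.1 0 1 : ℂ),
            (g.lam.1 1 0 : ℂ) * x.1 + (g.lam.1 1 1 : ℂ)) := by
        simp only [smul_def]
        ext1 <;> simp [mul_div_cancel₀ _ h0]
      simp only [F, hw]
      ext i j
      fin_cases i <;> fin_cases j <;> simp [him]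
    · intro g _ h _ e
      simp only [Prod.mk.injEq] at e
      exact Grp.ext e.1 (Subtype.ext e.2)

/-- The model of `ℍ × ℂ²` as a complex manifold of dimension three. -/
noncomputable abbrev model : ModelWithCorners ℂ (ℂ × ℂ × ℂ) (ModelProd ℂ (ℂ × ℂ)) :=
  𝓘(ℂ).prod 𝓘(ℂ, ℂ × ℂ)

/-- The Shimura curve `Σ = ℍ / Γ`. -/
abbrev Curve : Type := MulAction.orbitRel.Quotient D.Γ ℍ

/-- The Kuga-Shimura threefold, the quotient of `ℍ × ℂ²` by the semi-direct product of `Γ` and the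
lattice. -/
abbrev Threefold : Type := MulAction.orbitRel.Quotient D.Grp Cover

instance : IsManifold 𝓘(ℂ) ω D.Curve := isManifold_orbitQuotient _ D.contMDiff_moebius

instance : IsManifold model ω D.Threefold := isManifold_orbitQuotient _ D.contMDiff_smul

/-- The universal covering `ℍ → Σ`. -/
noncomputable def curveProj (τ : ℍ) : D.Curve := Quotient.mk _ τ

/-- The universal covering `ℍ × ℂ² → M`. -/
noncomputable def proj (x : Cover) : D.Threefold := Quotient.mk _ x

/-- The Kuga-Shimura fibration `M → Σ`, induced by `(τ, z₁, z₂) ↦ τ`. -/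
noncomputable def fibration : D.Threefold → D.Curve :=
  Quotient.map Prod.fst (by rintro _ y ⟨g, rfl⟩; exact ⟨g.γ, rfl⟩)

/-- The fibre over a point `p` of `Σ` of the line bundle `K_Σ^{k/2}`, the `k`-th power of the square
root of `K_Σ` given by the factor of automorphy `cτ + d`: a vector of the fibre is a function `v` on
the points `τ` of `ℍ` above `p` such that `v(τ) (dτ)^{k/2}` is invariant under `Γ`, where `dτ` is
transformed to `(cτ + d)⁻² dτ`. -/
def halfCanonicalFiber (k : ℕ) (p : D.Curve) : Submodule ℂ ({τ : ℍ // D.curveProj τ = p} → ℂ) where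
  carrier := {v | ∀ (γ : D.Γ) (τ τ' : {τ : ℍ // D.curveProj τ = p}), τ'.1 = γ • τ.1 →
    v τ' = autFactor γ.1 τ.1 ^ k * v τ}
  add_mem' hv hw γ τ τ' h := by simp [hv γ τ τ' h, hw γ τ τ' h, mul_add]
  zero_mem' γ τ τ' h := by simp
  smul_mem' c v hv γ τ τ' h := by simp [hv γ τ τ' h]; ring

variable {D} in
/-- The function on `ℍ` that represents a section of `K_Σ^{k/2}`. -/
noncomputable def sectionLift {k : ℕ} (s : Π p, D.halfCanonicalFiber k p) (τ : ℍ) : ℂ :=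
  (s (D.curveProj τ)).1 ⟨τ, rfl⟩

/-- The space `H⁰(Σ, K_Σ^{k/2})` of global holomorphic sections. -/
def H0 (k : ℕ) : Submodule ℂ (Π p, D.halfCanonicalFiber k p) where
  carrier := {s | ContMDiff 𝓘(ℂ) 𝓘(ℂ) ω (sectionLift s)}
  add_mem' hs ht := ContMDiff.add hs ht
  zero_mem' := contMDiff_const
  smul_mem' _ _ hs := contMDiff_const.mul hs

/-- The complex vector space `H⁰(Σ, K_Σ^{3/2})²`. -/
def SectionPairs : Type := D.H0 3 × D.H0 3

noncomputable instance : AddCommGroup D.SectionPairs :=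
  inferInstanceAs (AddCommGroup (D.H0 3 × D.H0 3))

noncomputable instance : Module ℂ D.SectionPairs :=
  inferInstanceAs (Module ℂ (D.H0 3 × D.H0 3))

end KugaShimuraDatum

/-! ### Holomorphic projective connections -/

section Projective
open Bundle TopologicalSpace

variable {E : Type*} [NormedAddCommGroup E] [NormedSpace ℂ E]
  {H : Type*} [TopologicalSpace H] (I : ModelWithCorners ℂ E H)
  (M : Type*) [TopologicalSpace M] [ChartedSpace H M] [IsManifold I ω M]

variable {M} in
/-- `θ` is a holomorphic one-form on `W`. -/
def IsHolomorphicOneFormOn (θ : Π x : M, TangentSpace I x →L[ℂ] ℂ) (W : Set M) : Prop :=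
  ContMDiffOn I (I.prod 𝓘(ℂ, E →L[ℂ] ℂ)) ω
    (fun x => (⟨x, θ x⟩ :
      TotalSpace (E →L[ℂ] ℂ) (fun x : M => TangentSpace I x →L[ℂ] Trivial M ℂ x))) W

/-- A torsion-free holomorphic affine connection on an open subset of `M`, where `cov Y x v` is
`∇_v Y` at `x`. Holomorphic means that `∇Y` is holomorphic on `V` for every holomorphic vector field
`Y` on an open subset `V`; since there may be few holomorphic vector fields on the whole domain, all
smaller `V` have to be considered. -/
structure LocalAffineConnection where
  domain : Opens M
  cov : (Π x : M, TangentSpace I x) → (Π x : M, TangentSpace I x →L[ℂ] TangentSpace I x)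
  isCovariantDerivative : IsCovariantDerivativeOn E cov (domain : Set M)
  holomorphic : ∀ V : Opens M, V ≤ domain →
    ContMDiffCovariantDerivativeOn E ω cov (V : Set M)
  torsionFree : ∀ x ∈ domain, ∀ X Y : Π x : M, TangentSpace I x,
    MDiffAt (T% X) x → MDiffAt (T% Y) x →
      cov Y x (X x) - cov X x (Y x) = VectorField.mlieBracket I X Y x

variable {I M} in
/-- Two torsion-free connections are projectively equivalent on the intersection of their domains if
`∇¹_X Y = ∇²_X Y + θ(X) Y + θ(Y) X` there for a holomorphic one-form `θ`. -/
def LocalAffineConnection.ProjEquiv (r s : LocalAffineConnection I M) : Prop :=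
  ∃ θ : Π x : M, TangentSpace I x →L[ℂ] ℂ,
    IsHolomorphicOneFormOn I θ (r.domain ⊓ s.domain : Opens M) ∧
    ∀ x ∈ r.domain ⊓ s.domain, ∀ Y : Π x : M, TangentSpace I x, MDiffAt (T% Y) x →
      ∀ v : TangentSpace I x,
        r.cov Y x v = s.cov Y x v + (θ x v • Y x + θ x (Y x) • v)

/-- A holomorphic projective connection on `M`: a collection of torsion-free holomorphic affine
connections, on open subsets that cover `M`, which are projectively equivalent on the overlaps. -/
structure HolProjConnection where
  reps : Set (LocalAffineConnection I M)
  cover : ∀ x : M, ∃ r ∈ reps, x ∈ r.domain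
  compatible : ∀ r ∈ reps, ∀ s ∈ reps, r.ProjEquiv s

variable {I M}

/-- Two holomorphic projective connections are projectively equivalent if their union is again a
holomorphic projective connection. -/
def HolProjConnection.Equivalent (φ ψ : HolProjConnection I M) : Prop :=
  ∃ χ : HolProjConnection I M, χ.reps = φ.reps ∪ ψ.reps

/-- An affine connection is flat if a holomorphic coordinate function on its domain takes it to the
standard connection of the model vector space. -/
def LocalAffineConnection.IsFlat (r : LocalAffineConnection I M) : Prop :=
  ∃ e ∈ IsManifold.maximalAtlas I ω M, e.source = (r.domain : Set M) ∧
    ∀ x ∈ r.domain, ∀ Y : Π x : M, TangentSpace I x, MDiffAt (T% Y) x →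
      ∀ v : TangentSpace I x,
        (mfderiv I 𝓘(ℂ, E) (e.extend I) x (r.cov Y x v) : E) =
          mfderiv I 𝓘(ℂ, E) (fun y => (mfderiv I 𝓘(ℂ, E) (e.extend I) y (Y y) : E)) x v

/-- A holomorphic projective connection is flat if it is projectively equivalent to one whose local
representatives are all flat. -/
def HolProjConnection.IsFlat (φ : HolProjConnection I M) : Prop :=
  ∃ ψ : HolProjConnection I M, φ.Equivalent ψ ∧ ∀ r ∈ ψ.reps, r.IsFlat

/-- The fibres of a holomorphic submersion `f` are totally geodesic: for every local representative `∇`,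
every vector field `Y` that is tangent to the fibre through `x` at the points of this fibre, and every
tangent vector `v` of the fibre at `x`, the vector `∇_v Y` is tangent to the fibre. The tangent spaces
of the fibres are the kernels of `df`. -/
def HolProjConnection.FibersTotallyGeodesic (φ : HolProjConnection I M)
    {E' : Type*} [NormedAddCommGroup E'] [NormedSpace ℂ E'] {H' : Type*} [TopologicalSpace H']
    (J : ModelWithCorners ℂ E' H') {N : Type*} [TopologicalSpace N] [ChartedSpace H' N]
    (f : M → N) : Prop :=
  ∀ r ∈ φ.reps, ∀ x ∈ r.domain, ∀ Y : Π x : M, TangentSpace I x, MDiffAt (T% Y) x →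
    (∀ᶠ y in 𝓝 x, f y = f x → mfderiv I J f y (Y y) = 0) →
    ∀ v : TangentSpace I x, mfderiv I J f x v = 0 → mfderiv I J f x (r.cov Y x v) = 0

theorem oneForm_unique {x : M} {θ θ' : TangentSpace I x →L[ℂ] ℂ}
    (h : ∀ Y : Π x : M, TangentSpace I x, MDiffAt (T% Y) x → ∀ v : TangentSpace I x,
      θ v • Y x + θ (Y x) • v = θ' v • Y x + θ' (Y x) • v) : θ = θ' := by
  ext v
  have h1 := h (FiberBundle.extend E v) (FiberBundle.mdifferentiableAt_extend ..) v
  rw [FiberBundle.extend_apply_self, ← add_smul, ← add_smul] at h1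
  by_cases hv : v = 0
  · subst hv; simp
  · have := smul_left_injective ℂ hv h1
    linear_combination this / 2

theorem LocalAffineConnection.ProjEquiv.symm {r s : LocalAffineConnection I M}
    (h : r.ProjEquiv s) : s.ProjEquiv r := by
  obtain ⟨θ, hθ, h⟩ := h
  refine ⟨-θ, ?_, fun x hx Y hY v => ?_⟩
  · rw [inf_comm]
    exact hθ.neg_section
  · rw [h x (by rwa [inf_comm]) Y hY v]
    simp only [Pi.neg_apply, neg_apply, neg_smul]
    abel

theorem HolProjConnection.equivalent_iff {φ ψ : HolProjConnection I M} :
    φ.Equivalent ψ ↔ ∀ r ∈ φ.reps, ∀ s ∈ ψ.reps, r.ProjEquiv s := by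
  constructor
  · rintro ⟨χ, hχ⟩ r hr s hs
    exact χ.compatible r (hχ ▸ Or.inl hr) s (hχ ▸ Or.inr hs)
  · intro h
    refine ⟨⟨φ.reps ∪ ψ.reps, fun x => ?_, ?_⟩, rfl⟩
    · obtain ⟨r, hr, hx⟩ := φ.cover x
      exact ⟨r, Or.inl hr, hx⟩
    · rintro r (hr | hr) s (hs | hs)
      exacts [φ.compatible r hr s hs, h r hr s hs, (h s hs r hr).symm, ψ.compatible r hr s hs]

/-- Projective equivalence of holomorphic projective connections. -/
instance projSetoid : Setoid (HolProjConnection I M) where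
  r := HolProjConnection.Equivalent
  iseqv := by
    refine ⟨fun φ => ⟨φ, by simp⟩, fun ⟨χ, h⟩ => ⟨χ, by rw [h, Set.union_comm]⟩, ?_⟩
    intro φ ψ χ h1 h2
    rw [HolProjConnection.equivalent_iff] at *
    intro r hr t ht
    choose s hs hxs using ψ.cover
    choose θ₁ hol₁ eq₁ using fun x => h1 r hr (s x) (hs x)
    choose θ₂ hol₂ eq₂ using fun x => h2 (s x) (hs x) t ht
    have hx1 : ∀ {x y}, x ∈ r.domain ⊓ t.domain → x ∈ (s y).domain →
        x ∈ r.domain ⊓ (s y).domain := fun h h' => ⟨h.1, h'⟩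
    have hx2 : ∀ {x y}, x ∈ r.domain ⊓ t.domain → x ∈ (s y).domain →
        x ∈ (s y).domain ⊓ t.domain := fun h h' => ⟨h', h.2⟩
    have key : ∀ y x, x ∈ r.domain ⊓ t.domain → x ∈ (s y).domain →
        ∀ Y : Π x : M, TangentSpace I x, MDiffAt (T% Y) x → ∀ v : TangentSpace I x,
        r.cov Y x v = t.cov Y x v +
          ((θ₁ y x + θ₂ y x) v • Y x + (θ₁ y x + θ₂ y x) (Y x) • v) := by
      intro y x hx hy Y hY v
      rw [eq₁ y x (hx1 hx hy) Y hY v, eq₂ y x (hx2 hx hy) Y hY v]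
      simp only [add_apply, add_smul]
      abel
    refine ⟨fun x => θ₁ x x + θ₂ x x, ?_, fun x hx Y hY v => key x x hx (hxs x) Y hY v⟩
    intro x hx
    have hev : ∀ᶠ y in 𝓝 x, θ₁ y y + θ₂ y y = θ₁ x y + θ₂ x y := by
      filter_upwards [(r.domain ⊓ t.domain).isOpen.mem_nhds hx,
        (s x).domain.isOpen.mem_nhds (hxs x)] with y hy hy'
      refine oneForm_unique fun Y hY v => ?_
      have := key y y hy (hxs y) Y hY v
      rw [key x y hy hy' Y hY v] at this
      exact (add_left_cancel this).symm
    have a1 := (hol₁ x).contMDiffAt ((r.domain ⊓ (s x).domain).isOpen.mem_nhds (hx1 hx (hxs x)))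
    have a2 := (hol₂ x).contMDiffAt (((s x).domain ⊓ t.domain).isOpen.mem_nhds (hx2 hx (hxs x)))
    have a3 := a1.add_section a2
    refine (a3.congr_of_eventuallyEq ?_).contMDiffWithinAt
    filter_upwards [hev] with y hy
    rw [hy]
    rfl

variable (I M) in
/-- The set of projective equivalence classes of holomorphic projective connections on `M`. -/
def ProjClass : Type _ := Quotient (projSetoid (I := I) (M := M))

/-- The projective equivalence class of a holomorphic projective connection. -/
def HolProjConnection.toClass (φ : HolProjConnection I M) : ProjClass I M := Quotient.mk _ φ

end Projective

/-! ### Translation of projective connections by sections of `K_Σ^{3/2}` -/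

namespace KugaShimuraDatum
variable (D : KugaShimuraDatum)

variable {D} in
/-- The quadratic tensor `dτ ⊗ dτ ⊗ (A(τ) ∂/∂z₁ + B(τ) ∂/∂z₂)` on `ℍ × ℂ²`. -/
noncomputable def tensor (A B : D.H0 3) (x : Cover) (v w : TangentSpace model x) : TangentSpace model x :=
  let v' : ℂ × ℂ × ℂ := v
  let w' : ℂ × ℂ × ℂ := w
  ((0, v'.1 * w'.1 * sectionLift A.1 x.1, v'.1 * w'.1 * sectionLift B.1 x.1) : ℂ × ℂ × ℂ)

variable {D} in
/-- The projective connection `ψ` is obtained from `φ` by adding the tensor on `M` that is induced by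
`dτ ⊗ dτ ⊗ (A ∂/∂z₁ + B ∂/∂z₂)`, where `c = (A, B)`: local representatives satisfy
`∇'_X Y = ∇_X Y + Θ(X, Y) + θ(X) Y + θ(Y) X` for a holomorphic one-form `θ`. The values `X = dϖ(v)` and
`Y = dϖ(w)` at a point are written by means of tangent vectors `v`, `w` of `ℍ × ℂ²`. -/
def IsTranslate (c : D.SectionPairs) (φ ψ : HolProjConnection model D.Threefold) : Prop :=
  ∀ r ∈ φ.reps, ∀ s ∈ ψ.reps, ∃ θ : Π p : D.Threefold, TangentSpace model p →L[ℂ] ℂ,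
    IsHolomorphicOneFormOn model θ
      (r.domain ⊓ s.domain : TopologicalSpace.Opens D.Threefold) ∧
    ∀ x : Cover, D.proj x ∈ r.domain ⊓ s.domain →
      ∀ Y : Π p : D.Threefold, TangentSpace model p,
      MDifferentiableAt model model.tangent
        (fun p => (⟨p, Y p⟩ : TangentBundle model D.Threefold)) (D.proj x) →
      ∀ v w : TangentSpace model x, mfderiv model model D.proj x w = Y (D.proj x) →
        s.cov Y (D.proj x) (mfderiv model model D.proj x v) =
          r.cov Y (D.proj x) (mfderiv model model D.proj x v) +
          mfderiv model model D.proj x (tensor c.1 c.2 x v w) +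
          (θ (D.proj x) (mfderiv model model D.proj x v) • Y (D.proj x) +
            θ (D.proj x) (Y (D.proj x)) • mfderiv model model D.proj x v)

end KugaShimuraDatum

/-!
The group `Γ ⋉ Λ'` acts on `ℍ × ℂ²` by restrictions of projective transformations of `ℙ³`, so the
standard connection of `ℂ³` induces a flat projective connection on the threefold `M`. Any other
projective connection differs from it, modulo pure tensors `θ ⊗ id + id ⊗ θ`, by a unique trace-free
tensor, which pulls back to a trace-free tensor on `ℍ × ℂ²` invariant under `Γ ⋉ Λ'`.

On the fibre over `τ` the lattice acts on such tensors unipotently. The component functions are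
therefore, one after the other, either periodic, hence constant by Liouville's theorem, or periodic
up to a linear function of the lattice element `X`, hence affine. In the affine case the increment
is complex linear in the period `X (τ, 1)ᵗ` and is also a linear function of the slope `X (1, 0)ᵗ`,
which is not complex linear in the period, so it vanishes. Together with the vanishing of the trace
this leaves only `dτ ⊗ dτ ⊗ (A ∂/∂z₁ + B ∂/∂z₂)` with `A`, `B` depending on `τ` alone, and
invariance under `Γ` says that `A` and `B` are sections of `K_Σ^{3/2}`.

Such a projective connection is flat: after the shear `(τ, z) ↦ (τ, z + a(τ))` with `a'' = (A, B)`
the standard connection pulls back to the one with tensor `dτ ⊗ dτ ⊗ (A, B)`. The fibres are totally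
geodesic because the standard connection preserves vertical fields and the tensor vanishes on
vertical vectors.
-/

section Bundles
open Bundle

variable {𝕜 : Type*} [NontriviallyNormedField 𝕜] {n : ℕ∞ω}
  {E : Type*} [NormedAddCommGroup E] [NormedSpace 𝕜 E]
  {H : Type*} [TopologicalSpace H] {I : ModelWithCorners 𝕜 E H}
  {M : Type*} [TopologicalSpace M] [ChartedSpace H M]
  {F₁ : Type*} [NormedAddCommGroup F₁] [NormedSpace 𝕜 F₁]
  {F₂ : Type*} [NormedAddCommGroup F₂] [NormedSpace 𝕜 F₂]
  {V₁ : M → Type*} [TopologicalSpace (TotalSpace F₁ V₁)] [∀ x, AddCommGroup (V₁ x)]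
  [∀ x, Module 𝕜 (V₁ x)] [∀ x, TopologicalSpace (V₁ x)] [FiberBundle F₁ V₁] [VectorBundle 𝕜 F₁ V₁]
  {V₂ : M → Type*} [TopologicalSpace (TotalSpace F₂ V₂)] [∀ x, AddCommGroup (V₂ x)]
  [∀ x, Module 𝕜 (V₂ x)] [∀ x, TopologicalSpace (V₂ x)] [∀ x, IsTopologicalAddGroup (V₂ x)]
  [∀ x, ContinuousSMul 𝕜 (V₂ x)] [FiberBundle F₂ V₂] [VectorBundle 𝕜 F₂ V₂]
  {L : Π x, V₁ x →L[𝕜] V₂ x} {x : M}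

theorem contMDiffAt_hom_of_localFrame [CompleteSpace 𝕜] {ι : Type*} [Finite ι]
    (b : Module.Basis ι 𝕜 F₁)
    (h : ∀ i, ContMDiffAt I (I.prod 𝓘(𝕜, F₂)) n
      (T% fun y => L y ((trivializationAt F₁ V₁ x).localFrame b i y)) x) :
    ContMDiffAt I (I.prod 𝓘(𝕜, F₁ →L[𝕜] F₂)) n
      (fun y => TotalSpace.mk' (F₁ →L[𝕜] F₂) (E := fun y => V₁ y →L[𝕜] V₂ y) y (L y)) x := by
  have := Fintype.ofFinite ι
  have : FiniteDimensional 𝕜 F₁ := b.finiteDimensional_of_finite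
  rw [contMDiffAt_hom_bundle]
  refine ⟨contMDiffAt_id, ?_⟩
  have hcoord (i : ι) : ContMDiffAt I 𝓘(𝕜, F₂) n
      (fun y => ContinuousLinearMap.inCoordinates F₁ V₁ F₂ V₂ x y x y (L y) (b i)) x := by
    refine ((contMDiffAt_section _).1 (h i)).congr_of_eventuallyEq ?_
    filter_upwards [(trivializationAt F₁ V₁ x).open_baseSet.mem_nhds
        (mem_baseSet_trivializationAt F₁ V₁ x),
      (trivializationAt F₂ V₂ x).open_baseSet.mem_nhds (mem_baseSet_trivializationAt F₂ V₂ x)]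
      with y hy₁ hy₂
    rw [ContinuousLinearMap.inCoordinates, ContinuousLinearMap.comp_apply,
      ContinuousLinearMap.comp_apply, Trivialization.continuousLinearMapAt_apply,
      Trivialization.coe_linearMapAt_of_mem _ hy₂,
      Trivialization.localFrame_apply_of_mem_baseSet _ _ hy₁]
    simp [Trivialization.basisAt, hy₁]
  have hsum (y : M) : ContinuousLinearMap.inCoordinates F₁ V₁ F₂ V₂ x y x y (L y) =
      ∑ i, ContinuousLinearMap.smulRightL 𝕜 F₁ F₂ (LinearMap.toContinuousLinearMap (b.coord i))
        (ContinuousLinearMap.inCoordinates F₁ V₁ F₂ V₂ x y x y (L y) (b i)) := by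
    ext v
    conv_lhs => rw [← b.sum_repr v, map_sum]
    simp
  exact (contMDiffAt_finsetSum fun i _ =>
    (ContinuousLinearMap.contMDiff _).contMDiffAt.comp x (hcoord i)).congr_of_eventuallyEq
      (.of_forall hsum)

theorem contMDiffAt_hom_of_apply [CompleteSpace 𝕜] [FiniteDimensional 𝕜 F₁]
    [ContMDiffVectorBundle n F₁ V₁ I]
    (h : ∀ W : Π x, V₁ x, ContMDiffAt I (I.prod 𝓘(𝕜, F₁)) n (T% W) x →
      ContMDiffAt I (I.prod 𝓘(𝕜, F₂)) n (T% fun y => L y (W y)) x) :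
    ContMDiffAt I (I.prod 𝓘(𝕜, F₁ →L[𝕜] F₂)) n
      (fun y => TotalSpace.mk' (F₁ →L[𝕜] F₂) (E := fun y => V₁ y →L[𝕜] V₂ y) y (L y)) x :=
  contMDiffAt_hom_of_localFrame (Module.finBasis 𝕜 F₁) fun i =>
    h _ (contMDiffAt_localFrame_of_mem n _ _ i (mem_baseSet_trivializationAt F₁ V₁ x))

end Bundles

/-! ### Vector fields in a chart -/

section Coordinates

variable {𝕜 : Type*} [NontriviallyNormedField 𝕜]
  {E : Type*} [NormedAddCommGroup E] [NormedSpace 𝕜 E]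
  {H : Type*} [TopologicalSpace H] {I : ModelWithCorners 𝕜 E H}
  {M : Type*} [TopologicalSpace M] [ChartedSpace H M]
  {F : Type*} [NormedAddCommGroup F] [NormedSpace 𝕜 F]
  {W : Π x : M, TangentSpace I x} {x : M}

section mvfderiv
variable [IsManifold I 1 M] {f : M → F} {m n : ℕ∞ω}

theorem contMDiffAt_mvfderiv_apply (hf : ContMDiffAt I 𝓘(𝕜, F) n f x)
    (hW : ContMDiffAt I I.tangent m (T% W) x) (hmn : m + 1 ≤ n) :
    ContMDiffAt I 𝓘(𝕜, F) m (fun y => mvfderiv I f y (W y)) x := by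
  have h := (hf.mfderiv_const hmn).clm_apply_of_inCoordinates hW
    (hf.of_le (le_self_add.trans hmn))
  exact (contMDiff_snd_tangentBundle_modelSpace F 𝓘(𝕜, F)).contMDiffAt.comp x h

theorem mdifferentiableAt_mvfderiv_apply (hf : ContMDiffAt I 𝓘(𝕜, F) 2 f x)
    (hW : MDifferentiableAt I I.tangent (T% W) x) :
    MDifferentiableAt I 𝓘(𝕜, F) (fun y => mvfderiv I f y (W y)) x := by
  have h := ((hf.mfderiv_const (m := 1) (by norm_num)).mdifferentiableAt
    one_ne_zero).clm_apply_of_inCoordinates hW (hf.mdifferentiableAt two_ne_zero)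
  exact ((contMDiff_snd_tangentBundle_modelSpace F 𝓘(𝕜, F)).contMDiffAt
    (n := 1)).mdifferentiableAt one_ne_zero |>.comp x h

end mvfderiv

variable (I) in
/-- The differential at `y` of the coordinate function of a chart `e`. -/
noncomputable def coordDeriv (e : OpenPartialHomeomorph M H) (y : M) : TangentSpace I y →L[𝕜] E :=
  mvfderiv I (e.extend I) y

variable (I) in
/-- The inverse of the differential at `y` of the coordinate function of a chart `e`; zero where
this differential is not invertible. -/
noncomputable def coordInv (e : OpenPartialHomeomorph M H) (y : M) : E →L[𝕜] TangentSpace I y :=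
  (coordDeriv I e y).inverse

variable (I) in
/-- The expression of a vector field in the coordinates of a chart `e`. -/
noncomputable def coordField (e : OpenPartialHomeomorph M H) (W : Π x : M, TangentSpace I x)
    (u : E) : E :=
  coordDeriv I e ((e.extend I).symm u) (W ((e.extend I).symm u))

variable {e : OpenPartialHomeomorph M H}

theorem isInvertible_coordDeriv (he : e ∈ IsManifold.maximalAtlas I ω M) (hx : x ∈ e.source) :
    (coordDeriv I e x).IsInvertible := by
  have hd : e.MDifferentiable I I :=
    ⟨(contMDiffOn_of_mem_maximalAtlas he).mdifferentiableOn (by simp),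
      (contMDiffOn_symm_of_mem_maximalAtlas he).mdifferentiableOn (by simp)⟩
  exact ⟨hd.mfderiv hx,
    (I.hasMFDerivAt.comp x (hd.mdifferentiableAt hx).hasMFDerivAt).mfderiv.symm⟩

theorem coordDeriv_coordInv (he : e ∈ IsManifold.maximalAtlas I ω M) (hx : x ∈ e.source) (v : E) :
    coordDeriv I e x (coordInv I e x v) = v := by
  obtain ⟨L, hL⟩ := isInvertible_coordDeriv he hx
  simp [coordInv, ← hL]

theorem coordInv_coordDeriv (he : e ∈ IsManifold.maximalAtlas I ω M) (hx : x ∈ e.source)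
    (v : TangentSpace I x) : coordInv I e x (coordDeriv I e x v) = v := by
  obtain ⟨L, hL⟩ := isInvertible_coordDeriv he hx
  simp [coordInv, ← hL]

theorem mpullback_coordField_eventuallyEq (he : e ∈ IsManifold.maximalAtlas I ω M)
    (hx : x ∈ e.source) (W : Π x : M, TangentSpace I x) :
    VectorField.mpullback I 𝓘(𝕜, E) (e.extend I) (coordField I e W) =ᶠ[𝓝 x] W := by
  filter_upwards [e.open_source.mem_nhds hx] with y hy
  change coordInv I e y (coordDeriv I e ((e.extend I).symm (e.extend I y))
    (W ((e.extend I).symm (e.extend I y)))) = W y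
  rw [e.extend_left_inv hy, coordInv_coordDeriv he hy]

variable [IsManifold I ω M]

theorem contMDiffAt_coordDeriv_apply (he : e ∈ IsManifold.maximalAtlas I ω M) (hx : x ∈ e.source)
    (hW : ContMDiffAt I I.tangent ω (T% W) x) :
    ContMDiffAt I 𝓘(𝕜, E) ω (fun y => coordDeriv I e y (W y)) x :=
  contMDiffAt_mvfderiv_apply (e.contMDiffAt_extend he hx) hW le_rfl

theorem mdifferentiableAt_coordDeriv_apply (he : e ∈ IsManifold.maximalAtlas I ω M)
    (hx : x ∈ e.source) (hW : MDifferentiableAt I I.tangent (T% W) x) :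
    MDifferentiableAt I 𝓘(𝕜, E) (fun y => coordDeriv I e y (W y)) x :=
  mdifferentiableAt_mvfderiv_apply ((e.contMDiffAt_extend he hx).of_le le_top) hW

theorem contMDiffAt_coordInv_const [CompleteSpace E]
    (he : e ∈ IsManifold.maximalAtlas I ω M) (hx : x ∈ e.source) (v : E) :
    ContMDiffAt I I.tangent ω (T% fun y => coordInv I e y v) x := by
  let V : Π u : E, TangentSpace 𝓘(𝕜, E) u := fun _ => v
  have hv : ContMDiffAt 𝓘(𝕜, E) 𝓘(𝕜, E).tangent ω (T% V) (e.extend I x) := by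
    rw [contMDiffAt_vectorSpace_iff_contDiffAt]
    exact (contDiffAt_const : ContDiffAt 𝕜 ω (fun _ : E => v) _)
  have hinv := isInvertible_coordDeriv he hx
  exact ContMDiffAt.mpullback_vectorField_preimage (I := I) (I' := 𝓘(𝕜, E)) (f := e.extend I)
    (V := V) (m := ω) (n := ω) hv (e.contMDiffAt_extend he hx) hinv le_rfl

theorem contMDiffAt_coordInv_apply [CompleteSpace 𝕜] [FiniteDimensional 𝕜 E] {h : M → E}
    (he : e ∈ IsManifold.maximalAtlas I ω M) (hx : x ∈ e.source)
    (hh : ContMDiffAt I 𝓘(𝕜, E) ω h x) :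
    ContMDiffAt I I.tangent ω (T% fun y => coordInv I e y (h y)) x := by
  have := FiniteDimensional.complete 𝕜 E
  let b := Module.finBasis 𝕜 E
  have hsum (y : M) : coordInv I e y (h y) =
      ∑ i, LinearMap.toContinuousLinearMap (b.coord i) (h y) • coordInv I e y (b i) := by
    conv_lhs => rw [← b.sum_repr (h y), map_sum]
    simp
  simp_rw [hsum]
  exact ContMDiffAt.sum_section fun i _ =>
    ((ContinuousLinearMap.contMDiff _).contMDiffAt.comp x hh).smul_section
      (contMDiffAt_coordInv_const he hx (b i))

section Bracket
variable [I.Boundaryless] {X Y : Π x : M, TangentSpace I x}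

theorem mdifferentiableAt_coordField (he : e ∈ IsManifold.maximalAtlas I ω M)
    (hx : x ∈ e.source) (hW : MDifferentiableAt I I.tangent (T% W) x) :
    MDifferentiableAt 𝓘(𝕜, E) 𝓘(𝕜, E) (coordField I e W) (e.extend I x) := by
  have hsymm : MDifferentiableAt 𝓘(𝕜, E) I (e.extend I).symm (e.extend I x) := by
    refine ((contMDiffOn_extend_symm he).contMDiffAt ?_).mdifferentiableAt (by simp)
    rw [← e.extend_target']
    exact e.isOpen_extend_target.mem_nhds ((e.extend I).map_source (by simpa using hx))
  exact (mdifferentiableAt_coordDeriv_apply he hx hW).comp_of_eq _ hsymm (e.extend_left_inv hx)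

theorem mvfderiv_coordDeriv_apply (he : e ∈ IsManifold.maximalAtlas I ω M) (hx : x ∈ e.source)
    (hW : MDifferentiableAt I I.tangent (T% W) x) (v : TangentSpace I x) :
    mvfderiv I (fun y => coordDeriv I e y (W y)) x v =
      fderiv 𝕜 (coordField I e W) (e.extend I x) (coordDeriv I e x v) := by
  have hcomp : (fun y => coordDeriv I e y (W y)) =ᶠ[𝓝 x] coordField I e W ∘ e.extend I := by
    filter_upwards [e.open_source.mem_nhds hx] with y hy
    simp only [Function.comp_apply, coordField]
    rw [e.extend_left_inv hy]
  rw [mvfderiv, hcomp.mfderiv_eq, mfderiv_comp x (mdifferentiableAt_coordField he hx hW)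
    ((e.contMDiffAt_extend he hx).mdifferentiableAt (by simp)), mfderiv_eq_fderiv]
  rfl

theorem coordDeriv_mlieBracket [CompleteSpace E] (he : e ∈ IsManifold.maximalAtlas I ω M)
    (hx : x ∈ e.source) (hX : MDifferentiableAt I I.tangent (T% X) x)
    (hY : MDifferentiableAt I I.tangent (T% Y) x) :
    coordDeriv I e x (VectorField.mlieBracket I X Y x) =
      mvfderiv I (fun y => coordDeriv I e y (Y y)) x (X x) -
        mvfderiv I (fun y => coordDeriv I e y (X y)) x (Y x) := by
  let V (Z : Π x : M, TangentSpace I x) : Π u : E, TangentSpace 𝓘(𝕜, E) u := coordField I e Z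
  have hV {Z : Π x : M, TangentSpace I x} (hZ : MDifferentiableAt I I.tangent (T% Z) x) :
      MDifferentiableAt 𝓘(𝕜, E) 𝓘(𝕜, E).tangent (T% (V Z)) (e.extend I x) := by
    rw [mdifferentiableAt_section]
    exact (mdifferentiableAt_coordField he hx hZ).congr_of_eventuallyEq
      (.of_forall fun u => by simp [V])
  have hbracket := VectorField.mpullback_mlieBracket (n := ω) (hV hX) (hV hY)
    (e.contMDiffAt_extend he hx) (by simp)
  rw [Filter.EventuallyEq.mlieBracket_vectorField_eq (mpullback_coordField_eventuallyEq he hx X)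
    (mpullback_coordField_eventuallyEq he hx Y)] at hbracket
  have hfield (Z : Π x : M, TangentSpace I x) :
      coordField I e Z (e.extend I x) = coordDeriv I e x (Z x) := by
    rw [coordField, e.extend_left_inv hx]
  rw [← hbracket, mvfderiv_coordDeriv_apply he hx hX, mvfderiv_coordDeriv_apply he hx hY,
    ← hfield X, ← hfield Y]
  refine (coordDeriv_coordInv he hx _).trans ?_
  rw [← VectorField.mlieBracketWithin_univ, VectorField.mlieBracketWithin_eq_lieBracketWithin,
    VectorField.lieBracketWithin_univ]
  rfl

end Bracket
end Coordinates

/-! ### Connections and their differences -/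

section Connections
open TopologicalSpace

variable {E : Type*} [NormedAddCommGroup E] [NormedSpace ℂ E]
  {H : Type*} [TopologicalSpace H] {I : ModelWithCorners ℂ E H}
  {M : Type*} [TopologicalSpace M] [ChartedSpace H M] [IsManifold I ω M]

theorem isCovariantDerivativeOn_flat {e : OpenPartialHomeomorph M H}
    (he : e ∈ IsManifold.maximalAtlas I ω M) :
    IsCovariantDerivativeOn E (fun (Y : Π x : M, TangentSpace I x) x =>
      (coordInv I e x).comp (mvfderiv I (fun y => coordDeriv I e y (Y y)) x)) e.source where
  add {σ σ'} x hσ hσ' hx := by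
    have hfun : (fun y => coordDeriv I e y ((σ + σ') y)) =
        (fun y => coordDeriv I e y (σ y)) + fun y => coordDeriv I e y (σ' y) := by
      ext y; simp
    rw [hfun, mvfderiv_add (mdifferentiableAt_coordDeriv_apply he hx hσ)
      (mdifferentiableAt_coordDeriv_apply he hx hσ')]
    exact ContinuousLinearMap.comp_add _ _ _
  leibniz {σ g} x hσ hg hx := by
    have hfun : (fun y => coordDeriv I e y ((g • σ) y)) =
        g • fun y => coordDeriv I e y (σ y) := by
      ext y; simp
    rw [hfun, mvfderiv_smul hg (mdifferentiableAt_coordDeriv_apply he hx hσ)]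
    ext v
    simp [coordInv_coordDeriv he hx]

/-- A field of bilinear maps on the tangent spaces is holomorphic at `x` if it takes holomorphic
vector fields to holomorphic vector fields. -/
def IsHolomorphicTensorAt (Θ : Π x : M, TangentSpace I x → TangentSpace I x → TangentSpace I x)
    (x : M) : Prop :=
  ∀ V W : Π x : M, TangentSpace I x, ContMDiffAt I I.tangent ω (T% V) x →
    ContMDiffAt I I.tangent ω (T% W) x →
    ContMDiffAt I I.tangent ω (T% fun y => Θ y (V y) (W y)) x

theorem LocalAffineConnection.contMDiffAt_cov_apply {r : LocalAffineConnection I M} {x : M}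
    (hx : x ∈ r.domain) {V W : Π x : M, TangentSpace I x} (hV : ContMDiffAt I I.tangent ω (T% V) x)
    (hW : ContMDiffAt I I.tangent ω (T% W) x) :
    ContMDiffAt I I.tangent ω (T% fun y => r.cov V y (W y)) x := by
  obtain ⟨U, hVU, hUo, hxU⟩ :=
    eventually_nhds_iff.1 ((contMDiffAt_iff_contMDiffAt_nhds (by simp)).1 hV)
  let U' : Opens M := ⟨U, hUo⟩ ⊓ r.domain
  have hVU' : ContMDiffOn I I.tangent (ω + 1) (T% V) (U' : Set M) :=
    fun y hy => (hVU y hy.1).contMDiffWithinAt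
  have hcov := ((r.holomorphic U' inf_le_right).contMDiff hVU').contMDiffAt
    (U'.isOpen.mem_nhds ⟨hxU, hx⟩)
  exact hcov.clm_bundle_apply hW

variable [FiniteDimensional ℂ E]

/-- The connection on the domain of a chart `e` which `e` takes to the standard connection of the
model vector space. -/
noncomputable def flatConnection [I.Boundaryless] (e : OpenPartialHomeomorph M H)
    (he : e ∈ IsManifold.maximalAtlas I ω M) : LocalAffineConnection I M where
  domain := ⟨e.source, e.open_source⟩
  cov Y x := (coordInv I e x).comp (mvfderiv I (fun y => coordDeriv I e y (Y y)) x)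
  isCovariantDerivative := isCovariantDerivativeOn_flat he
  holomorphic V hV := ⟨fun {σ} hσ x hx => by
    have hσx : ContMDiffAt I I.tangent ω (T% σ) x := hσ.contMDiffAt (V.isOpen.mem_nhds hx)
    refine (contMDiffAt_hom_of_apply fun W hW => ?_).contMDiffWithinAt
    exact contMDiffAt_coordInv_apply he (hV hx)
      (contMDiffAt_mvfderiv_apply (contMDiffAt_coordDeriv_apply he (hV hx) hσx) hW le_rfl)⟩
  torsionFree x hx X Y hX hY := by
    have := FiniteDimensional.complete ℂ E
    rw [← coordInv_coordDeriv he hx (VectorField.mlieBracket I X Y x),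
      coordDeriv_mlieBracket he hx hX hY]
    exact (map_sub (coordInv I e x) _ _).symm

theorem flatConnection_isFlat [I.Boundaryless] {e : OpenPartialHomeomorph M H}
    (he : e ∈ IsManifold.maximalAtlas I ω M) : (flatConnection e he).IsFlat :=
  ⟨e, he, rfl, fun _ hx _ _ _ => coordDeriv_coordInv he hx _⟩

namespace LocalAffineConnection

variable {r s t : LocalAffineConnection I M} {x : M}

/-- The connection `∇ + Θ`, for a holomorphic symmetric tensor `Θ`. -/
noncomputable def addTensor (r : LocalAffineConnection I M)
    (Θ : Π x : M, TangentSpace I x →L[ℂ] TangentSpace I x →L[ℂ] TangentSpace I x)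
    (hsymm : ∀ x ∈ r.domain, ∀ v w, Θ x v w = Θ x w v)
    (hhol : ∀ x ∈ r.domain, IsHolomorphicTensorAt (fun y v w => Θ y v w) x) :
    LocalAffineConnection I M where
  domain := r.domain
  cov Y x := r.cov Y x + Θ x (Y x)
  isCovariantDerivative := r.isCovariantDerivative.add_one_form Θ
  holomorphic V hV := ⟨fun {σ} hσ x hx => by
    have hσx : ContMDiffAt I I.tangent ω (T% σ) x := hσ.contMDiffAt (V.isOpen.mem_nhds hx)
    refine (contMDiffAt_hom_of_apply fun W hW => ?_).contMDiffWithinAt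
    exact (contMDiffAt_cov_apply (hV hx) hσx hW).add_section (hhol x (hV hx) σ W hσx hW)⟩
  torsionFree x hx X Y hX hY := by
    rw [← r.torsionFree x hx X Y hX hY]
    simp only [add_apply, hsymm x hx (Y x) (X x)]
    abel

/-- The difference of two connections as a tensor, whose value on `Y x` and `v` is
`∇_v Y - ∇'_v Y`. -/
noncomputable def diff (r s : LocalAffineConnection I M) (x : M) :
    TangentSpace I x →L[ℂ] TangentSpace I x →L[ℂ] TangentSpace I x :=
  (r.isCovariantDerivative.mono (s := (r.domain ⊓ s.domain : Opens M)) fun _ h => h.1).difference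
    (s.isCovariantDerivative.mono fun _ h => h.2) x

theorem diff_apply (hr : x ∈ r.domain) (hs : x ∈ s.domain) {Y : Π x : M, TangentSpace I x}
    (hY : MDifferentiableAt I I.tangent (T% Y) x) :
    r.diff s x (Y x) = r.cov Y x - s.cov Y x :=
  IsCovariantDerivativeOn.difference_apply _ _ (show x ∈ r.domain ⊓ s.domain from ⟨hr, hs⟩) hY

theorem diff_eq_cov_extend (hr : x ∈ r.domain) (hs : x ∈ s.domain) (v : TangentSpace I x) :
    r.diff s x v = r.cov (FiberBundle.extend E v) x - s.cov (FiberBundle.extend E v) x := by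
  have h := diff_apply hr hs (FiberBundle.mdifferentiableAt_extend I E v)
  rwa [FiberBundle.extend_apply_self] at h

theorem diff_self (hr : x ∈ r.domain) : r.diff r x = 0 := by
  ext v w
  simp [diff_eq_cov_extend hr hr]

theorem diff_swap (hr : x ∈ r.domain) (hs : x ∈ s.domain) : s.diff r x = -r.diff s x := by
  ext v w
  simp [diff_eq_cov_extend hr hs, diff_eq_cov_extend hs hr]

theorem diff_add_diff (hr : x ∈ r.domain) (hs : x ∈ s.domain) (ht : x ∈ t.domain) :
    r.diff s x + s.diff t x = r.diff t x := by
  ext v w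
  simp [diff_eq_cov_extend hr hs, diff_eq_cov_extend hs ht, diff_eq_cov_extend hr ht]

theorem addTensor_diff
    {Θ : Π x : M, TangentSpace I x →L[ℂ] TangentSpace I x →L[ℂ] TangentSpace I x}
    (hsymm : ∀ x ∈ r.domain, ∀ v w, Θ x v w = Θ x w v)
    (hhol : ∀ x ∈ r.domain, IsHolomorphicTensorAt (fun y v w => Θ y v w) x) (hx : x ∈ r.domain) :
    (r.addTensor Θ hsymm hhol).diff r x = Θ x := by
  ext v w
  rw [diff_eq_cov_extend (r := r.addTensor Θ hsymm hhol) hx hx]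
  simp [addTensor]

theorem diff_symm (hr : x ∈ r.domain) (hs : x ∈ s.domain) (v w : TangentSpace I x) :
    r.diff s x v w = r.diff s x w v := by
  have hv := FiberBundle.mdifferentiableAt_extend I E v
  have hw := FiberBundle.mdifferentiableAt_extend I E w
  have htorsion := (r.torsionFree x hr _ _ hv hw).trans (s.torsionFree x hs _ _ hv hw).symm
  simp only [FiberBundle.extend_apply_self] at htorsion
  rw [diff_eq_cov_extend hr hs, diff_eq_cov_extend hr hs, sub_apply, sub_apply,
    sub_eq_sub_iff_sub_eq_sub, ← neg_sub, htorsion, neg_sub]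

theorem isHolomorphicTensorAt_diff (hr : x ∈ r.domain) (hs : x ∈ s.domain) :
    IsHolomorphicTensorAt (fun y v w => r.diff s y v w) x := by
  intro V W hV hW
  refine ((contMDiffAt_cov_apply hr hV hW).sub_section
    (contMDiffAt_cov_apply hs hV hW)).congr_of_eventuallyEq ?_
  filter_upwards [r.domain.isOpen.mem_nhds hr, s.domain.isOpen.mem_nhds hs,
    (contMDiffAt_iff_contMDiffAt_nhds (by simp)).1 hV] with y hyr hys hVy
  rw [diff_apply hyr hys (hVy.mdifferentiableAt (by simp))]
  rfl

end LocalAffineConnection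
end Connections

/-! ### Trace-free tensors and projective equivalence -/

section TraceFree

variable {𝕜 V W : Type*} [Field 𝕜] [AddCommGroup V] [Module 𝕜 V] [AddCommGroup W] [Module 𝕜 W]

variable (𝕜) in
/-- The bilinear maps `θ(v) w + θ(w) v`, by which projectively equivalent connections differ. -/
def IsPureTensor (B : V → V → V) : Prop :=
  ∃ θ : V →ₗ[𝕜] 𝕜, ∀ v w, B v w = θ v • w + θ w • v

namespace IsPureTensor

variable {B C : V → V → V}

theorem add (hB : IsPureTensor 𝕜 B) (hC : IsPureTensor 𝕜 C) :
    IsPureTensor 𝕜 fun v w => B v w + C v w := by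
  obtain ⟨θ, hθ⟩ := hB
  obtain ⟨η, hη⟩ := hC
  exact ⟨θ + η, fun v w => by simp only [hθ, hη, LinearMap.add_apply, add_smul]; abel⟩

theorem neg (hB : IsPureTensor 𝕜 B) : IsPureTensor 𝕜 fun v w => -B v w := by
  obtain ⟨θ, hθ⟩ := hB
  exact ⟨-θ, fun v w => by simp only [hθ, LinearMap.neg_apply, neg_smul]; abel⟩

theorem congr (hB : IsPureTensor 𝕜 B) (h : ∀ v w, C v w = B v w) : IsPureTensor 𝕜 C := by
  obtain ⟨θ, hθ⟩ := hB
  exact ⟨θ, fun v w => by rw [h, hθ]⟩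

theorem conj (hB : IsPureTensor 𝕜 B) {L : V →ₗ[𝕜] W} {K : W →ₗ[𝕜] V} (h : ∀ w, L (K w) = w) :
    IsPureTensor 𝕜 fun v w => L (B (K v) (K w)) := by
  obtain ⟨θ, hθ⟩ := hB
  exact ⟨θ ∘ₗ K, fun v w => by simp [hθ, h]⟩

end IsPureTensor

/-- The trace-free part of a symmetric bilinear map on an `n`-dimensional space: the multiple
`1 / (n + 1)` makes the trace of a pure tensor `θ(v) w + θ(w) v` recover `θ(v)`. -/
noncomputable def traceFree (B : V →ₗ[𝕜] V →ₗ[𝕜] V) : V →ₗ[𝕜] V →ₗ[𝕜] V :=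
  let θ : V →ₗ[𝕜] 𝕜 := (Module.finrank 𝕜 V + 1 : 𝕜)⁻¹ • (LinearMap.trace 𝕜 V ∘ₗ B)
  B - LinearMap.mk₂ 𝕜 (fun v w => θ v • w + θ w • v)
    (fun v v' w => by simp only [map_add]; module)
    (fun c v w => by simp only [map_smul, smul_eq_mul]; module)
    (fun v w w' => by simp only [map_add]; module)
    (fun c v w => by simp only [map_smul, smul_eq_mul]; module)

theorem traceFree_apply (B : V →ₗ[𝕜] V →ₗ[𝕜] V) (v w : V) :
    traceFree B v w = B v w -
      (((Module.finrank 𝕜 V + 1 : 𝕜)⁻¹ * LinearMap.trace 𝕜 V (B v)) • w +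
        ((Module.finrank 𝕜 V + 1 : 𝕜)⁻¹ * LinearMap.trace 𝕜 V (B w)) • v) :=
  rfl

theorem isPureTensor_sub_traceFree (B : V →ₗ[𝕜] V →ₗ[𝕜] V) :
    IsPureTensor 𝕜 fun v w => B v w - traceFree B v w :=
  ⟨(Module.finrank 𝕜 V + 1 : 𝕜)⁻¹ • (LinearMap.trace 𝕜 V ∘ₗ B), fun v w => by
    simp only [traceFree_apply, sub_sub_cancel]; rfl⟩

theorem traceFree_sub (B C : V →ₗ[𝕜] V →ₗ[𝕜] V) :
    traceFree (B - C) = traceFree B - traceFree C := by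
  ext v w
  simp only [traceFree_apply, LinearMap.sub_apply, map_sub]
  module

theorem traceFree_symm {B : V →ₗ[𝕜] V →ₗ[𝕜] V} (h : ∀ v w, B v w = B w v) (v w : V) :
    traceFree B v w = traceFree B w v := by
  rw [traceFree_apply, traceFree_apply, h v w, add_comm]

theorem traceFree_equivariant (L : V ≃ₗ[𝕜] W) {B : V →ₗ[𝕜] V →ₗ[𝕜] V} {C : W →ₗ[𝕜] W →ₗ[𝕜] W}
    (h : ∀ v w, C (L v) (L w) = L (B v w)) (v w : V) :
    traceFree C (L v) (L w) = L (traceFree B v w) := by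
  have htrace (v : V) : LinearMap.trace 𝕜 W (C (L v)) = LinearMap.trace 𝕜 V (B v) := by
    rw [← LinearMap.trace_conj' (B v) L]
    congr 1
    ext w
    rw [LinearEquiv.conj_apply_apply, ← h, LinearEquiv.apply_symm_apply]
  simp only [traceFree_apply, h, htrace, map_sub, map_add, map_smul, L.finrank_eq]

variable [CharZero 𝕜] [FiniteDimensional 𝕜 V] {B : V →ₗ[𝕜] V →ₗ[𝕜] V}

theorem IsPureTensor.traceFree_eq_zero (hB : IsPureTensor 𝕜 fun v w => B v w) :
    traceFree B = 0 := by
  obtain ⟨θ, hθ⟩ := hB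
  beta_reduce at hθ
  have htrace (v : V) : LinearMap.trace 𝕜 V (B v) = (Module.finrank 𝕜 V + 1 : 𝕜) * θ v := by
    have hBv : B v = θ v • LinearMap.id + θ.smulRight v := by
      ext w; simp [hθ]
    rw [hBv, map_add, map_smul, LinearMap.trace_id, LinearMap.trace_smulRight, smul_eq_mul]
    ring
  have hn : (Module.finrank 𝕜 V + 1 : 𝕜) ≠ 0 := Nat.cast_add_one_ne_zero _
  ext v w
  rw [traceFree_apply, htrace, htrace, hθ, inv_mul_cancel_left₀ hn, inv_mul_cancel_left₀ hn,
    sub_self, LinearMap.zero_apply, LinearMap.zero_apply]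

variable (B) in
theorem trace_traceFree (v : V) : LinearMap.trace 𝕜 V (traceFree B v) = 0 := by
  let c : 𝕜 := (Module.finrank 𝕜 V + 1 : 𝕜)⁻¹
  let t : V →ₗ[𝕜] 𝕜 := LinearMap.trace 𝕜 V ∘ₗ B
  have hn : (Module.finrank 𝕜 V + 1 : 𝕜) ≠ 0 := Nat.cast_add_one_ne_zero _
  have hBv : traceFree B v = B v - ((c * t v) • LinearMap.id + (c • t).smulRight v) := by
    ext w
    simp [traceFree_apply, c, t]
  rw [hBv, map_sub, map_add, map_smul, LinearMap.trace_id, LinearMap.trace_smulRight]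
  simp only [c, t, LinearMap.comp_apply, LinearMap.smul_apply, smul_eq_mul]
  field_simp
  ring

end TraceFree

section ProjEquiv
open Bundle TopologicalSpace

variable {E : Type*} [NormedAddCommGroup E] [NormedSpace ℂ E] [FiniteDimensional ℂ E]
  {H : Type*} [TopologicalSpace H] {I : ModelWithCorners ℂ E H}
  {M : Type*} [TopologicalSpace M] [ChartedSpace H M] [IsManifold I ω M]

theorem isHolomorphicOneFormOn_of_pure
    {B : Π x : M, TangentSpace I x → TangentSpace I x → TangentSpace I x}
    {θ : Π x : M, TangentSpace I x →L[ℂ] ℂ} {U : Set M} (hU : IsOpen U)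
    (hB : ∀ x ∈ U, IsHolomorphicTensorAt B x)
    (h : ∀ x ∈ U, ∀ v w, B x v w = θ x v • w + θ x w • v) : IsHolomorphicOneFormOn I θ U := by
  intro x hx
  let b := Module.finBasis ℂ E
  let t := trivializationAt E (TangentSpace I : M → Type _) x
  have hxt : x ∈ t.baseSet := mem_baseSet_trivializationAt E (TangentSpace I) x
  refine (contMDiffAt_hom_of_localFrame (V₂ := Trivial M ℂ) b fun i => ?_).contMDiffWithinAt
  have hs : ContMDiffAt I I.tangent ω (T% (t.localFrame b i)) x :=
    contMDiffAt_localFrame_of_mem ω t b i hxt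
  have hcoeff := contMDiffAt_localFrameCoeff b hxt (hB x hx _ _ hs hs) i
  rw [contMDiffAt_section]
  refine ((contMDiffAt_const (c := (2⁻¹ : ℂ))).mul hcoeff).congr_of_eventuallyEq ?_
  filter_upwards [hU.mem_nhds hx, t.open_baseSet.mem_nhds hxt] with y hyU hyt
  have hself : t.localFrameCoeff I b i y (t.localFrame b i y) = 1 := by
    rw [t.localFrameCoeff_apply_of_mem_baseSet b hyt, t.localFrame_apply_of_mem_baseSet b hyt,
      Module.Basis.repr_self, Finsupp.single_eq_same]
  simp only [LinearMap.piApply_apply_apply, Pi.mul_apply, h y hyU, map_add, map_smul, hself]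
  simp [t, ← two_mul]

namespace LocalAffineConnection

variable {r s : LocalAffineConnection I M}

theorem exists_oneForm_iff_isPureTensor
    {Θ : Π x : M, TangentSpace I x → TangentSpace I x → TangentSpace I x}
    (hΘ : ∀ x ∈ r.domain ⊓ s.domain, IsHolomorphicTensorAt Θ x) :
    (∃ θ : Π x : M, TangentSpace I x →L[ℂ] ℂ,
      IsHolomorphicOneFormOn I θ (r.domain ⊓ s.domain : Opens M) ∧
      ∀ x ∈ r.domain ⊓ s.domain, ∀ Y : Π x : M, TangentSpace I x,
        MDifferentiableAt I I.tangent (T% Y) x → ∀ v : TangentSpace I x,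
        r.cov Y x v = s.cov Y x v + Θ x (Y x) v + (θ x v • Y x + θ x (Y x) • v)) ↔
    ∀ x ∈ r.domain ⊓ s.domain, IsPureTensor ℂ fun v w => r.diff s x v w - Θ x v w := by
  constructor
  · rintro ⟨θ, -, hθ⟩ x hx
    refine ⟨θ x, fun v w => ?_⟩
    have hv := hθ x hx _ (FiberBundle.mdifferentiableAt_extend I E v) w
    rw [FiberBundle.extend_apply_self] at hv
    simp only [diff_eq_cov_extend hx.1 hx.2, sub_apply, hv, ContinuousLinearMap.coe_coe]
    abel
  · intro hpure
    have hform (x : M) : ∃ θ : TangentSpace I x →L[ℂ] ℂ, x ∈ r.domain ⊓ s.domain →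
        ∀ v w, r.diff s x v w - Θ x v w = θ v • w + θ w • v := by
      by_cases hx : x ∈ r.domain ⊓ s.domain
      · obtain ⟨θ, hθ⟩ := hpure x hx
        have : FiniteDimensional ℂ (TangentSpace I x) := inferInstanceAs (FiniteDimensional ℂ E)
        have : T2Space (TangentSpace I x) := inferInstanceAs (T2Space E)
        exact ⟨LinearMap.toContinuousLinearMap θ, fun _ => hθ⟩
      · exact ⟨0, fun h => absurd h hx⟩
    choose θ hθ using hform
    refine ⟨θ, isHolomorphicOneFormOn_of_pure (r.domain ⊓ s.domain).isOpen
      (fun x hx V W hV hW => (isHolomorphicTensorAt_diff hx.1 hx.2 V W hV hW).sub_section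
        (hΘ x hx V W hV hW)) hθ, fun x hx Y hY v => ?_⟩
    rw [add_assoc, ← sub_eq_iff_eq_add', add_comm (θ x v • Y x), ← sub_apply,
      ← diff_apply hx.1 hx.2 hY, ← sub_eq_iff_eq_add', hθ x hx, add_comm]

theorem projEquiv_iff_isPureTensor :
    r.ProjEquiv s ↔ ∀ x ∈ r.domain ⊓ s.domain, IsPureTensor ℂ fun v w => r.diff s x v w := by
  have h := exists_oneForm_iff_isPureTensor (r := r) (s := s) (Θ := fun _ _ _ => 0)
    fun x _ _ _ _ _ => contMDiff_zeroSection ℂ (TangentSpace I : M → Type _) x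
  simp only [sub_zero, add_zero] at h
  exact h

end LocalAffineConnection
end ProjEquiv

/-! ### Changes of coordinates -/

section ChangeOfChart

section Transition

variable {𝕜 : Type*} [NontriviallyNormedField 𝕜]
  {E : Type*} [NormedAddCommGroup E] [NormedSpace 𝕜 E]
  {H : Type*} [TopologicalSpace H] {I : ModelWithCorners 𝕜 E H}
  {M : Type*} [TopologicalSpace M] [ChartedSpace H M]
  {F F' : Type*} [NormedAddCommGroup F] [NormedSpace 𝕜 F] [NormedAddCommGroup F']
  [NormedSpace 𝕜 F'] {x : M}

theorem mvfderiv_comp_of_hasFDerivAt {k : M → F} {G : F → F'} {G' : F →L[𝕜] F'}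
    (hG : HasFDerivAt G G' (k x)) (hk : MDifferentiableAt I 𝓘(𝕜, F) k x) (v : TangentSpace I x) :
    mvfderiv I (fun y => G (k y)) x v = G' (mvfderiv I k x v) :=
  congrArg (fun L => L v) (hG.hasMFDerivAt.comp x hk.hasMFDerivAt).mfderiv

variable {e e' : OpenPartialHomeomorph M H} {T : E → E}

theorem coordDeriv_of_transition (he : e ∈ IsManifold.maximalAtlas I ω M) (hx : x ∈ e.source)
    (h : e'.extend I =ᶠ[𝓝 x] fun y => T (e.extend I y))
    (hT : DifferentiableAt 𝕜 T (e.extend I x)) (v : TangentSpace I x) :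
    coordDeriv I e' x v = fderiv 𝕜 T (e.extend I x) (coordDeriv I e x v) :=
  (congrArg (fun L : TangentSpace I x →L[𝕜] E => L v) h.mfderiv_eq).trans
    (mvfderiv_comp_of_hasFDerivAt hT.hasFDerivAt
      ((e.contMDiffAt_extend he hx).mdifferentiableAt (by simp)) v)

theorem mvfderiv_coordDeriv_of_transition [IsManifold I ω M] [I.Boundaryless]
    (he : e ∈ IsManifold.maximalAtlas I ω M) (hx : x ∈ e.source)
    (h : e'.extend I =ᶠ[𝓝 x] fun y => T (e.extend I y)) (hT : ContDiffAt 𝕜 ω T (e.extend I x))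
    {Y : Π x : M, TangentSpace I x} (hY : MDifferentiableAt I I.tangent (T% Y) x)
    (v : TangentSpace I x) :
    mvfderiv I (fun y => coordDeriv I e' y (Y y)) x v =
      fderiv 𝕜 T (e.extend I x) (mvfderiv I (fun y => coordDeriv I e y (Y y)) x v) +
        fderiv 𝕜 (fderiv 𝕜 T) (e.extend I x) (coordDeriv I e x v) (coordDeriv I e x (Y x)) := by
  have hcont : ContinuousAt (e.extend I) x := e.continuousAt_extend hx
  have hfield : (fun y => coordDeriv I e' y (Y y)) =ᶠ[𝓝 x]
      fun y => fderiv 𝕜 T (e.extend I y) (coordField I e Y (e.extend I y)) := by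
    filter_upwards [h.eventuallyEq_nhds, hcont.eventually (hT.eventually (by simp)),
      e.open_source.mem_nhds hx] with y hy hTy hye
    rw [coordDeriv_of_transition he hye hy (hTy.differentiableAt (by simp)), coordField,
      e.extend_left_inv hye]
  have hT' : HasFDerivAt (fderiv 𝕜 T) (fderiv 𝕜 (fderiv 𝕜 T) (e.extend I x)) (e.extend I x) :=
    ((hT.fderiv_right (m := ω) (by simp)).differentiableAt (by simp)).hasFDerivAt
  have hYx : coordField I e Y (e.extend I x) = coordDeriv I e x (Y x) := by
    rw [coordField, e.extend_left_inv hx]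
  have hYd := (mdifferentiableAt_coordField he hx hY).differentiableAt.hasFDerivAt
  have hcomp := mvfderiv_comp_of_hasFDerivAt (hT'.clm_apply hYd)
    ((e.contMDiffAt_extend he hx).mdifferentiableAt (by simp)) v
  rw [mvfderiv, hfield.mfderiv_eq, mvfderiv_coordDeriv_apply he hx hY]
  rw [hYx] at hcomp
  exact hcomp

end Transition

variable {E : Type*} [NormedAddCommGroup E] [NormedSpace ℂ E] [FiniteDimensional ℂ E]
  {H : Type*} [TopologicalSpace H] {I : ModelWithCorners ℂ E H} [I.Boundaryless]
  {M : Type*} [TopologicalSpace M] [ChartedSpace H M] [IsManifold I ω M]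

theorem flatConnection_diff {e e' : OpenPartialHomeomorph M H}
    (he : e ∈ IsManifold.maximalAtlas I ω M) (he' : e' ∈ IsManifold.maximalAtlas I ω M) {x : M}
    (hx : x ∈ e.source) (hx' : x ∈ e'.source) {T : E → E} (hT : ContDiffAt ℂ ω T (e.extend I x))
    (h : e'.extend I =ᶠ[𝓝 x] fun y => T (e.extend I y)) {B : E → E → E}
    (hB : ∀ v w, fderiv ℂ (fderiv ℂ T) (e.extend I x) v w = fderiv ℂ T (e.extend I x) (B v w))
    (v w : TangentSpace I x) :
    (flatConnection e' he').diff (flatConnection e he) x w v =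
      coordInv I e x (B (coordDeriv I e x v) (coordDeriv I e x w)) := by
  let Y := FiberBundle.extend E w
  have hY : MDifferentiableAt I I.tangent (T% Y) x := FiberBundle.mdifferentiableAt_extend I E w
  have hYx : Y x = w := FiberBundle.extend_apply_self E w
  have hcov : (flatConnection e' he').cov Y x v = (flatConnection e he).cov Y x v +
      coordInv I e x (B (coordDeriv I e x v) (coordDeriv I e x w)) := by
    rw [← coordInv_coordDeriv he' hx' ((flatConnection e he).cov Y x v +
        coordInv I e x (B (coordDeriv I e x v) (coordDeriv I e x w))),
      coordDeriv_of_transition he hx h (hT.differentiableAt (by simp)), map_add,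
      coordDeriv_coordInv he hx, map_add, ← hB, ← hYx]
    refine congrArg (coordInv I e' x)
      ((mvfderiv_coordDeriv_of_transition he hx h hT hY v).trans ?_)
    exact congrArg (fun u => fderiv ℂ T (e.extend I x) u + _)
      (coordDeriv_coordInv he hx _).symm
  rw [LocalAffineConnection.diff_eq_cov_extend (r := flatConnection e' he')
    (s := flatConnection e he) hx' hx, sub_apply, sub_eq_iff_eq_add', hcov]

end ChangeOfChart

section ProjectiveMap

variable {𝕜 E F : Type*} [RCLike 𝕜] [NormedAddCommGroup E] [NormedSpace 𝕜 E]
  [NormedAddCommGroup F] [NormedSpace 𝕜 F] (L : E →L[𝕜] F) (L₀ : F) (j : E →L[𝕜] 𝕜) (j₀ : 𝕜)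

/-- The fractional linear map `u ↦ (L u + L₀) / (j u + j₀)`. -/
noncomputable def projMap (u : E) : F := (j u + j₀)⁻¹ • (L u + L₀)

variable {L L₀ j j₀} {u : E}

theorem contDiffAt_projMap (h : j u + j₀ ≠ 0) : ContDiffAt 𝕜 ω (projMap L L₀ j j₀) u := by
  have hden : ContDiffAt 𝕜 ω (fun u => j u + j₀) u := by fun_prop
  have hnum : ContDiffAt 𝕜 ω (fun u => L u + L₀) u := by fun_prop
  exact (hden.inv h).smul hnum

theorem hasFDerivAt_inv_affine (h : j u + j₀ ≠ 0) :
    HasFDerivAt (fun u => (j u + j₀)⁻¹) (-((j u + j₀)⁻¹) ^ 2 • j) u := by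
  have hinv := (hasDerivAt_inv h).comp_hasFDerivAt u (j.hasFDerivAt.add_const j₀)
  rwa [← inv_pow] at hinv

theorem fderiv_projMap (h : j u + j₀ ≠ 0) (v : E) : fderiv 𝕜 (projMap L L₀ j j₀) u v =
    (j u + j₀)⁻¹ • L v - ((j u + j₀)⁻¹ ^ 2 * j v) • (L u + L₀) := by
  have hd := ((hasFDerivAt_inv_affine h).smul (L.hasFDerivAt.add_const L₀)).fderiv
  refine (congrArg (fun L => L v) hd).trans ?_
  simp only [add_apply, smul_apply, ContinuousLinearMap.smulRight_apply, smul_eq_mul]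
  module

theorem fderiv_fderiv_projMap (h : j u + j₀ ≠ 0) (v w : E) :
    fderiv 𝕜 (fderiv 𝕜 (projMap L L₀ j j₀)) u v w =
      fderiv 𝕜 (projMap L L₀ j j₀) u
        (-((j u + j₀)⁻¹ * j v) • w + -((j u + j₀)⁻¹ * j w) • v) := by
  have hd : DifferentiableAt 𝕜 (fderiv 𝕜 (projMap L L₀ j j₀)) u :=
    ((contDiffAt_projMap h).fderiv_right (m := ω) (by simp)).differentiableAt (by simp)
  have hswap : fderiv 𝕜 (fderiv 𝕜 (projMap L L₀ j j₀)) u v w =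
      fderiv 𝕜 (fun u => fderiv 𝕜 (projMap L L₀ j j₀) u w) u v := by
    rw [fderiv_clm_apply hd (differentiableAt_const w)]
    simp
  have hev : (fun u => fderiv 𝕜 (projMap L L₀ j j₀) u w) =ᶠ[𝓝 u] fun u =>
      (j u + j₀)⁻¹ • L w - ((((j u + j₀)⁻¹) ^ 2) * j w) • (L u + L₀) := by
    have hcont : ContinuousAt (fun u => j u + j₀) u := by fun_prop
    filter_upwards [hcont.eventually_ne h] with y hy
    rw [fderiv_projMap hy]
  have hinv := hasFDerivAt_inv_affine h
  have hquot := (hinv.smul_const (L w)).sub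
    (((hinv.pow 2).mul_const (j w)).smul (L.hasFDerivAt.add_const L₀))
  rw [hswap, hev.fderiv_eq]
  refine (congrArg (fun L => L v) hquot.fderiv).trans ?_
  rw [map_add, map_smul, map_smul, fderiv_projMap h, fderiv_projMap h]
  simp only [sub_apply, add_apply, smul_apply, ContinuousLinearMap.smulRight_apply, smul_eq_mul]
  module

end ProjectiveMap

/-! ### The covering of an orbit quotient -/

section OrbitCovering

variable {E H M G : Type*} [NormedAddCommGroup E] [NormedSpace ℂ E] [TopologicalSpace H]
  {I : ModelWithCorners ℂ E H} [TopologicalSpace M] [ChartedSpace H M] [Group G] [MulAction G M]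
  [ProperlyDiscontinuousSMul G M] [ContinuousConstSMul G M] [IsCancelSMul G M]
  [T2Space M] [LocallyCompactSpace M]

variable (M G) in
theorem isLocalHomeomorph_orbitQuotient :
    IsLocalHomeomorph (Quotient.mk (MulAction.orbitRel G M)) :=
  (isQuotientCoveringMap_quotientMk_of_properlyDiscontinuousSMul (G := G)
    (E := M)).isCoveringMap.isLocalHomeomorph

variable (G) in
/-- The local inverse at `b` of the projection to the orbit quotient. -/
noncomputable def orbitLift (b : M) : OpenPartialHomeomorph (MulAction.orbitRel.Quotient G M) M :=
  (isLocalHomeomorph_orbitQuotient M G).localInverseAt b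

theorem exists_chartAt_orbitQuotient (p : MulAction.orbitRel.Quotient G M) :
    ∃ b : M, chartAt H p = (orbitLift G b).trans (chartAt H b) ∧ p = Quotient.mk _ b := by
  have hsurj : Function.HasRightInverse (Quotient.mk (MulAction.orbitRel G M)) :=
    Function.Surjective.hasRightInverse Quotient.mk_surjective
  exact ⟨hsurj.choose p, rfl, (hsurj.choose_spec p).symm⟩

theorem orbitLift_mk_self (b : M) : orbitLift G b (Quotient.mk _ b) = b :=
  (isLocalHomeomorph_orbitQuotient M G).localInverseAt_apply_self

theorem mk_mem_orbitLift_source (b : M) : Quotient.mk _ b ∈ (orbitLift G b).source :=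
  (isLocalHomeomorph_orbitQuotient M G).apply_self_mem_localInverseAt_source

theorem mk_orbitLift {b : M} {p : MulAction.orbitRel.Quotient G M}
    (hp : p ∈ (orbitLift G b).source) : Quotient.mk _ (orbitLift G b p) = p :=
  (isLocalHomeomorph_orbitQuotient M G).apply_localInverseAt_of_mem hp

theorem orbitLift_symm (b : M) :
    (orbitLift G b).symm = Quotient.mk (MulAction.orbitRel G M) :=
  (isLocalHomeomorph_orbitQuotient M G).localInverseAt_symm b

theorem exists_smul_eq_orbitLift {b x : M} (hx : Quotient.mk _ x ∈ (orbitLift G b).source) :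
    ∃ g : G, g • x = orbitLift G b (Quotient.mk _ x) := by
  obtain ⟨g, hg⟩ : orbitLift G b (Quotient.mk _ x) ∈ MulAction.orbit G x :=
    Quotient.exact (mk_orbitLift hx)
  exact ⟨g, hg⟩

theorem eventually_orbitLift_mk {b x : M} {g : G} (hx : Quotient.mk _ x ∈ (orbitLift G b).source)
    (hg : g • x = orbitLift G b (Quotient.mk _ x)) :
    ∀ᶠ z in 𝓝 x, orbitLift G b (Quotient.mk _ z) = g • z := by
  have htarget : ∀ᶠ z in 𝓝 x, g • z ∈ (orbitLift G b).target :=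
    (continuous_const_smul g).continuousAt.eventually_mem
      ((orbitLift G b).open_target.mem_nhds (hg ▸ (orbitLift G b).map_source hx))
  filter_upwards [htarget] with z hz
  have hmk : Quotient.mk (MulAction.orbitRel G M) (g • z) = Quotient.mk _ z :=
    Quotient.sound ⟨g, rfl⟩
  rw [← hmk, ← orbitLift_symm b, (orbitLift G b).right_inv hz]

theorem eventually_mk_of_eventually {x : M} {p : MulAction.orbitRel.Quotient G M → Prop}
    (h : ∀ᶠ z in 𝓝 x, p (Quotient.mk _ z)) : ∀ᶠ q in 𝓝 (Quotient.mk _ x), p q := by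
  rw [← (isLocalHomeomorph_orbitQuotient M G).map_nhds_eq x]
  exact h

theorem contMDiff_orbitQuotient_mk (hG : ∀ g : G, ContMDiff I I ω (fun x : M => g • x)) :
    ContMDiff I I ω (Quotient.mk (MulAction.orbitRel G M)) := by
  intro x
  rw [contMDiffAt_iff_target]
  refine ⟨(isLocalHomeomorph_orbitQuotient M G).continuous.continuousAt, ?_⟩
  obtain ⟨b, hb, hbx⟩ :=
    exists_chartAt_orbitQuotient (H := H) (Quotient.mk (MulAction.orbitRel G M) x)
  have hs : Quotient.mk _ x ∈ (orbitLift G b).source := hbx ▸ mk_mem_orbitLift_source b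
  obtain ⟨g, hg⟩ := exists_smul_eq_orbitLift hs
  have hgb : g • x = b := by rw [hg, hbx, orbitLift_mk_self]
  have hchart : ContMDiffAt I 𝓘(ℂ, E) ω (fun z => extChartAt I b (g • z)) x :=
    ContMDiffAt.comp_of_eq contMDiffAt_extChartAt (hG g).contMDiffAt hgb
  refine hchart.congr_of_eventuallyEq ?_
  filter_upwards [eventually_orbitLift_mk hs hg] with z hz
  rw [Function.comp_apply, extChartAt, hb]
  simp [hz]

variable [IsManifold I ω M]

theorem contMDiffAt_orbitLift (hG : ∀ g : G, ContMDiff I I ω (fun x : M => g • x)) {b : M}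
    {p : MulAction.orbitRel.Quotient G M} (hp : p ∈ (orbitLift G b).source) :
    ContMDiffAt I I ω (orbitLift G b) p := by
  have : IsManifold I ω (MulAction.orbitRel.Quotient G M) := isManifold_orbitQuotient I hG
  obtain ⟨a, ha, rfl⟩ := exists_chartAt_orbitQuotient (H := H) p
  let q : MulAction.orbitRel.Quotient G M := Quotient.mk _ a
  obtain ⟨g, hg⟩ := exists_smul_eq_orbitLift hp
  have hchart : ContMDiffAt I I ω (chartAt H q) q :=
    contMDiffAt_of_mem_maximalAtlas (IsManifold.chart_mem_maximalAtlas _) (mem_chart_source H _)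
  have hchart_symm : ContMDiffAt I I ω (chartAt H a).symm (chartAt H q q) := by
    rw [ha, OpenPartialHomeomorph.coe_trans, Function.comp_apply, orbitLift_mk_self]
    exact contMDiffAt_symm_of_mem_maximalAtlas (IsManifold.chart_mem_maximalAtlas a)
      (mem_chart_target H a)
  refine ((hG g).contMDiffAt.comp _ (hchart_symm.comp _ hchart)).congr_of_eventuallyEq
    (eventually_mk_of_eventually ?_)
  filter_upwards [eventually_orbitLift_mk hp hg,
    eventually_orbitLift_mk (g := (1 : G)) (mk_mem_orbitLift_source a)
      (by rw [one_smul, orbitLift_mk_self]),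
    (chartAt H a).open_source.mem_nhds (mem_chart_source H a)] with z hz hz' hza
  simp only [Function.comp_apply, q, ha, OpenPartialHomeomorph.coe_trans]
  rw [hz, hz', one_smul, (chartAt H a).left_inv hza]

theorem orbitLift_trans_chartAt_mem_maximalAtlas
    (hG : ∀ g : G, ContMDiff I I ω (fun x : M => g • x)) (b : M) :
    (orbitLift G b).trans (chartAt H b) ∈
      IsManifold.maximalAtlas I ω (MulAction.orbitRel.Quotient G M) := by
  have : IsManifold I ω (MulAction.orbitRel.Quotient G M) := isManifold_orbitQuotient I hG
  refine OpenPartialHomeomorph.mem_maximalAtlas_of_contMDiffOn _ (fun p hp => ?_) fun u hu => ?_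
  · exact ((contMDiffAt_of_mem_maximalAtlas (IsManifold.chart_mem_maximalAtlas b) hp.2).comp p
      (contMDiffAt_orbitLift hG hp.1)).contMDiffWithinAt
  · rw [OpenPartialHomeomorph.coe_trans_symm, orbitLift_symm]
    exact ((contMDiff_orbitQuotient_mk hG).contMDiffAt.comp u
      (contMDiffAt_symm_of_mem_maximalAtlas (IsManifold.chart_mem_maximalAtlas b)
        hu.1)).contMDiffWithinAt

theorem mfderiv_orbitQuotient_mk_injective (hG : ∀ g : G, ContMDiff I I ω (fun x : M => g • x))
    (x : M) : Function.Injective (mfderiv I I (Quotient.mk (MulAction.orbitRel G M)) x) := by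
  have hmk : MDifferentiableAt I I (Quotient.mk (MulAction.orbitRel G M)) x :=
    (contMDiff_orbitQuotient_mk hG).contMDiffAt.mdifferentiableAt (n := ω) (by simp)
  have hlift : MDifferentiableAt I I (orbitLift G x) (Quotient.mk (MulAction.orbitRel G M) x) :=
    (contMDiffAt_orbitLift hG (mk_mem_orbitLift_source x)).mdifferentiableAt (by simp)
  have hid : orbitLift G x ∘ Quotient.mk (MulAction.orbitRel G M) =ᶠ[𝓝 x] id := by
    filter_upwards [eventually_orbitLift_mk (g := (1 : G)) (mk_mem_orbitLift_source x)
      (by rw [one_smul, orbitLift_mk_self])] with z hz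
    rw [Function.comp_apply, hz, one_smul, id]
  have hcomp := (mfderiv_comp x hlift hmk).symm.trans (hid.mfderiv_eq.trans mfderiv_id)
  exact Function.LeftInverse.injective
    (g := mfderiv I I (orbitLift G x) (Quotient.mk (MulAction.orbitRel G M) x))
    fun v => congrArg (fun L : TangentSpace I x →L[ℂ] E => L v) hcomp

end OrbitCovering

/-! ### Quasi-periodic functions and invariant tensors on a fibre -/

theorem add_sum_int_smul_of_periods {ι V W : Type*} [AddCommGroup V] {f : V → W} {u : ι → V}
    (h : ∀ i z, f (z + u i) = f z) (s : Finset ι) (n : ι → ℤ)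
    (z : V) : f (z + ∑ i ∈ s, n i • u i) = f z := by
  induction s using Finset.cons_induction generalizing z with
  | empty => simp
  | cons i s hi ih =>
    rw [Finset.sum_cons, ← add_assoc, ih]
    exact Function.Periodic.zsmul (h i) (n i) z

section Periods
variable {ι V W : Type*} [Finite ι] [NormedAddCommGroup V] [NormedSpace ℂ V]
  [NormedAddCommGroup W] [NormedSpace ℂ W] {f : V → W} {u : ι → V}

theorem apply_eq_apply_of_periods (hu : Submodule.span ℝ (Set.range u) = ⊤)
    (hf : Differentiable ℂ f) (h : ∀ i z, f (z + u i) = f z) (z z' : V) : f z = f z' := by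
  have := Fintype.ofFinite ι
  refine hf.apply_eq_apply_of_bounded ?_ z z'
  have hcompact : IsCompact (Set.univ.pi fun _ : ι => Set.Icc (0 : ℝ) 1) :=
    isCompact_univ_pi fun _ => isCompact_Icc
  have hcont : Continuous fun t : ι → ℝ => f (∑ i, t i • u i) :=
    hf.continuous.comp (by fun_prop)
  refine (hcompact.image hcont).isBounded.subset ?_
  rintro _ ⟨z, rfl⟩
  obtain ⟨t, rfl⟩ := (Submodule.mem_span_range_iff_exists_fun ℝ).1
    (hu ▸ Submodule.mem_top : z ∈ Submodule.span ℝ (Set.range u))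
  refine ⟨fun i => Int.fract (t i),
    fun i _ => ⟨Int.fract_nonneg _, (Int.fract_lt_one _).le⟩, ?_⟩
  have hsum : ∑ i, t i • u i = ∑ i, Int.fract (t i) • u i + ∑ i, ⌊t i⌋ • u i := by
    simp only [← Finset.sum_add_distrib, ← Int.cast_smul_eq_zsmul ℝ, ← add_smul,
      Int.fract_add_floor]
  beta_reduce
  rw [hsum, add_sum_int_smul_of_periods h]

theorem exists_eq_add_of_quasiPeriods (hu : Submodule.span ℝ (Set.range u) = ⊤)
    (hf : ContDiff ℂ ω f) {c : ι → W} (h : ∀ i z, f (z + u i) = f z + c i) :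
    ∃ ℓ : V →L[ℂ] W, (∀ z, f z = f 0 + ℓ z) ∧ ∀ i, ℓ (u i) = c i := by
  have hdiff : Differentiable ℂ f := hf.differentiable (by simp)
  have hfderiv : ∀ z, fderiv ℂ f z = fderiv ℂ f 0 := by
    refine fun z => apply_eq_apply_of_periods hu
      ((hf.fderiv_right (m := ω) (by simp)).differentiable (by simp)) (fun i z => ?_) z 0
    rw [← fderiv_comp_add_right]
    simp_rw [h i]
    rw [fderiv_add_const]
  have haffine : ∀ z, f z = f 0 + fderiv ℂ f 0 z := by
    intro z
    have hconst := is_const_of_fderiv_eq_zero (𝕜 := ℂ)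
      (hdiff.sub (fderiv ℂ f 0).differentiable) (fun z => by
        rw [fderiv_sub (hdiff z) (fderiv ℂ f 0).differentiableAt, hfderiv,
          ContinuousLinearMap.fderiv, sub_self]) z 0
    simpa [sub_eq_iff_eq_add] using hconst
  refine ⟨fderiv ℂ f 0, haffine, fun i => ?_⟩
  have hperiod := h i 0
  rwa [zero_add, haffine, add_right_inj] at hperiod

end Periods

/-- The period `X · (τ, 1)ᵗ` of a matrix `X`. -/
noncomputable def periodVec (τ : ℍ) : Matrix (Fin 2) (Fin 2) ℝ →ₗ[ℝ] ℂ × ℂ where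
  toFun X := ((X 0 0 : ℂ) * τ + (X 0 1 : ℂ), (X 1 0 : ℂ) * τ + (X 1 1 : ℂ))
  map_add' X Y := by ext1 <;> simp <;> ring
  map_smul' c X := by ext1 <;> simp <;> ring

/-- The first column of a real matrix `X`, as a complex vector: the derivative in `τ` of the period
of `X`. -/
noncomputable def periodSlope : Matrix (Fin 2) (Fin 2) ℝ →ₗ[ℝ] ℂ × ℂ where
  toFun X := ((X 0 0 : ℂ), (X 1 0 : ℂ))
  map_add' X Y := by simp
  map_smul' c X := by simp

theorem periodVec_surjective (τ : ℍ) : Function.Surjective (periodVec τ) := by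
  have exists_coords : ∀ z : ℂ, ∃ m n : ℝ, (m : ℂ) * τ + n = z := fun z => by
    refine ⟨z.im / τ.im, z.re - z.im / τ.im * τ.re, ?_⟩
    have := τ.im_ne_zero
    apply Complex.ext <;> simp [this]
  rintro ⟨z, w⟩
  obtain ⟨m, n, hz⟩ := exists_coords z
  obtain ⟨k, l, hw⟩ := exists_coords w
  exact ⟨!![m, n; k, l], Prod.ext (by simpa [periodVec] using hz) (by simpa [periodVec] using hw)⟩

section Basis
variable {ι W : Type*} [NormedAddCommGroup W] [NormedSpace ℂ W] {τ : ℍ} {f : ℂ × ℂ → W}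
  (b : Module.Basis ι ℝ (Matrix (Fin 2) (Fin 2) ℝ))

theorem span_range_periodVec_basis (τ : ℍ) :
    Submodule.span ℝ (Set.range fun i => periodVec τ (b i)) = ⊤ := by
  rw [Set.range_comp' (periodVec τ), Submodule.span_image, b.span_eq, Submodule.map_top,
    LinearMap.range_eq_top.2 (periodVec_surjective τ)]

theorem apply_eq_apply_of_periodVec [Finite ι] (τ : ℍ) (hf : Differentiable ℂ f)
    (h : ∀ i z, f (z + periodVec τ (b i)) = f z) (z z' : ℂ × ℂ) : f z = f z' :=
  apply_eq_apply_of_periods (span_range_periodVec_basis b τ) hf h z z'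

theorem eq_zero_of_periodVec_eq_periodSlope {ℓ φ : ℂ × ℂ →ₗ[ℂ] W}
    (h : ∀ X, ℓ (periodVec τ X) = φ (periodSlope X)) : φ = 0 := by
  have hℓ₁ : ℓ (1, 0) = 0 := by
    simpa [periodVec, periodSlope, Prod.mk_zero_zero] using h !![0, 1; 0, 0]
  have hℓ₂ : ℓ (0, 1) = 0 := by
    simpa [periodVec, periodSlope, Prod.mk_zero_zero] using h !![0, 0; 0, 1]
  have hℓ : ℓ = 0 := by ext <;> simp [hℓ₁, hℓ₂]
  have hφ₁ : φ (1, 0) = 0 := by simpa [periodSlope, hℓ] using (h !![1, 0; 0, 0]).symm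
  have hφ₂ : φ (0, 1) = 0 := by simpa [periodSlope, hℓ] using (h !![0, 0; 1, 0]).symm
  ext <;> simp [hφ₁, hφ₂]

theorem eq_zero_of_quasiPeriodic [Finite ι] (τ : ℍ) (hf : ContDiff ℂ ω f)
    {φ : ℂ × ℂ →ₗ[ℂ] W}
    (h : ∀ i z, f (z + periodVec τ (b i)) = f z + φ (periodSlope (b i))) :
    φ = 0 := by
  obtain ⟨ℓ, -, hℓ⟩ :=
    exists_eq_add_of_quasiPeriods (span_range_periodVec_basis b τ) hf h
  have hlin : (ℓ : ℂ × ℂ →ₗ[ℂ] W).restrictScalars ℝ ∘ₗ periodVec τ =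
      φ.restrictScalars ℝ ∘ₗ periodSlope := b.ext hℓ
  exact eq_zero_of_periodVec_eq_periodSlope (LinearMap.congr_fun hlin)

end Basis

/-- A family `T` of symmetric bilinear maps on `ℂ × ℂ²`, holomorphic in `z ∈ ℂ²`, that is invariant
under the lattice spanned by `b`: the matrix `X` acts on the tangent spaces of the fibre over `τ` by
`v ↦ v + v₁ · (0, X · (1, 0)ᵗ)`, the derivative of `(τ, z) ↦ (τ, z + X · (τ, 1)ᵗ)`. -/
structure IsInvariantTensor {ι : Type*} (b : Module.Basis ι ℝ (Matrix (Fin 2) (Fin 2) ℝ)) (τ : ℍ)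
    (T : ℂ × ℂ → (ℂ × ℂ × ℂ) →ₗ[ℂ] (ℂ × ℂ × ℂ) →ₗ[ℂ] (ℂ × ℂ × ℂ)) : Prop where
  contDiff : ∀ v w, ContDiff ℂ ω fun z => T z v w
  symm : ∀ z v w, T z v w = T z w v
  invariant : ∀ i z v w,
    T (z + periodVec τ (b i)) (v + (0, v.1 • periodSlope (b i)))
      (w + (0, w.1 • periodSlope (b i))) =
    T z v w + (0, (T z v w).1 • periodSlope (b i))

namespace IsInvariantTensor
variable {ι : Type*} {b : Module.Basis ι ℝ (Matrix (Fin 2) (Fin 2) ℝ)} {τ : ℍ}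
  {T : ℂ × ℂ → (ℂ × ℂ × ℂ) →ₗ[ℂ] (ℂ × ℂ × ℂ) →ₗ[ℂ] (ℂ × ℂ × ℂ)}

theorem apply_vert_vert_add (hT : IsInvariantTensor b τ T) (i : ι) (z s t : ℂ × ℂ) :
    T (z + periodVec τ (b i)) (0, s) (0, t) =
      T z (0, s) (0, t) + (0, (T z (0, s) (0, t)).1 • periodSlope (b i)) := by
  simpa using hT.invariant i z (0, s) (0, t)

theorem apply_horiz_vert_add (hT : IsInvariantTensor b τ T) (i : ι) (z t : ℂ × ℂ) :
    T (z + periodVec τ (b i)) (1, 0) (0, t) =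
      T z (1, 0) (0, t) + (0, (T z (1, 0) (0, t)).1 • periodSlope (b i)) -
        T (z + periodVec τ (b i)) (0, periodSlope (b i)) (0, t) := by
  have hinv := hT.invariant i z (1, 0) (0, t)
  simp only [one_smul, zero_smul, Prod.mk_zero_zero, add_zero, map_add,
    LinearMap.add_apply] at hinv
  exact eq_sub_of_add_eq hinv

theorem apply_horiz_horiz_add (hT : IsInvariantTensor b τ T) (i : ι) (z : ℂ × ℂ) :
    T (z + periodVec τ (b i)) (1, 0) (1, 0) =
      T z (1, 0) (1, 0) + (0, (T z (1, 0) (1, 0)).1 • periodSlope (b i)) -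
        (2 : ℂ) • T (z + periodVec τ (b i)) (1, 0) (0, periodSlope (b i)) -
        T (z + periodVec τ (b i)) (0, periodSlope (b i)) (0, periodSlope (b i)) := by
  have hinv := hT.invariant i z (1, 0) (1, 0)
  simp only [one_smul, map_add, LinearMap.add_apply] at hinv
  rw [← hinv, hT.symm _ (0, periodSlope (b i)) (1, 0), two_smul]
  abel

variable [Finite ι]

theorem fst_apply_vert_vert (hT : IsInvariantTensor b τ T) (z s t : ℂ × ℂ) :
    (T z (0, s) (0, t)).1 = 0 := by
  have hconst : ∀ s z, (T z (0, s) (0, t)).1 = (T 0 (0, s) (0, t)).1 := fun s z =>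
    apply_eq_apply_of_periodVec b τ ((hT.contDiff _ _).fst.differentiable (by simp))
      (fun i z => by simp [hT.apply_vert_vert_add]) z 0
  have hzero := eq_zero_of_quasiPeriodic b τ (hT.contDiff (1, 0) (0, t)).fst
    (φ := -(LinearMap.fst ℂ ℂ (ℂ × ℂ) ∘ₗ (T 0).flip (0, t) ∘ₗ LinearMap.inr ℂ ℂ (ℂ × ℂ)))
    (fun i z => by simp [hT.apply_horiz_vert_add, hconst, sub_eq_add_neg])
  simpa [hconst s z] using LinearMap.congr_fun hzero s

theorem fst_apply_horiz_vert (hT : IsInvariantTensor b τ T) (z t : ℂ × ℂ) :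
    (T z (1, 0) (0, t)).1 = 0 := by
  have hconst : ∀ t z, (T z (1, 0) (0, t)).1 = (T 0 (1, 0) (0, t)).1 := fun t z =>
    apply_eq_apply_of_periodVec b τ ((hT.contDiff _ _).fst.differentiable (by simp))
      (fun i z => by simp [hT.apply_horiz_vert_add, hT.fst_apply_vert_vert]) z 0
  have hzero := eq_zero_of_quasiPeriodic b τ (hT.contDiff (1, 0) (1, 0)).fst
    (φ := -((2 : ℂ) • (LinearMap.fst ℂ ℂ (ℂ × ℂ) ∘ₗ T 0 (1, 0) ∘ₗ LinearMap.inr ℂ ℂ (ℂ × ℂ))))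
    (fun i z => by
      simp [hT.apply_horiz_horiz_add, hT.fst_apply_vert_vert, hconst, sub_eq_add_neg])
  simpa [hconst t z] using LinearMap.congr_fun hzero t

theorem apply_vert_vert (hT : IsInvariantTensor b τ T) (z s t : ℂ × ℂ) :
    T z (0, s) (0, t) = 0 := by
  have hconst : ∀ s z, (T z (0, s) (0, t)).2 = (T 0 (0, s) (0, t)).2 := fun s z =>
    apply_eq_apply_of_periodVec b τ ((hT.contDiff _ _).snd.differentiable (by simp))
      (fun i z => by simp [hT.apply_vert_vert_add, hT.fst_apply_vert_vert]) z 0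
  have hzero := eq_zero_of_quasiPeriodic b τ (hT.contDiff (1, 0) (0, t)).snd
    (φ := -(LinearMap.snd ℂ ℂ (ℂ × ℂ) ∘ₗ (T 0).flip (0, t) ∘ₗ LinearMap.inr ℂ ℂ (ℂ × ℂ)))
    (fun i z => by
      simp [hT.apply_horiz_vert_add, hT.fst_apply_horiz_vert, hconst, sub_eq_add_neg])
  refine Prod.ext (hT.fst_apply_vert_vert z s t) ?_
  simpa [hconst s z] using LinearMap.congr_fun hzero s

theorem fst_apply_horiz_horiz (hT : IsInvariantTensor b τ T) (z z' : ℂ × ℂ) :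
    (T z (1, 0) (1, 0)).1 = (T z' (1, 0) (1, 0)).1 :=
  apply_eq_apply_of_periodVec b τ ((hT.contDiff _ _).fst.differentiable (by simp))
    (fun i z => by
      simp [hT.apply_horiz_horiz_add, hT.fst_apply_horiz_vert, hT.fst_apply_vert_vert]) z z'

theorem apply_horiz_vert (hT : IsInvariantTensor b τ T) (z t : ℂ × ℂ) :
    T z (1, 0) (0, t) = (0, ((T z (1, 0) (1, 0)).1 / 2) • t) := by
  have hconst : ∀ t z, (T z (1, 0) (0, t)).2 = (T 0 (1, 0) (0, t)).2 := fun t z =>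
    apply_eq_apply_of_periodVec b τ ((hT.contDiff _ _).snd.differentiable (by simp))
      (fun i z => by
        simp [hT.apply_horiz_vert_add, hT.fst_apply_horiz_vert, hT.apply_vert_vert]) z 0
  have hzero := eq_zero_of_quasiPeriodic b τ (hT.contDiff (1, 0) (1, 0)).snd
    (φ := (T 0 (1, 0) (1, 0)).1 • LinearMap.id -
      (2 : ℂ) • (LinearMap.snd ℂ ℂ (ℂ × ℂ) ∘ₗ T 0 (1, 0) ∘ₗ LinearMap.inr ℂ ℂ (ℂ × ℂ)))
    (fun i z => by
      simp [hT.apply_horiz_horiz_add, hT.apply_vert_vert, hconst, hT.fst_apply_horiz_horiz z 0,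
        add_sub_assoc])
  have hsnd : (T z (1, 0) (1, 0)).1 • t = (2 : ℂ) • (T z (1, 0) (0, t)).2 := by
    simpa [sub_eq_zero, hconst t z, hT.fst_apply_horiz_horiz z 0] using
      LinearMap.congr_fun hzero t
  refine Prod.ext (hT.fst_apply_horiz_vert z t) ?_
  simp [div_eq_inv_mul, mul_smul, hsnd]

theorem apply_horiz (hT : IsInvariantTensor b τ T) (z : ℂ × ℂ) :
    T z (1, 0) = ((T z (1, 0) (1, 0)).1 / 2) • LinearMap.id + (LinearMap.fst ℂ ℂ (ℂ × ℂ)).smulRight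
      ((T z (1, 0) (1, 0)).1 / 2, (T z (1, 0) (1, 0)).2) := by
  refine LinearMap.prod_ext (LinearMap.ext_ring ?_) (LinearMap.ext fun t => ?_)
  · ext1 <;> simp
  · simp [hT.apply_horiz_vert z t]

theorem fst_apply_horiz_horiz_of_trace (hT : IsInvariantTensor b τ T) {z : ℂ × ℂ}
    (htrace : LinearMap.trace ℂ (ℂ × ℂ × ℂ) (T z (1, 0)) = 0) : (T z (1, 0) (1, 0)).1 = 0 := by
  rw [hT.apply_horiz, map_add, map_smul, LinearMap.trace_id, LinearMap.trace_smulRight] at htrace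
  simp at htrace
  linear_combination htrace / 2

theorem apply_of_trace (hT : IsInvariantTensor b τ T)
    (htrace : ∀ z, LinearMap.trace ℂ (ℂ × ℂ × ℂ) (T z (1, 0)) = 0) (z : ℂ × ℂ)
    (v w : ℂ × ℂ × ℂ) : T z v w = (0, (v.1 * w.1) • (T 0 (1, 0) (1, 0)).2) := by
  have hfst : ∀ z, (T z (1, 0) (1, 0)).1 = 0 := fun z =>
    hT.fst_apply_horiz_horiz_of_trace (htrace z)
  have hhoriz_vert : ∀ z t, T z (1, 0) (0, t) = 0 := fun z t => by
    rw [hT.apply_horiz_vert, hfst, zero_div, zero_smul, Prod.mk_zero_zero]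
  have hsnd : (T z (1, 0) (1, 0)).2 = (T 0 (1, 0) (1, 0)).2 :=
    apply_eq_apply_of_periodVec b τ ((hT.contDiff _ _).snd.differentiable (by simp))
      (fun i z => by
        simp [hT.apply_horiz_horiz_add, hhoriz_vert, hT.apply_vert_vert, hfst]) z 0
  have hsplit : ∀ v : ℂ × ℂ × ℂ, v = v.1 • (1, 0) + (0, v.2) := fun v => by ext1 <;> simp
  calc T z v w = (v.1 * w.1) • T z (1, 0) (1, 0) := by
        conv_lhs => rw [hsplit v, hsplit w]
        simp only [map_add, map_smul, LinearMap.add_apply, LinearMap.smul_apply,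
          hT.symm z (0, v.2) (1, 0), hhoriz_vert, hT.apply_vert_vert, smul_zero, add_zero,
          smul_smul, mul_comm]
    _ = (0, (v.1 * w.1) • (T 0 (1, 0) (1, 0)).2) := by
        refine Prod.ext ?_ ?_
        · rw [Prod.smul_fst, hfst, smul_zero]
        · rw [Prod.smul_snd, hsnd]

end IsInvariantTensor

/-! ### Coordinates on the threefold -/

namespace KugaShimuraDatum

/-- The coordinates `(τ, z₁, z₂)` of a point of `ℍ × ℂ²`. -/
noncomputable def coords (x : Cover) : ℂ × ℂ × ℂ := (x.1, x.2)

theorem extChartAt_cover (b : Cover) : (extChartAt model b : Cover → ℂ × ℂ × ℂ) = coords := rfl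

theorem chartAt_cover_source (b : Cover) :
    (chartAt (ModelProd ℂ (ℂ × ℂ)) b).source = Set.univ := by
  rw [prodChartedSpace_chartAt, OpenPartialHomeomorph.prod_source, ← Set.univ_prod_univ,
    chartAt_self_eq]
  rfl

theorem mfderiv_coords (x : Cover) (v : TangentSpace model x) :
    (mfderiv model 𝓘(ℂ, ℂ × ℂ × ℂ) coords x v : ℂ × ℂ × ℂ) = v := by
  rw [← extChartAt_cover x, mfderiv_extChartAt_self]
  rfl

theorem contMDiff_coords : ContMDiff model 𝓘(ℂ, ℂ × ℂ × ℂ) ω coords := fun x => by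
  rw [← extChartAt_cover x]
  exact contMDiffAt_extChartAt

theorem mfderiv_coords_comp {E H M : Type*} [NormedAddCommGroup E] [NormedSpace ℂ E]
    [TopologicalSpace H] {I : ModelWithCorners ℂ E H} [TopologicalSpace M] [ChartedSpace H M]
    {f : M → Cover} {x : M} (hf : MDifferentiableAt I model f x) (v : TangentSpace I x) :
    (mfderiv I 𝓘(ℂ, ℂ × ℂ × ℂ) (fun y => coords (f y)) x v : ℂ × ℂ × ℂ) = mfderiv I model f x v :=
  (congrArg (fun L : TangentSpace I x →L[ℂ] ℂ × ℂ × ℂ => L v) (mfderiv_comp x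
    (contMDiff_coords.contMDiffAt.mdifferentiableAt (by simp)) hf)).trans (mfderiv_coords _ _)

variable {D : KugaShimuraDatum}

/-- The linear part of the numerators of the action of `g` in coordinates. -/
noncomputable def actNum (g : D.Grp) : ℂ × ℂ × ℂ →L[ℂ] ℂ × ℂ × ℂ :=
  LinearMap.toContinuousLinearMap
    { toFun := fun v => ((g.γ.1.1 0 0 : ℂ) * v.1, v.2.1 + (g.lam.1 0 0 : ℂ) * v.1,
        v.2.2 + (g.lam.1 1 0 : ℂ) * v.1)
      map_add' := fun v w => by ext <;> simp <;> ring
      map_smul' := fun c v => by ext <;> simp <;> ring }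

/-- The linear part of the denominator of the action of `g` in coordinates. -/
noncomputable def actDenom (g : D.Grp) : ℂ × ℂ × ℂ →L[ℂ] ℂ :=
  (g.γ.1.1 1 0 : ℂ) • ContinuousLinearMap.fst ℂ ℂ (ℂ × ℂ)

/-- The action of `g` in coordinates. -/
noncomputable def actMap (g : D.Grp) : ℂ × ℂ × ℂ → ℂ × ℂ × ℂ :=
  projMap (actNum g) ((g.γ.1.1 0 1 : ℂ), (g.lam.1 0 1 : ℂ), (g.lam.1 1 1 : ℂ)) (actDenom g)
    (g.γ.1.1 1 1 : ℂ)

theorem actDenom_coords (g : D.Grp) (x : Cover) :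
    actDenom g (coords x) + (g.γ.1.1 1 1 : ℂ) = autFactor g.γ.1 x.1 := by
  simp [actDenom, coords, autFactor]

theorem actDenom_coords_ne_zero (g : D.Grp) (x : Cover) :
    actDenom g (coords x) + (g.γ.1.1 1 1 : ℂ) ≠ 0 := by
  rw [actDenom_coords]
  exact autFactor_ne_zero _ _

theorem coords_smul (g : D.Grp) (x : Cover) : coords (g • x) = actMap g (coords x) := by
  have hmoebius : ((g.γ • x.1 : ℍ) : ℂ) =
      ((g.γ.1.1 0 0 : ℂ) * x.1 + (g.γ.1.1 0 1 : ℂ)) / autFactor g.γ.1 x.1 :=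
    UpperHalfPlane.coe_specialLinearGroup_apply g.γ.1 x.1
  rw [actMap, projMap, actDenom_coords, smul_def]
  simp only [coords, hmoebius]
  ext <;> simp [actNum] <;> ring

/-- The differential of the action in coordinates. -/
noncomputable def actDeriv (g : D.Grp) (x : Cover) : ℂ × ℂ × ℂ →L[ℂ] ℂ × ℂ × ℂ :=
  fderiv ℂ (actMap g) (coords x)

theorem contDiffAt_actMap (g : D.Grp) (x : Cover) : ContDiffAt ℂ ω (actMap g) (coords x) :=
  contDiffAt_projMap (actDenom_coords_ne_zero g x)

theorem actDeriv_apply (g : D.Grp) (x : Cover) (v : ℂ × ℂ × ℂ) : actDeriv g x v =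
    (v.1 / autFactor g.γ.1 x.1 ^ 2,
      (v.2.1 + (g.lam.1 0 0 : ℂ) * v.1) / autFactor g.γ.1 x.1 - (g.γ.1.1 1 0 : ℂ) * v.1 /
        autFactor g.γ.1 x.1 ^ 2 * (x.2.1 + ((g.lam.1 0 0 : ℂ) * x.1 + (g.lam.1 0 1 : ℂ))),
      (v.2.2 + (g.lam.1 1 0 : ℂ) * v.1) / autFactor g.γ.1 x.1 - (g.γ.1.1 1 0 : ℂ) * v.1 /
        autFactor g.γ.1 x.1 ^ 2 * (x.2.2 + ((g.lam.1 1 0 : ℂ) * x.1 + (g.lam.1 1 1 : ℂ)))) := by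
  have hfactor := autFactor_ne_zero g.γ.1 x.1
  have hdet : (g.γ.1.1 0 0 : ℂ) * g.γ.1.1 1 1 - (g.γ.1.1 0 1 : ℂ) * g.γ.1.1 1 0 = 1 := by
    have := g.γ.1.2
    rw [Matrix.det_fin_two] at this
    exact_mod_cast this
  rw [actDeriv, actMap, fderiv_projMap (actDenom_coords_ne_zero g x), actDenom_coords]
  refine Prod.ext ?_ (Prod.ext ?_ ?_)
  · simp [actNum, actDenom, coords]
    field_simp
    rw [autFactor]
    linear_combination v.1 * hdet
  · simp [actNum, actDenom, coords]
    field_simp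
    ring
  · simp [actNum, actDenom, coords]
    field_simp
    ring

theorem actDeriv_eq_mfderiv (g : D.Grp) (x : Cover) (v : TangentSpace model x) :
    (mfderiv model model (fun y : Cover => g • y) x v : ℂ × ℂ × ℂ) = actDeriv g x v := by
  refine (mfderiv_coords_comp ((D.contMDiff_smul g).contMDiffAt.mdifferentiableAt
    (by simp)) v).symm.trans ?_
  rw [funext (coords_smul g)]
  exact (mvfderiv_comp_of_hasFDerivAt
    ((contDiffAt_actMap g x).differentiableAt (by simp)).hasFDerivAt
    (contMDiff_coords.contMDiffAt.mdifferentiableAt (by simp)) v).trans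
    (congrArg (actDeriv g x) (mfderiv_coords x v))

theorem actDeriv_one (x : Cover) (v : ℂ × ℂ × ℂ) : actDeriv (1 : D.Grp) x v = v := by
  refine (actDeriv_eq_mfderiv 1 x v).symm.trans ?_
  rw [funext (one_smul D.Grp)]
  exact congrArg (fun L : TangentSpace model x →L[ℂ] TangentSpace model x => L v)
    (mfderiv_id (I := model) (x := x))

variable (D)

theorem contMDiff_proj : ContMDiff model model ω D.proj :=
  contMDiff_orbitQuotient_mk D.contMDiff_smul

variable {D} in
theorem mdifferentiableAt_proj (x : Cover) : MDifferentiableAt model model D.proj x :=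
  D.contMDiff_proj.contMDiffAt.mdifferentiableAt (by simp)

theorem proj_smul (g : D.Grp) (x : Cover) : D.proj (g • x) = D.proj x :=
  Quotient.sound ⟨g, rfl⟩

theorem proj_surjective : Function.Surjective D.proj := Quotient.mk_surjective

/-- The chart of the threefold given by the local inverse at `b` of the universal covering. -/
noncomputable def sheet (b : Cover) : OpenPartialHomeomorph D.Threefold (ModelProd ℂ (ℂ × ℂ)) :=
  (orbitLift D.Grp b).trans (chartAt _ b)

theorem sheet_mem (b : Cover) : D.sheet b ∈ IsManifold.maximalAtlas model ω D.Threefold :=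
  orbitLift_trans_chartAt_mem_maximalAtlas D.contMDiff_smul b

theorem sheet_source (b : Cover) : (D.sheet b).source = (orbitLift D.Grp b).source := by
  rw [sheet, OpenPartialHomeomorph.trans_source, chartAt_cover_source, Set.preimage_univ,
    Set.inter_univ]

theorem proj_mem_sheet_source (b : Cover) : D.proj b ∈ (D.sheet b).source := by
  rw [sheet_source]
  exact mk_mem_orbitLift_source b

theorem sheet_extend (b : Cover) (p : D.Threefold) :
    (D.sheet b).extend model p = coords (orbitLift D.Grp b p) := rfl

variable {D}

theorem proj_orbitLift {b : Cover} {p : D.Threefold} (hp : p ∈ (D.sheet b).source) :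
    D.proj (orbitLift D.Grp b p) = p :=
  mk_orbitLift (by rwa [← sheet_source])

theorem orbitLift_proj_self (x : Cover) : orbitLift D.Grp x (D.proj x) = x :=
  orbitLift_mk_self x

theorem exists_smul_eq_orbitLift_of_proj_eq {b x : Cover} {p : D.Threefold}
    (hp : p ∈ (D.sheet b).source) (hx : D.proj x = p) :
    ∃ g : D.Grp, g • x = orbitLift D.Grp b p := by
  subst hx
  exact exists_smul_eq_orbitLift (by rwa [← sheet_source])

theorem eventually_orbitLift_proj {b x : Cover} {g : D.Grp} (hx : D.proj x ∈ (D.sheet b).source)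
    (hg : g • x = orbitLift D.Grp b (D.proj x)) :
    ∀ᶠ z in 𝓝 x, orbitLift D.Grp b (D.proj z) = g • z :=
  eventually_orbitLift_mk (by rwa [← sheet_source]) hg

variable (D) in
/-- The differential of the covering at `x`, in the coordinates of `ℍ × ℂ²`. -/
noncomputable def projDeriv (x : Cover) : ℂ × ℂ × ℂ →L[ℂ] TangentSpace model (D.proj x) :=
  mfderiv model model D.proj x

theorem coordDeriv_sheet_projDeriv {b x : Cover} {g : D.Grp} (hx : D.proj x ∈ (D.sheet b).source)
    (hg : g • x = orbitLift D.Grp b (D.proj x)) (v : ℂ × ℂ × ℂ) :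
    coordDeriv model (D.sheet b) (D.proj x) (D.projDeriv x v) = actDeriv g x v := by
  have hlift : (D.sheet b).extend model ∘ D.proj =ᶠ[𝓝 x] fun z => coords (g • z) := by
    filter_upwards [eventually_orbitLift_proj hx hg] with z hz
    rw [Function.comp_apply, sheet_extend, hz]
  have hchain : mfderiv model 𝓘(ℂ, ℂ × ℂ × ℂ) (fun z => coords (g • z)) x =
      (coordDeriv model (D.sheet b) (D.proj x)).comp (D.projDeriv x) :=
    hlift.mfderiv_eq.symm.trans (mfderiv_comp x
      (((D.sheet b).contMDiffAt_extend (D.sheet_mem b) hx).mdifferentiableAt (by simp))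
      (mdifferentiableAt_proj x))
  refine (congrArg (fun L : TangentSpace model x →L[ℂ] ℂ × ℂ × ℂ => L v) hchain).symm.trans ?_
  exact (mfderiv_coords_comp ((D.contMDiff_smul g).contMDiffAt.mdifferentiableAt (by simp)) v).trans
    (actDeriv_eq_mfderiv g x v)

theorem coordInv_sheet_actDeriv {b x : Cover} {g : D.Grp} (hx : D.proj x ∈ (D.sheet b).source)
    (hg : g • x = orbitLift D.Grp b (D.proj x)) (v : ℂ × ℂ × ℂ) :
    coordInv model (D.sheet b) (D.proj x) (actDeriv g x v) = D.projDeriv x v := by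
  rw [← coordDeriv_sheet_projDeriv hx hg, coordInv_coordDeriv (D.sheet_mem b) hx]

theorem coordInv_sheet_self (x : Cover) (v : ℂ × ℂ × ℂ) :
    coordInv model (D.sheet x) (D.proj x) v = D.projDeriv x v := by
  rw [← coordInv_sheet_actDeriv (D.proj_mem_sheet_source x) (g := 1)
    (by rw [one_smul, orbitLift_proj_self]), actDeriv_one]

theorem sheet_extend_eventuallyEq {a b : Cover} {p : D.Threefold} {g : D.Grp}
    (ha : p ∈ (D.sheet a).source) (hb : p ∈ (D.sheet b).source)
    (hg : g • orbitLift D.Grp a p = orbitLift D.Grp b p) :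
    (D.sheet b).extend model =ᶠ[𝓝 p] fun q => actMap g ((D.sheet a).extend model q) := by
  obtain ⟨x, hx, rfl⟩ : ∃ x, x = orbitLift D.Grp a p ∧ D.proj x = p := ⟨_, rfl, proj_orbitLift ha⟩
  rw [← hx] at hg
  refine eventually_mk_of_eventually ?_
  filter_upwards [eventually_orbitLift_proj ha (g := 1) (by rw [one_smul, ← hx]),
    eventually_orbitLift_proj hb hg] with z hza hzb
  change (D.sheet b).extend model (D.proj z) = actMap g ((D.sheet a).extend model (D.proj z))
  rw [sheet_extend, sheet_extend, hza, hzb, one_smul, coords_smul]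

theorem coordDeriv_sheet {a b : Cover} {p : D.Threefold} {g : D.Grp}
    (ha : p ∈ (D.sheet a).source) (hb : p ∈ (D.sheet b).source)
    (hg : g • orbitLift D.Grp a p = orbitLift D.Grp b p) (v : TangentSpace model p) :
    coordDeriv model (D.sheet b) p v =
      actDeriv g (orbitLift D.Grp a p) (coordDeriv model (D.sheet a) p v) :=
  coordDeriv_of_transition (D.sheet_mem a) ha (sheet_extend_eventuallyEq ha hb hg)
    ((contDiffAt_actMap g (orbitLift D.Grp a p)).differentiableAt (by simp)) v

variable (D) in
/-- The flat connection of a sheet. -/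
noncomputable def sheetConnection (b : Cover) : LocalAffineConnection model D.Threefold :=
  flatConnection (D.sheet b) (D.sheet_mem b)

theorem isPureTensor_sheetConnection_diff {a b : Cover} {p : D.Threefold}
    (ha : p ∈ (D.sheet a).source) (hb : p ∈ (D.sheet b).source) :
    IsPureTensor ℂ fun v w => (D.sheetConnection b).diff (D.sheetConnection a) p v w := by
  obtain ⟨g, hg⟩ := exists_smul_eq_orbitLift_of_proj_eq hb (proj_orbitLift ha)
  let x := orbitLift D.Grp a p
  let θ : ℂ × ℂ × ℂ →L[ℂ] ℂ := -((actDenom g (coords x) + (g.γ.1.1 1 1 : ℂ))⁻¹ • actDenom g)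
  have hdiff := flatConnection_diff (D.sheet_mem a) (D.sheet_mem b) ha hb
    (contDiffAt_actMap g x) (sheet_extend_eventuallyEq ha hb hg)
    (B := fun v w => θ v • w + θ w • v) (fun v w =>
      (fderiv_fderiv_projMap (actDenom_coords_ne_zero g x) v w).trans (by simp [θ]; rfl))
  refine ⟨(θ.comp (coordDeriv model (D.sheet a) p)).toLinearMap, fun v w => (hdiff w v).trans ?_⟩
  rw [add_comm, map_add, map_smul, map_smul, coordInv_coordDeriv (D.sheet_mem a) ha,
    coordInv_coordDeriv (D.sheet_mem a) ha]
  rfl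

variable (D) in
/-- The projective connection on the threefold that is induced by the standard connection of
`ℂ³`. -/
noncomputable def standardConnection : HolProjConnection model D.Threefold where
  reps := Set.range D.sheetConnection
  cover p := by
    obtain ⟨x, rfl⟩ := D.proj_surjective p
    exact ⟨_, ⟨x, rfl⟩, D.proj_mem_sheet_source x⟩
  compatible := by
    rintro _ ⟨b, rfl⟩ _ ⟨a, rfl⟩
    exact LocalAffineConnection.projEquiv_iff_isPureTensor.2 fun p hp =>
      isPureTensor_sheetConnection_diff hp.2 hp.1

end KugaShimuraDatum

/-! ### The tensors of sections of `K_Σ^{3/2}` -/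

namespace KugaShimuraDatum
variable {D : KugaShimuraDatum}

theorem section_apply_congr {k : ℕ} (s : Π p, D.halfCanonicalFiber k p) {p q : D.Curve}
    (hpq : p = q) {τ : ℍ} (hτ : D.curveProj τ = p) :
    (s p).1 ⟨τ, hτ⟩ = (s q).1 ⟨τ, hτ.trans hpq⟩ := by
  subst hpq
  rfl

theorem sectionLift_smul {k : ℕ} (s : Π p, D.halfCanonicalFiber k p) (γ : D.Γ) (τ : ℍ) :
    sectionLift s (γ • τ) = autFactor γ.1 τ ^ k * sectionLift s τ := by
  have horbit : D.curveProj (γ • τ) = D.curveProj τ := Quotient.sound ⟨γ, rfl⟩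
  exact (section_apply_congr s horbit rfl).trans
    ((s (D.curveProj τ)).2 γ ⟨τ, rfl⟩ ⟨γ • τ, horbit⟩ rfl)

theorem sectionLift_injective (k : ℕ) :
    Function.Injective (sectionLift : (Π p, D.halfCanonicalFiber k p) → ℍ → ℂ) := by
  intro s t h
  refine funext fun p => Subtype.ext (funext ?_)
  rintro ⟨τ, rfl⟩
  exact congrFun h τ

theorem exists_sectionLift_eq {k : ℕ} {f : ℍ → ℂ} (hf : ContMDiff 𝓘(ℂ) 𝓘(ℂ) ω f)
    (h : ∀ (γ : D.Γ) τ, f (γ • τ) = autFactor γ.1 τ ^ k * f τ) :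
    ∃ s : D.H0 k, sectionLift s.1 = f :=
  ⟨⟨fun _ => ⟨fun τ => f τ.1, fun γ τ _ hτ => (congrArg f hτ).trans (h γ τ)⟩, hf⟩, rfl⟩

/-- The function on the upper half plane of a pair of sections. -/
noncomputable def pairLift (c : D.SectionPairs) (τ : ℍ) : ℂ × ℂ :=
  (sectionLift c.1.1 τ, sectionLift c.2.1 τ)

theorem pairLift_smul (c : D.SectionPairs) (γ : D.Γ) (τ : ℍ) :
    pairLift c (γ • τ) = autFactor γ.1 τ ^ 3 • pairLift c τ :=
  Prod.ext (sectionLift_smul _ γ τ) (sectionLift_smul _ γ τ)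

theorem contMDiff_pairLift (c : D.SectionPairs) : ContMDiff 𝓘(ℂ) 𝓘(ℂ, ℂ × ℂ) ω (pairLift c) :=
  ContMDiff.prodMk_space c.1.2 c.2.2

theorem pairLift_add (c d : D.SectionPairs) (τ : ℍ) :
    pairLift (c + d) τ = pairLift c τ + pairLift d τ := rfl

theorem pairLift_neg (c : D.SectionPairs) (τ : ℍ) : pairLift (-c) τ = -pairLift c τ := rfl

theorem pairLift_zero (τ : ℍ) : pairLift (0 : D.SectionPairs) τ = 0 := rfl

theorem pairLift_injective : Function.Injective (pairLift : D.SectionPairs → ℍ → ℂ × ℂ) :=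
  fun _ _ h => Prod.ext
    (Subtype.ext (sectionLift_injective 3 (funext fun τ => congrArg Prod.fst (congrFun h τ))))
    (Subtype.ext (sectionLift_injective 3 (funext fun τ => congrArg Prod.snd (congrFun h τ))))

theorem exists_pairLift_eq {f : ℍ → ℂ × ℂ} (hf : ContMDiff 𝓘(ℂ) 𝓘(ℂ, ℂ × ℂ) ω f)
    (h : ∀ (γ : D.Γ) τ, f (γ • τ) = autFactor γ.1 τ ^ 3 • f τ) :
    ∃ c : D.SectionPairs, pairLift c = f := by
  obtain ⟨s, hs⟩ := exists_sectionLift_eq (f := fun τ => (f τ).1)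
    ((contDiff_fst (𝕜 := ℂ) (E := ℂ) (F := ℂ)).contMDiff.comp hf)
    (fun γ τ => congrArg Prod.fst (h γ τ))
  obtain ⟨t, ht⟩ := exists_sectionLift_eq (f := fun τ => (f τ).2)
    ((contDiff_snd (𝕜 := ℂ) (E := ℂ) (F := ℂ)).contMDiff.comp hf)
    (fun γ τ => congrArg Prod.snd (h γ τ))
  exact ⟨(s, t), funext fun τ => Prod.ext (congrFun hs τ) (congrFun ht τ)⟩

/-- The bilinear map `(v, w) ↦ dτ(v) dτ(w) u` for a vector `u` of the fibre direction. -/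
noncomputable def squareTensor (u : ℂ × ℂ) : ℂ × ℂ × ℂ →L[ℂ] ℂ × ℂ × ℂ →L[ℂ] ℂ × ℂ × ℂ :=
  (ContinuousLinearMap.fst ℂ ℂ (ℂ × ℂ)).smulRight
    ((ContinuousLinearMap.fst ℂ ℂ (ℂ × ℂ)).smulRight ((0, u) : ℂ × ℂ × ℂ))

theorem squareTensor_apply (u : ℂ × ℂ) (v w : ℂ × ℂ × ℂ) :
    squareTensor u v w = (0, (v.1 * w.1) • u) := by
  simp [squareTensor, smul_smul]

theorem tensor_eq_squareTensor (c : D.SectionPairs) (x : Cover) (v w : TangentSpace model x) :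
    (tensor c.1 c.2 x v w : ℂ × ℂ × ℂ) = squareTensor (pairLift c x.1) v w :=
  (squareTensor_apply (pairLift c x.1) v w).symm

theorem actDeriv_squareTensor (g : D.Grp) (x : Cover) (u : ℂ × ℂ) (v w : ℂ × ℂ × ℂ) :
    squareTensor (autFactor g.γ.1 x.1 ^ 3 • u) (actDeriv g x v) (actDeriv g x w) =
      actDeriv g x (squareTensor u v w) := by
  have hfactor := autFactor_ne_zero g.γ.1 x.1
  rw [squareTensor_apply, squareTensor_apply, actDeriv_apply g x (_, _)]
  simp only [actDeriv_apply]
  refine Prod.ext (by simp) (Prod.ext ?_ ?_) <;> simp <;> field_simp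

theorem coordInv_sheet {a b : Cover} {p : D.Threefold} {g : D.Grp}
    (ha : p ∈ (D.sheet a).source) (hb : p ∈ (D.sheet b).source)
    (hg : g • orbitLift D.Grp a p = orbitLift D.Grp b p) (v : ℂ × ℂ × ℂ) :
    coordInv model (D.sheet b) p (actDeriv g (orbitLift D.Grp a p) v) =
      coordInv model (D.sheet a) p v := by
  have htransition := coordDeriv_sheet ha hb hg (coordInv model (D.sheet a) p v)
  rw [coordDeriv_coordInv (D.sheet_mem a) ha] at htransition
  rw [← htransition, coordInv_coordDeriv (D.sheet_mem b) hb]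

theorem projDeriv_coordDeriv_sheet (x : Cover) (v : TangentSpace model (D.proj x)) :
    D.projDeriv x (coordDeriv model (D.sheet x) (D.proj x) v) = v := by
  rw [← coordInv_sheet_self, coordInv_coordDeriv (D.sheet_mem x) (D.proj_mem_sheet_source x)]

theorem projDeriv_surjective (x : Cover) : Function.Surjective (D.projDeriv x) :=
  fun v => ⟨_, projDeriv_coordDeriv_sheet x v⟩

/-- The tensor `Θ_{A,B}` on the threefold of a pair `(A, B)` of sections, computed at each point
in the sheet of some preimage; `sectionTensor_eq` says that any other sheet does as well. -/
noncomputable def sectionTensor (c : D.SectionPairs) (p : D.Threefold) :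
    TangentSpace model p →L[ℂ] TangentSpace model p →L[ℂ] TangentSpace model p :=
  let b := (D.proj_surjective p).choose
  let ℓ := (ContinuousLinearMap.fst ℂ ℂ (ℂ × ℂ)).comp (coordDeriv model (D.sheet b) p)
  ℓ.smulRight (ℓ.smulRight (coordInv model (D.sheet b) p (0, pairLift c b.1)))

theorem sectionTensor_eq (c : D.SectionPairs) {b : Cover} {p : D.Threefold}
    (hp : p ∈ (D.sheet b).source) (v w : TangentSpace model p) :
    sectionTensor c p v w = coordInv model (D.sheet b) p (squareTensor
      (pairLift c (orbitLift D.Grp b p).1) (coordDeriv model (D.sheet b) p v)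
      (coordDeriv model (D.sheet b) p w)) := by
  obtain ⟨a, ha, haself, hdef⟩ : ∃ a : Cover, p ∈ (D.sheet a).source ∧ orbitLift D.Grp a p = a ∧
      sectionTensor c p v w = coordInv model (D.sheet a) p (squareTensor (pairLift c a.1)
        (coordDeriv model (D.sheet a) p v) (coordDeriv model (D.sheet a) p w)) := by
    have hchoose := (D.proj_surjective p).choose_spec
    refine ⟨(D.proj_surjective p).choose, ?_, ?_, ?_⟩
    · simpa only [hchoose] using D.proj_mem_sheet_source (D.proj_surjective p).choose
    · simpa only [hchoose] using orbitLift_proj_self (D := D) (D.proj_surjective p).choose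
    · simp only [sectionTensor, squareTensor, ContinuousLinearMap.smulRight_apply, map_smul,
        smul_apply]
      rfl
  obtain ⟨g, hg⟩ := exists_smul_eq_orbitLift_of_proj_eq hp (proj_orbitLift ha)
  have hpair : pairLift c (orbitLift D.Grp b p).1 = autFactor g.γ.1 a.1 ^ 3 • pairLift c a.1 := by
    rw [← hg, haself]
    exact pairLift_smul c g.γ a.1
  rw [hdef, coordDeriv_sheet ha hp hg, coordDeriv_sheet ha hp hg, hpair, haself,
    actDeriv_squareTensor, ← coordInv_sheet ha hp hg, haself]

theorem sectionTensor_symm (c : D.SectionPairs) (p : D.Threefold) (v w : TangentSpace model p) :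
    sectionTensor c p v w = sectionTensor c p w v := by
  simp only [sectionTensor, ContinuousLinearMap.smulRight_apply, smul_apply]
  rw [smul_comm]

theorem sectionTensor_projDeriv (c : D.SectionPairs) (x : Cover) (v w : ℂ × ℂ × ℂ) :
    sectionTensor c (D.proj x) (D.projDeriv x v) (D.projDeriv x w) =
      D.projDeriv x (squareTensor (pairLift c x.1) v w) := by
  have hx := D.proj_mem_sheet_source x
  rw [sectionTensor_eq c hx, ← coordInv_sheet_self, ← coordInv_sheet_self, ← coordInv_sheet_self,
    coordDeriv_coordInv (D.sheet_mem x) hx, coordDeriv_coordInv (D.sheet_mem x) hx,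
    orbitLift_proj_self]

theorem sectionTensor_add (c d : D.SectionPairs) (p : D.Threefold) (v w : TangentSpace model p) :
    sectionTensor (c + d) p v w = sectionTensor c p v w + sectionTensor d p v w := by
  obtain ⟨x, rfl⟩ := D.proj_surjective p
  simp only [sectionTensor_eq _ (D.proj_mem_sheet_source x), ← map_add, squareTensor_apply,
    pairLift_add, smul_add, Prod.mk_add_mk, add_zero]

theorem sectionTensor_neg (c : D.SectionPairs) (p : D.Threefold) (v w : TangentSpace model p) :
    sectionTensor (-c) p v w = -sectionTensor c p v w := by
  obtain ⟨x, rfl⟩ := D.proj_surjective p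
  simp only [sectionTensor_eq _ (D.proj_mem_sheet_source x), ← map_neg, squareTensor_apply,
    pairLift_neg, smul_neg, Prod.neg_mk, neg_zero]

theorem sectionTensor_zero (p : D.Threefold) (v w : TangentSpace model p) :
    sectionTensor (0 : D.SectionPairs) p v w = 0 := by
  obtain ⟨x, rfl⟩ := D.proj_surjective p
  simp only [sectionTensor_eq _ (D.proj_mem_sheet_source x), squareTensor_apply, pairLift_zero,
    smul_zero]
  exact map_zero _

theorem isHolomorphicTensorAt_sectionTensor (c : D.SectionPairs) (p : D.Threefold) :
    IsHolomorphicTensorAt (fun q v w => sectionTensor c q v w) p := by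
  intro V W hV hW
  obtain ⟨x, rfl⟩ := D.proj_surjective p
  have hx := D.proj_mem_sheet_source x
  have hfst : ContMDiff 𝓘(ℂ, ℂ × ℂ × ℂ) 𝓘(ℂ) ω (Prod.fst : ℂ × ℂ × ℂ → ℂ) :=
    (contDiff_fst (𝕜 := ℂ) (E := ℂ) (F := ℂ × ℂ)).contMDiff
  have hVfst := hfst.contMDiffAt.comp _ (contMDiffAt_coordDeriv_apply (D.sheet_mem x) hx hV)
  have hWfst := hfst.contMDiffAt.comp _ (contMDiffAt_coordDeriv_apply (D.sheet_mem x) hx hW)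
  have hpair : ContMDiffAt model 𝓘(ℂ, ℂ × ℂ) ω
      (fun q => pairLift c (orbitLift D.Grp x q).1) (D.proj x) :=
    (contMDiff_pairLift c).contMDiffAt.comp (D.proj x) (contMDiffAt_fst.comp (D.proj x)
      (contMDiffAt_orbitLift D.contMDiff_smul (by rwa [← sheet_source])))
  refine (contMDiffAt_coordInv_apply (D.sheet_mem x) hx ((contMDiffAt_const
    (c := (0 : ℂ))).prodMk_space ((hVfst.mul hWfst).smul hpair))).congr_of_eventuallyEq ?_
  filter_upwards [(D.sheet x).open_source.mem_nhds hx] with q hq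
  rw [sectionTensor_eq c hq, squareTensor_apply]
  rfl

theorem isTranslate_iff_isPureTensor {c : D.SectionPairs}
    {φ ψ : HolProjConnection model D.Threefold} :
    IsTranslate c φ ψ ↔ ∀ r ∈ φ.reps, ∀ s ∈ ψ.reps, ∀ p ∈ r.domain ⊓ s.domain,
      IsPureTensor ℂ fun v w => s.diff r p v w - sectionTensor c p v w := by
  refine forall₂_congr fun r _ => forall₂_congr fun s _ => ?_
  rw [inf_comm, ← LocalAffineConnection.exists_oneForm_iff_isPureTensor
    fun p _ => isHolomorphicTensorAt_sectionTensor c p]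
  have htensor {x : Cover} {y : TangentSpace model (D.proj x)} {w : ℂ × ℂ × ℂ}
      (hw : D.projDeriv x w = y) (v : ℂ × ℂ × ℂ) : D.projDeriv x (tensor c.1 c.2 x v w) =
        sectionTensor c (D.proj x) y (D.projDeriv x v) := by
    rw [← hw, sectionTensor_symm, sectionTensor_projDeriv]
    exact congrArg (D.projDeriv x) (tensor_eq_squareTensor c x v w)
  refine exists_congr fun θ => and_congr Iff.rfl
    ⟨fun h p hp Y hY v => ?_, fun h x hp Y hY v w hw => ?_⟩
  · obtain ⟨x, rfl⟩ := D.proj_surjective p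
    obtain ⟨v, rfl⟩ := projDeriv_surjective x v
    obtain ⟨w, hw⟩ := projDeriv_surjective x (Y (D.proj x))
    exact (h x hp Y hY v w hw).trans (congrArg (fun u => _ + u + _) (htensor hw v))
  · exact (h (D.proj x) hp Y hY (D.projDeriv x v)).trans
      (congrArg (fun u => _ + u + _) (htensor hw v).symm)

end KugaShimuraDatum

/-! ### The difference of a projective connection and the standard one -/

section ContMDiffTrace

variable {𝕜 : Type*} [NontriviallyNormedField 𝕜] [CompleteSpace 𝕜]
  {E : Type*} [NormedAddCommGroup E] [NormedSpace 𝕜 E]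
  {H : Type*} [TopologicalSpace H] {I : ModelWithCorners 𝕜 E H}
  {M : Type*} [TopologicalSpace M] [ChartedSpace H M]
  {F : Type*} [NormedAddCommGroup F] [NormedSpace 𝕜 F] [FiniteDimensional 𝕜 F]
  {n : ℕ∞ω} {x : M}

theorem contMDiffAt_trace {A : M → F →ₗ[𝕜] F}
    (hA : ∀ v, ContMDiffAt I 𝓘(𝕜, F) n (fun y => A y v) x) :
    ContMDiffAt I 𝓘(𝕜) n (fun y => LinearMap.trace 𝕜 F (A y)) x := by
  let b := Module.finBasis 𝕜 F
  simp only [LinearMap.trace_eq_matrix_trace 𝕜 b, Matrix.trace, Matrix.diag,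
    LinearMap.toMatrix_apply]
  exact contMDiffAt_finsetSum fun i _ =>
    (LinearMap.toContinuousLinearMap (b.coord i)).contMDiff.contMDiffAt.comp x (hA (b i))

theorem contMDiffAt_traceFree {B : M → F →ₗ[𝕜] F →ₗ[𝕜] F}
    (hB : ∀ v w, ContMDiffAt I 𝓘(𝕜, F) n (fun y => B y v w) x) (v w : F) :
    ContMDiffAt I 𝓘(𝕜, F) n (fun y => traceFree (B y) v w) x := by
  have hterm (v w : F) : ContMDiffAt I 𝓘(𝕜, F) n
      (fun y => ((Module.finrank 𝕜 F + 1 : 𝕜)⁻¹ * LinearMap.trace 𝕜 F (B y v)) • w) x :=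
    (contMDiffAt_const.mul (contMDiffAt_trace (hB v))).smul contMDiffAt_const
  simp only [traceFree_apply]
  exact (hB v w).sub ((hterm v w).add (hterm w v))

end ContMDiffTrace

section ChartTensor

variable {E : Type*} [NormedAddCommGroup E] [NormedSpace ℂ E] [FiniteDimensional ℂ E]
  {H : Type*} [TopologicalSpace H] {I : ModelWithCorners ℂ E H}
  {M : Type*} [TopologicalSpace M] [ChartedSpace H M] [IsManifold I ω M]

/-- The difference of two connections in the coordinates of a chart. -/
noncomputable def chartTensor (r s : LocalAffineConnection I M) (e : OpenPartialHomeomorph M H)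
    (p : M) : E →ₗ[ℂ] E →ₗ[ℂ] E :=
  LinearMap.mk₂ ℂ (fun v w => coordDeriv I e p (r.diff s p (coordInv I e p v) (coordInv I e p w)))
    (fun v v' w => by simp only [map_add, add_apply])
    (fun c v w => by simp only [map_smul, smul_apply])
    (fun v w w' => by simp only [map_add])
    (fun c v w => by simp only [map_smul])

theorem chartTensor_apply (r s : LocalAffineConnection I M) (e : OpenPartialHomeomorph M H) (p : M)
    (v w : E) : chartTensor r s e p v w =
      coordDeriv I e p (r.diff s p (coordInv I e p v) (coordInv I e p w)) := rfl

variable {r s r' s' : LocalAffineConnection I M} {e : OpenPartialHomeomorph M H} {p : M}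

theorem contMDiffAt_chartTensor (he : e ∈ IsManifold.maximalAtlas I ω M) (hp : p ∈ e.source)
    (hr : p ∈ r.domain) (hs : p ∈ s.domain) (v w : E) :
    ContMDiffAt I 𝓘(ℂ, E) ω (fun q => chartTensor r s e q v w) p := by
  have := FiniteDimensional.complete ℂ E
  exact contMDiffAt_coordDeriv_apply he hp (LocalAffineConnection.isHolomorphicTensorAt_diff
    hr hs _ _ (contMDiffAt_coordInv_const he hp v) (contMDiffAt_coordInv_const he hp w))

theorem traceFree_chartTensor_congr (he : e ∈ IsManifold.maximalAtlas I ω M) (hp : p ∈ e.source)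
    (hr : p ∈ r.domain) (hs : p ∈ s.domain) (hr' : p ∈ r'.domain) (hs' : p ∈ s'.domain)
    (hrr' : r.ProjEquiv r') (hss' : s.ProjEquiv s') :
    traceFree (chartTensor r s e p) = traceFree (chartTensor r' s' e p) := by
  rw [LocalAffineConnection.projEquiv_iff_isPureTensor] at hrr' hss'
  have hdiff : r.diff s p - r'.diff s' p = r.diff r' p - s.diff s' p := by
    rw [← LocalAffineConnection.diff_add_diff hr hr' hs,
      ← LocalAffineConnection.diff_add_diff hr' hs' hs, LocalAffineConnection.diff_swap hs hs']
    abel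
  have hpure := ((hrr' p ⟨hr, hr'⟩).add (hss' p ⟨hs, hs'⟩).neg).conj
    (L := (coordDeriv I e p).toLinearMap) (K := (coordInv I e p).toLinearMap)
    (coordDeriv_coordInv he hp)
  rw [← sub_eq_zero, ← traceFree_sub]
  refine (hpure.congr fun v w => ?_).traceFree_eq_zero
  have happly := congrArg (fun T => coordDeriv I e p (T (coordInv I e p v) (coordInv I e p w)))
    hdiff
  simpa only [LinearMap.sub_apply, chartTensor_apply, ContinuousLinearMap.coe_coe, sub_apply,
    map_sub, ← sub_eq_add_neg] using happly

end ChartTensor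

namespace KugaShimuraDatum
variable {D : KugaShimuraDatum}

theorem actDeriv_injective (g : D.Grp) (x : Cover) : Function.Injective (actDeriv g x) := by
  rw [injective_iff_map_eq_zero]
  intro v hv
  have hfactor := autFactor_ne_zero g.γ.1 x.1
  rw [actDeriv_apply] at hv
  have hfst : v.1 = 0 := by simpa [hfactor] using congrArg Prod.fst hv
  refine Prod.ext hfst (Prod.ext ?_ ?_)
  · simpa [hfactor, hfst] using congrArg (fun u => u.2.1) hv
  · simpa [hfactor, hfst] using congrArg (fun u => u.2.2) hv

variable (φ : HolProjConnection model D.Threefold)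

/-- The trace-free part of the difference of `φ` and the standard projective connection, pulled
back to the covering space. It does not depend on the local representative of `φ` that is chosen
at each point. -/
noncomputable def coverTensor (x : Cover) : ℂ × ℂ × ℂ →ₗ[ℂ] ℂ × ℂ × ℂ →ₗ[ℂ] ℂ × ℂ × ℂ :=
  traceFree
    (chartTensor (φ.cover (D.proj x)).choose (D.sheetConnection x) (D.sheet x) (D.proj x))

variable {φ}

theorem traceFree_chartTensor_actDeriv {r : LocalAffineConnection model D.Threefold}
    (hr : r ∈ φ.reps) {a b x : Cover} {g : D.Grp} (hx : D.proj x ∈ r.domain)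
    (ha : D.proj x ∈ (D.sheet a).source) (hb : D.proj x ∈ (D.sheet b).source)
    (hg : g • x = orbitLift D.Grp b (D.proj x)) (v w : ℂ × ℂ × ℂ) :
    traceFree (chartTensor r (D.sheetConnection a) (D.sheet b) (D.proj x))
      (actDeriv g x v) (actDeriv g x w) = actDeriv g x (coverTensor φ x v w) := by
  have hsource := D.proj_mem_sheet_source x
  obtain ⟨hmem, hdom⟩ := (φ.cover (D.proj x)).choose_spec
  have hcover : coverTensor φ x =
      traceFree (chartTensor r (D.sheetConnection a) (D.sheet x) (D.proj x)) :=
    traceFree_chartTensor_congr (D.sheet_mem x) hsource hdom hsource hx ha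
      (φ.compatible _ hmem _ hr) (D.standardConnection.compatible _ ⟨x, rfl⟩ _ ⟨a, rfl⟩)
  let L : (ℂ × ℂ × ℂ) ≃ₗ[ℂ] ℂ × ℂ × ℂ :=
    LinearEquiv.ofInjectiveEndo (actDeriv g x : ℂ × ℂ × ℂ →ₗ[ℂ] ℂ × ℂ × ℂ) (actDeriv_injective g x)
  rw [hcover]
  refine traceFree_equivariant L (fun v w => ?_) v w
  change coordDeriv _ _ _ (r.diff _ _ (coordInv _ _ _ (actDeriv g x v))
    (coordInv _ _ _ (actDeriv g x w))) = actDeriv g x _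
  rw [coordInv_sheet_actDeriv hb hg, coordInv_sheet_actDeriv hb hg,
    coordDeriv_sheet hsource hb (g := g) (by rw [orbitLift_proj_self, hg]), chartTensor_apply,
    coordInv_sheet_self, coordInv_sheet_self, orbitLift_proj_self]

theorem traceFree_chartTensor_eq_coverTensor {r : LocalAffineConnection model D.Threefold}
    (hr : r ∈ φ.reps) {a b x : Cover} (hx : D.proj x ∈ r.domain)
    (ha : D.proj x ∈ (D.sheet a).source) (hb : D.proj x ∈ (D.sheet b).source)
    (hlift : orbitLift D.Grp b (D.proj x) = x) (v w : ℂ × ℂ × ℂ) :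
    traceFree (chartTensor r (D.sheetConnection a) (D.sheet b) (D.proj x)) v w =
      coverTensor φ x v w := by
  simpa only [actDeriv_one] using
    traceFree_chartTensor_actDeriv hr hx ha hb (g := 1) (by rw [one_smul, hlift]) v w

theorem coverTensor_smul (g : D.Grp) (x : Cover) (v w : ℂ × ℂ × ℂ) :
    coverTensor φ (g • x) (actDeriv g x v) (actDeriv g x w) =
      actDeriv g x (coverTensor φ x v w) := by
  have hrep := (φ.cover (D.proj (g • x))).choose_spec
  have hsource := D.proj_mem_sheet_source (g • x)
  have hlift := orbitLift_proj_self (D := D) (g • x)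
  rw [coverTensor]
  generalize (φ.cover (D.proj (g • x))).choose = r at hrep ⊢
  rw [proj_smul] at hrep hsource hlift ⊢
  exact traceFree_chartTensor_actDeriv hrep.1 hrep.2 hsource hsource hlift.symm v w

theorem contMDiff_coverTensor (v w : ℂ × ℂ × ℂ) :
    ContMDiff model 𝓘(ℂ, ℂ × ℂ × ℂ) ω (fun x => coverTensor φ x v w) := by
  intro x
  obtain ⟨hmem, hdom⟩ := (φ.cover (D.proj x)).choose_spec
  have hsource := D.proj_mem_sheet_source x
  have hcont : ContinuousAt D.proj x := D.contMDiff_proj.continuous.continuousAt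
  have hlocal := (contMDiffAt_traceFree (fun v w => contMDiffAt_chartTensor
    (s := D.sheetConnection x) (D.sheet_mem x) hsource hdom hsource v w) v w).comp x
      D.contMDiff_proj.contMDiffAt
  refine hlocal.congr_of_eventuallyEq ?_
  filter_upwards [
    eventually_orbitLift_proj hsource (g := 1) (by rw [one_smul, orbitLift_proj_self]),
    hcont.eventually ((φ.cover (D.proj x)).choose.domain.isOpen.mem_nhds hdom),
    hcont.eventually ((D.sheet x).open_source.mem_nhds hsource)] with y hlift hyr hys
  exact (traceFree_chartTensor_eq_coverTensor hmem hyr hys hys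
    (by rw [hlift, one_smul]) v w).symm

theorem coverTensor_symm (x : Cover) (v w : ℂ × ℂ × ℂ) :
    coverTensor φ x v w = coverTensor φ x w v := by
  refine traceFree_symm (fun v w => ?_) v w
  rw [chartTensor_apply, LocalAffineConnection.diff_symm (φ.cover (D.proj x)).choose_spec.2
    (D.proj_mem_sheet_source x), chartTensor_apply]

theorem translation_smul (X : D.periodLattice) (x : Cover) :
    (⟨1, X⟩ : D.Grp) • x = (x.1, x.2 + periodVec x.1 X) := by
  rw [smul_def]
  simp [autFactor, periodVec]
  rfl

theorem actDeriv_translation (X : D.periodLattice) (x : Cover) (v : ℂ × ℂ × ℂ) :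
    actDeriv (⟨1, X⟩ : D.Grp) x v = v + (0, v.1 • periodSlope X) := by
  rw [actDeriv_apply]
  ext <;> simp [autFactor, periodSlope, mul_comm]

theorem isInvariantTensor_coverTensor {ι : Type*}
    {b : Module.Basis ι ℝ (Matrix (Fin 2) (Fin 2) ℝ)} (hb : ∀ i, b i ∈ D.periodLattice) (τ : ℍ) :
    IsInvariantTensor b τ fun z => coverTensor φ (τ, z) where
  contDiff v w := by
    rw [← contMDiff_iff_contDiff]
    exact (contMDiff_coverTensor v w).comp (contMDiff_const.prodMk contMDiff_id)
  symm z := coverTensor_symm (τ, z)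
  invariant i z v w := by
    have hsmul := coverTensor_smul (φ := φ) ⟨1, ⟨b i, hb i⟩⟩ (τ, z) v w
    simp only [actDeriv_translation, translation_smul] at hsmul
    exact hsmul

theorem coverTensor_eq_squareTensor (x : Cover) (v w : ℂ × ℂ × ℂ) :
    coverTensor φ x v w = squareTensor (coverTensor φ (x.1, 0) (1, 0) (1, 0)).2 v w := by
  obtain ⟨b, hb⟩ := D.exists_basis
  have hmem (i) : b i ∈ D.periodLattice := by
    rw [← SetLike.mem_coe, hb]
    exact Submodule.subset_span ⟨i, rfl⟩
  rw [squareTensor_apply]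
  exact (isInvariantTensor_coverTensor hmem x.1).apply_of_trace
    (fun z => trace_traceFree _ _) x.2 v w

theorem exists_coverTensor_eq (φ : HolProjConnection model D.Threefold) :
    ∃ c : D.SectionPairs, ∀ x v w, coverTensor φ x v w = squareTensor (pairLift c x.1) v w := by
  let f : ℍ → ℂ × ℂ := fun τ => (coverTensor φ (τ, 0) (1, 0) (1, 0)).2
  have hf : ContMDiff 𝓘(ℂ) 𝓘(ℂ, ℂ × ℂ) ω f :=
    (contDiff_snd (𝕜 := ℂ) (E := ℂ) (F := ℂ × ℂ)).contMDiff.comp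
      ((contMDiff_coverTensor (φ := φ) (1, 0) (1, 0)).comp (contMDiff_id.prodMk contMDiff_const))
  have hautomorphic (γ : D.Γ) (τ : ℍ) : f (γ • τ) = autFactor γ.1 τ ^ 3 • f τ := by
    have hsmul := coverTensor_smul (φ := φ) ⟨γ, 0⟩ (τ, 0) (1, 0) (1, 0)
    rw [coverTensor_eq_squareTensor, coverTensor_eq_squareTensor (τ, 0),
      ← actDeriv_squareTensor, squareTensor_apply, squareTensor_apply, actDeriv_apply] at hsmul
    exact smul_right_injective (ℂ × ℂ) (by simp [autFactor_ne_zero]) (congrArg Prod.snd hsmul)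
  obtain ⟨c, hc⟩ := exists_pairLift_eq hf hautomorphic
  exact ⟨c, fun x v w => by rw [coverTensor_eq_squareTensor, hc]⟩

theorem exists_isTranslate_standardConnection (φ : HolProjConnection model D.Threefold) :
    ∃ c, IsTranslate c D.standardConnection φ := by
  obtain ⟨c, hc⟩ := exists_coverTensor_eq φ
  refine ⟨c, isTranslate_iff_isPureTensor.2 ?_⟩
  rintro _ ⟨a, rfl⟩ r hr p ⟨ha, hp⟩
  obtain ⟨x, rfl⟩ := D.proj_surjective p
  have hx := D.proj_mem_sheet_source x
  refine ((isPureTensor_sub_traceFree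
    (chartTensor r (D.sheetConnection a) (D.sheet x) (D.proj x))).conj
      (L := (coordInv model (D.sheet x) (D.proj x)).toLinearMap)
      (K := (coordDeriv model (D.sheet x) (D.proj x)).toLinearMap)
      (coordInv_coordDeriv (D.sheet_mem x) hx)).congr fun v w => ?_
  rw [traceFree_chartTensor_eq_coverTensor hr hp ha hx (orbitLift_proj_self x), hc, map_sub,
    chartTensor_apply, sectionTensor_eq c hx, orbitLift_proj_self]
  simp only [ContinuousLinearMap.coe_coe, coordInv_coordDeriv (D.sheet_mem x) hx]

end KugaShimuraDatum

/-! ### The affine structure on projective classes -/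

theorem exists_addTorsor_of_equiv {G P : Type*} [AddCommGroup G] (e : P ≃ G) :
    ∃ _ : AddTorsor G P, ∀ (g : G) (p q : P), g +ᵥ p = q ↔ g + e p = e q := by
  let torsor : AddTorsor G P :=
    { vadd := fun g p => e.symm (g + e p)
      vsub := fun p q => e p - e q
      nonempty := ⟨e.symm 0⟩
      zero_vadd := fun p => (congrArg e.symm (zero_add (e p))).trans (e.symm_apply_apply p)
      add_vadd := fun g h p => congrArg e.symm <|
        (add_assoc g h (e p)).trans (congrArg (g + ·) (e.apply_symm_apply (h + e p)).symm)
      vsub_vadd' := fun p q =>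
        (congrArg e.symm (sub_add_cancel (e p) (e q))).trans (e.symm_apply_apply p)
      vadd_vsub' := fun g p => by
        change e (e.symm (g + e p)) - e p = g
        rw [e.apply_symm_apply, add_sub_cancel_right] }
  exact ⟨torsor, fun g p q => e.symm_apply_eq⟩

namespace KugaShimuraDatum
variable {D : KugaShimuraDatum} {c d : D.SectionPairs}
  {φ ψ χ : HolProjConnection model D.Threefold}

theorem isTranslate_zero_iff : IsTranslate (0 : D.SectionPairs) φ ψ ↔ φ.Equivalent ψ := by
  rw [isTranslate_iff_isPureTensor, HolProjConnection.equivalent_iff]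
  simp only [sectionTensor_zero, sub_zero]
  refine forall₂_congr fun r _ => forall₂_congr fun s _ => ?_
  rw [inf_comm, ← LocalAffineConnection.projEquiv_iff_isPureTensor]
  exact ⟨fun h => h.symm, fun h => h.symm⟩

theorem toClass_eq_iff : φ.toClass = ψ.toClass ↔ IsTranslate (0 : D.SectionPairs) φ ψ :=
  Quotient.eq.trans isTranslate_zero_iff.symm

theorem IsTranslate.symm (h : IsTranslate c φ ψ) : IsTranslate (-c) ψ φ := by
  rw [isTranslate_iff_isPureTensor] at *
  intro s hs r hr p hp
  refine (h r hr s hs p hp.symm).neg.congr fun v w => ?_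
  rw [sectionTensor_neg, LocalAffineConnection.diff_swap hp.1 hp.2, neg_apply, neg_apply]
  abel

theorem IsTranslate.trans (h : IsTranslate c φ ψ) (h' : IsTranslate d ψ χ) :
    IsTranslate (c + d) φ χ := by
  rw [isTranslate_iff_isPureTensor] at *
  intro r hr t ht p hp
  obtain ⟨s, hs, hps⟩ := ψ.cover p
  refine ((h r hr s hs p ⟨hp.1, hps⟩).add (h' s hs t ht p ⟨hps, hp.2⟩)).congr fun v w => ?_
  rw [sectionTensor_add, ← LocalAffineConnection.diff_add_diff hp.2 hps hp.1, add_apply, add_apply]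
  abel

theorem eq_zero_of_isPureTensor_squareTensor {u : ℂ × ℂ}
    (h : IsPureTensor ℂ fun v w => squareTensor u v w) : u = 0 := by
  obtain ⟨θ, hθ⟩ := h
  simp only [squareTensor_apply] at hθ
  have hzero : θ (1, 0) = 0 := by
    simpa using (congrArg (fun x => x.2.1) (hθ (1, 0) (0, 1, 0))).symm
  simpa [hzero] using congrArg Prod.snd (hθ (1, 0) (1, 0))

theorem eq_zero_of_isPureTensor_sectionTensor
    (h : ∀ p : D.Threefold, IsPureTensor ℂ fun v w => sectionTensor c p v w) : c = 0 := by
  refine pairLift_injective (funext fun τ => ?_)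
  have hx := D.proj_mem_sheet_source (τ, 0)
  rw [pairLift_zero]
  refine eq_zero_of_isPureTensor_squareTensor (((h (D.proj (τ, 0))).conj
    (L := (coordDeriv model (D.sheet (τ, 0)) (D.proj (τ, 0))).toLinearMap)
    (K := (D.projDeriv (τ, 0)).toLinearMap) fun w => ?_).congr fun v w => ?_)
  · simp only [ContinuousLinearMap.coe_coe, ← coordInv_sheet_self,
      coordDeriv_coordInv (D.sheet_mem _) hx]
  · simp only [ContinuousLinearMap.coe_coe, sectionTensor_projDeriv]
    rw [← coordInv_sheet_self, coordDeriv_coordInv (D.sheet_mem _) hx]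

theorem IsTranslate.unique (h : IsTranslate c φ ψ) (h' : IsTranslate d φ ψ) : c = d := by
  rw [← sub_eq_zero, sub_eq_add_neg]
  refine eq_zero_of_isPureTensor_sectionTensor fun p => ?_
  obtain ⟨r, hr, hp⟩ := φ.cover p
  refine (isTranslate_iff_isPureTensor.1 (h.trans h'.symm) r hr r hr p ⟨hp, hp⟩).neg.congr
    fun v w => ?_
  rw [LocalAffineConnection.diff_self hp, zero_apply, zero_apply, zero_sub, neg_neg]

/-- The local representative `∇ + Θ_{A,B}` of a translated projective connection. -/
noncomputable def translateRep (c : D.SectionPairs) (r : LocalAffineConnection model D.Threefold) :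
    LocalAffineConnection model D.Threefold :=
  r.addTensor (sectionTensor c) (fun p _ v w => sectionTensor_symm c p v w)
    (fun p _ => isHolomorphicTensorAt_sectionTensor c p)

theorem translateRep_diff {r s : LocalAffineConnection model D.Threefold} {p : D.Threefold}
    (hr : p ∈ r.domain) (hs : p ∈ s.domain) :
    (translateRep c r).diff s p = sectionTensor c p + r.diff s p := by
  rw [← LocalAffineConnection.diff_add_diff (r := translateRep c r) hr hr hs, translateRep,
    LocalAffineConnection.addTensor_diff _ _ hr]

/-- The projective connection obtained from `φ` by adding `Θ_{A,B}`, where `c = (A, B)`. -/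
noncomputable def translate (c : D.SectionPairs) (φ : HolProjConnection model D.Threefold) :
    HolProjConnection model D.Threefold where
  reps := translateRep c '' φ.reps
  cover p := by
    obtain ⟨r, hr, hp⟩ := φ.cover p
    exact ⟨translateRep c r, ⟨r, hr, rfl⟩, hp⟩
  compatible := by
    rintro _ ⟨r, hr, rfl⟩ _ ⟨s, hs, rfl⟩
    rw [LocalAffineConnection.projEquiv_iff_isPureTensor]
    rintro p ⟨hpr : p ∈ r.domain, hps : p ∈ s.domain⟩
    refine (LocalAffineConnection.projEquiv_iff_isPureTensor.1
      (φ.compatible r hr s hs) p ⟨hpr, hps⟩).congr fun v w => ?_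
    rw [translateRep_diff hpr (s := translateRep c s) hps,
      LocalAffineConnection.diff_swap (r := translateRep c s) hps hpr, translateRep_diff hps hpr,
      LocalAffineConnection.diff_swap hpr hps]
    simp

theorem isTranslate_translate (c : D.SectionPairs) (φ : HolProjConnection model D.Threefold) :
    IsTranslate c φ (translate c φ) := by
  rw [isTranslate_iff_isPureTensor]
  rintro r hr _ ⟨s, hs, rfl⟩ p ⟨hpr, hps : p ∈ s.domain⟩
  refine (LocalAffineConnection.projEquiv_iff_isPureTensor.1
    (φ.compatible s hs r hr) p ⟨hps, hpr⟩).congr fun v w => ?_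
  rw [translateRep_diff hps hpr, add_apply, add_apply, add_sub_cancel_left]

variable (D) in
theorem bijective_toClass_translate : Function.Bijective
    fun c : D.SectionPairs => (translate c D.standardConnection).toClass := by
  constructor
  · intro c d h
    have htranslate := (isTranslate_translate c _).trans (toClass_eq_iff.1 h)
    rw [add_zero] at htranslate
    exact htranslate.unique (isTranslate_translate d _)
  · intro q
    obtain ⟨φ, rfl⟩ := Quotient.mk_surjective q
    obtain ⟨c, hc⟩ := exists_isTranslate_standardConnection φ
    refine ⟨c, toClass_eq_iff.2 ?_⟩
    simpa only [neg_add_cancel] using (isTranslate_translate c _).symm.trans hc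

variable (D) in
theorem exists_addTorsor :
    ∃ _ : AddTorsor D.SectionPairs (ProjClass model D.Threefold),
      ∀ (c : D.SectionPairs) (φ ψ : HolProjConnection model D.Threefold),
        c +ᵥ φ.toClass = ψ.toClass ↔ IsTranslate c φ ψ := by
  let e := Equiv.ofBijective _ (bijective_toClass_translate D)
  have he (φ : HolProjConnection model D.Threefold) :
      IsTranslate (e.symm φ.toClass) D.standardConnection φ := by
    have hclass := toClass_eq_iff.1 (e.apply_symm_apply φ.toClass)
    simpa only [add_zero] using (isTranslate_translate _ _).trans hclass
  obtain ⟨torsor, hvadd⟩ := exists_addTorsor_of_equiv e.symm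
  refine ⟨torsor, fun c φ ψ => (hvadd _ _ _).trans ⟨fun h => ?_, fun h => ?_⟩⟩
  · rw [← eq_sub_iff_add_eq, sub_eq_neg_add] at h
    exact h ▸ (he φ).symm.trans (he ψ)
  · rw [add_comm]
    exact ((he φ).trans h).unique (he ψ)

end KugaShimuraDatum

/-! ### Shears and flatness -/

section Shear

/-- The map `(x, y) ↦ (x, y + a(x))`. -/
def shearMap {X Y : Type*} [Add Y] (a : X → Y) (u : X × Y) : X × Y := (u.1, u.2 + a u.1)

/-- The shear `(x, y) ↦ (x, y + a(x))` over an open set of values of `x`. -/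
def shear {X Y : Type*} [TopologicalSpace X] [TopologicalSpace Y] [AddGroup Y]
    [IsTopologicalAddGroup Y] {S : Set X} (hS : IsOpen S) {a : X → Y} (ha : ContinuousOn a S) :
    OpenPartialHomeomorph (X × Y) (X × Y) where
  toFun := shearMap a
  invFun := shearMap (-a)
  source := Prod.fst ⁻¹' S
  target := Prod.fst ⁻¹' S
  map_source' _ h := h
  map_target' _ h := h
  left_inv' u _ := by simp [shearMap]
  right_inv' u _ := by simp [shearMap]
  open_source := hS.preimage continuous_fst
  open_target := hS.preimage continuous_fst
  continuousOn_toFun := continuousOn_fst.prodMk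
    (continuousOn_snd.add (ha.comp continuousOn_fst (Set.mapsTo_preimage _ _)))
  continuousOn_invFun := continuousOn_fst.prodMk
    (continuousOn_snd.add (ha.neg.comp continuousOn_fst (Set.mapsTo_preimage _ _)))

variable {𝕜 E F : Type*} [NontriviallyNormedField 𝕜] [NormedAddCommGroup E] [NormedSpace 𝕜 E]
  [NormedAddCommGroup F] [NormedSpace 𝕜 F] {a : E → F} {u : E × F}

theorem contDiffAt_shearMap {n : ℕ∞ω} (ha : ContDiffAt 𝕜 n a u.1) :
    ContDiffAt 𝕜 n (shearMap a) u :=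
  contDiffAt_fst.prodMk (contDiffAt_snd.add (ha.comp u contDiffAt_fst))

theorem fderiv_shearMap (ha : DifferentiableAt 𝕜 a u.1) (v : E × F) :
    fderiv 𝕜 (shearMap a) u v = (v.1, v.2 + fderiv 𝕜 a u.1 v.1) := by
  have hshear : HasFDerivAt (shearMap a) _ u :=
    hasFDerivAt_fst.prodMk (hasFDerivAt_snd.add (ha.hasFDerivAt.comp u hasFDerivAt_fst))
  rw [hshear.fderiv]
  rfl

theorem fderiv_fderiv_shearMap (ha : ContDiffAt 𝕜 2 a u.1) (v w : E × F) :
    fderiv 𝕜 (fderiv 𝕜 (shearMap a)) u v w =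
      fderiv 𝕜 (shearMap a) u (0, fderiv 𝕜 (fderiv 𝕜 a) u.1 v.1 w.1) := by
  have hshear : DifferentiableAt 𝕜 (fderiv 𝕜 (shearMap a)) u :=
    ((contDiffAt_shearMap ha).fderiv_right (m := 1) le_rfl).differentiableAt one_ne_zero
  have ha' : DifferentiableAt 𝕜 (fderiv 𝕜 a) u.1 :=
    (ha.fderiv_right (m := 1) le_rfl).differentiableAt one_ne_zero
  have hfderiv : (fun y => fderiv 𝕜 (shearMap a) y w) =ᶠ[𝓝 u]
      fun y => (w.1, w.2 + fderiv 𝕜 a y.1 w.1) := by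
    filter_upwards [continuous_fst.continuousAt.eventually (ha.eventually (by simp))] with y hy
    exact fderiv_shearMap (hy.differentiableAt two_ne_zero) w
  have hsecond : HasFDerivAt (fun y : E × F => (w.1, w.2 + fderiv 𝕜 a y.1 w.1)) _ u :=
    (hasFDerivAt_const w.1 u).prodMk ((hasFDerivAt_const w.2 u).add
      ((ha'.hasFDerivAt.comp u hasFDerivAt_fst).clm_apply (hasFDerivAt_const w.1 u)))
  have heval : fderiv 𝕜 (fun y => fderiv 𝕜 (shearMap a) y w) u v =
      fderiv 𝕜 (fderiv 𝕜 (shearMap a)) u v w := by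
    simp [fderiv_clm_apply hshear (differentiableAt_const w)]
  rw [← heval, hfderiv.fderiv_eq, hsecond.fderiv,
    fderiv_shearMap (ha.differentiableAt two_ne_zero)]
  simp

theorem fderiv_fderiv_eq_iteratedDeriv (a : 𝕜 → F) (t v w : 𝕜) :
    fderiv 𝕜 (fderiv 𝕜 a) t v w = (v * w) • iteratedDeriv 2 a t := by
  simpa [iteratedFDeriv_two_apply] using
    iteratedFDeriv_apply_eq_iteratedDeriv_mul_prod (n := 2) (f := a) (x := t) (m := ![v, w])

end Shear

theorem exists_iteratedDeriv_two_eqOn_ball {F : Type*} [NormedAddCommGroup F] [NormedSpace ℂ F]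
    [CompleteSpace F] {f : ℂ → F} {c : ℂ} {R : ℝ} (hf : DifferentiableOn ℂ f (Metric.ball c R)) :
    ∃ a : ℂ → F, DifferentiableOn ℂ a (Metric.ball c R) ∧
      Set.EqOn (iteratedDeriv 2 a) f (Metric.ball c R) := by
  obtain ⟨a', ha'⟩ := hf.isExactOn_ball
  have hdiff : DifferentiableOn ℂ a' (Metric.ball c R) := fun t ht =>
    (ha' t ht).differentiableAt.differentiableWithinAt
  obtain ⟨a, ha⟩ := hdiff.isExactOn_ball
  refine ⟨a, fun t ht => (ha t ht).differentiableAt.differentiableWithinAt, fun t ht => ?_⟩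
  have hderiv : deriv a =ᶠ[𝓝 t] a' := by
    filter_upwards [Metric.isOpen_ball.mem_nhds ht] with s hs
    exact (ha s hs).deriv
  rw [iteratedDeriv_succ, iteratedDeriv_one, hderiv.deriv_eq, (ha' t ht).deriv]

namespace KugaShimuraDatum
variable {D : KugaShimuraDatum}

theorem contMDiffAt_model_of_contDiffAt {f : ℂ × ℂ × ℂ → ℂ × ℂ × ℂ} {u : ℂ × ℂ × ℂ}
    (hf : ContDiffAt ℂ ω f u) :
    ContMDiffAt (M := ModelProd ℂ (ℂ × ℂ)) (M' := ModelProd ℂ (ℂ × ℂ)) model model ω f u :=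
  contMDiffAt_iff.2 ⟨hf.continuousAt, hf.contDiffWithinAt⟩

/-- The chart of the threefold given by the coordinates `(τ, z + a(τ))` on a sheet. -/
noncomputable def shearedSheet (b : Cover) {S : Set ℂ} (hS : IsOpen S) {a : ℂ → ℂ × ℂ}
    (ha : ContinuousOn a S) : OpenPartialHomeomorph D.Threefold (ModelProd ℂ (ℂ × ℂ)) :=
  (D.sheet b).trans (shear hS ha)

theorem shearedSheet_mem (b : Cover) {S : Set ℂ} (hS : IsOpen S) {a : ℂ → ℂ × ℂ}
    (ha : DifferentiableOn ℂ a S) :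
    shearedSheet b hS ha.continuousOn ∈ IsManifold.maximalAtlas model ω D.Threefold := by
  have hsmooth {t : ℂ} (ht : t ∈ S) : ContDiffAt ℂ ω a t :=
    (ha.contDiffOn hS).contDiffAt (hS.mem_nhds ht)
  refine OpenPartialHomeomorph.mem_maximalAtlas_of_contMDiffOn _ (fun p hp => ?_) fun u hu => ?_
  · exact ((contMDiffAt_model_of_contDiffAt (contDiffAt_shearMap (hsmooth hp.2))).comp p
      (contMDiffAt_of_mem_maximalAtlas (D.sheet_mem b) hp.1)).contMDiffWithinAt
  · exact ((contMDiffAt_symm_of_mem_maximalAtlas (D.sheet_mem b) hu.2).comp u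
      (contMDiffAt_model_of_contDiffAt
        (contDiffAt_shearMap (hsmooth hu.1).neg))).contMDiffWithinAt

theorem exists_isFlat_diff_eq_sectionTensor (c : D.SectionPairs) (x : Cover) :
    ∃ r : LocalAffineConnection model D.Threefold, r.IsFlat ∧ D.proj x ∈ r.domain ∧
      r.domain ≤ (D.sheetConnection x).domain ∧ ∀ p ∈ r.domain,
        r.diff (D.sheetConnection x) p = sectionTensor c p := by
  obtain ⟨R, hR, hball⟩ :=
    Metric.isOpen_iff.1 UpperHalfPlane.isOpen_upperHalfPlaneSet (x.1 : ℂ) x.1.im_pos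
  have hpair : DifferentiableOn ℂ (fun t => pairLift c (UpperHalfPlane.ofComplex t))
      (Metric.ball (x.1 : ℂ) R) := fun t ht =>
    ((contMDiff_pairLift c).contMDiffAt.comp t (UpperHalfPlane.contMDiffAt_ofComplex
      (n := ω) (hball ht))).contDiffAt.differentiableAt (by simp) |>.differentiableWithinAt
  obtain ⟨a, ha, hsecond⟩ := exists_iteratedDeriv_two_eqOn_ball hpair
  have hmem := shearedSheet_mem (D := D) x Metric.isOpen_ball ha
  refine ⟨flatConnection _ hmem, flatConnection_isFlat hmem,
    ⟨D.proj_mem_sheet_source x, ?_⟩, fun p hp => hp.1, fun p hp => ?_⟩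
  · change ((orbitLift D.Grp x (D.proj x)).1 : ℂ) ∈ Metric.ball (x.1 : ℂ) R
    rw [orbitLift_proj_self]
    exact Metric.mem_ball_self hR
  · have hball_mem : ((D.sheet x).extend model p).1 ∈ Metric.ball (x.1 : ℂ) R := hp.2
    have hsmooth : ContDiffAt ℂ ω a ((D.sheet x).extend model p).1 :=
      (ha.contDiffOn Metric.isOpen_ball).contDiffAt (Metric.isOpen_ball.mem_nhds hball_mem)
    ext v w
    refine (flatConnection_diff (D.sheet_mem x) hmem hp.1 hp (contDiffAt_shearMap hsmooth)
      (Filter.Eventually.of_forall fun q => rfl)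
      (fderiv_fderiv_shearMap (hsmooth.of_le le_top)) w v).trans ?_
    rw [sectionTensor_symm, sectionTensor_eq c hp.1, squareTensor_apply,
      fderiv_fderiv_eq_iteratedDeriv, hsecond hball_mem, sheet_extend, coords]
    simp only [UpperHalfPlane.ofComplex_apply]

theorem isFlat (φ : HolProjConnection model D.Threefold) : φ.IsFlat := by
  obtain ⟨c, hc⟩ := exists_isTranslate_standardConnection φ
  rw [isTranslate_iff_isPureTensor] at hc
  refine ⟨⟨{r | r.IsFlat ∧ ∀ s ∈ φ.reps, s.ProjEquiv r}, fun p => ?_, ?_⟩,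
    HolProjConnection.equivalent_iff.2 fun s hs r hr => hr.2 s hs, fun r hr => hr.1⟩
  · obtain ⟨x, rfl⟩ := D.proj_surjective p
    obtain ⟨r, hflat, hx, hdom, hdiff⟩ := exists_isFlat_diff_eq_sectionTensor c x
    refine ⟨r, ⟨hflat, fun s hs =>
      LocalAffineConnection.projEquiv_iff_isPureTensor.2 fun p ⟨hps, hpr⟩ => ?_⟩, hx⟩
    refine (hc _ ⟨x, rfl⟩ s hs p ⟨hdom hpr, hps⟩).congr fun v w => ?_
    rw [← LocalAffineConnection.diff_add_diff hps (hdom hpr) hpr,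
      LocalAffineConnection.diff_swap hpr (hdom hpr), hdiff p hpr, add_apply, add_apply,
      neg_apply, neg_apply, sub_eq_add_neg]
  · rintro r ⟨-, hr⟩ t ⟨-, ht⟩
    rw [LocalAffineConnection.projEquiv_iff_isPureTensor]
    intro p hp
    obtain ⟨s, hs, hps⟩ := φ.cover p
    refine ((LocalAffineConnection.projEquiv_iff_isPureTensor.1 (hr s hs).symm p ⟨hp.1, hps⟩).add
      (LocalAffineConnection.projEquiv_iff_isPureTensor.1 (ht s hs) p ⟨hps, hp.2⟩)).congr
      fun v w => ?_
    rw [← LocalAffineConnection.diff_add_diff hp.1 hps hp.2, add_apply, add_apply]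

end KugaShimuraDatum

/-! ### The fibres -/

namespace KugaShimuraDatum
variable {D : KugaShimuraDatum}

theorem mfderiv_fibration {b : Cover} {q : D.Threefold} (hq : q ∈ (D.sheet b).source)
    (u : TangentSpace model q) :
    mfderiv model 𝓘(ℂ) D.fibration q u =
      mfderiv 𝓘(ℂ) 𝓘(ℂ) D.curveProj (orbitLift D.Grp b q).1
        (coordDeriv model (D.sheet b) q u).1 := by
  have hlocal : D.fibration =ᶠ[𝓝 q] D.curveProj ∘ Prod.fst ∘ orbitLift D.Grp b := by
    filter_upwards [(D.sheet b).open_source.mem_nhds hq] with y hy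
    conv_lhs => rw [← proj_orbitLift hy]
    rfl
  have hlift : MDifferentiableAt model model (orbitLift D.Grp b) q :=
    (contMDiffAt_orbitLift D.contMDiff_smul (by rwa [← sheet_source])).mdifferentiableAt (by simp)
  have hfst : MDifferentiableAt model 𝓘(ℂ) (Prod.fst : Cover → ℍ) (orbitLift D.Grp b q) :=
    mdifferentiableAt_fst
  have hcurve : MDifferentiableAt 𝓘(ℂ) 𝓘(ℂ) D.curveProj (orbitLift D.Grp b q).1 :=
    (contMDiff_orbitQuotient_mk D.contMDiff_moebius).contMDiffAt.mdifferentiableAt (n := ω)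
      (by simp)
  have hfst_lift := mfderiv_comp q hfst hlift
  rw [mfderiv_fst] at hfst_lift
  refine (congrArg (fun L : TangentSpace model q →L[ℂ] ℂ => L u)
    (hlocal.mfderiv_eq.trans (mfderiv_comp q hcurve (hfst.comp q hlift)))).trans
    (congrArg (mfderiv 𝓘(ℂ) 𝓘(ℂ) D.curveProj (orbitLift D.Grp b q).1) ?_)
  exact (congrArg (fun L : TangentSpace model q →L[ℂ] ℂ => L u) hfst_lift).trans
    (congrArg Prod.fst (mfderiv_coords_comp hlift u).symm)

theorem mfderiv_fibration_eq_zero_iff {b : Cover} {q : D.Threefold} (hq : q ∈ (D.sheet b).source)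
    (u : TangentSpace model q) :
    mfderiv model 𝓘(ℂ) D.fibration q u = 0 ↔ (coordDeriv model (D.sheet b) q u).1 = 0 := by
  rw [mfderiv_fibration hq]
  exact map_eq_zero_iff (mfderiv 𝓘(ℂ) 𝓘(ℂ) D.curveProj (orbitLift D.Grp b q).1)
    (mfderiv_orbitQuotient_mk_injective D.contMDiff_moebius _)

theorem mvfderiv_eq_zero_of_eqOn_fiber {x : Cover} {k : D.Threefold → ℂ}
    (hk : MDifferentiableAt model 𝓘(ℂ) k (D.proj x))
    (hzero : ∀ᶠ q in 𝓝 (D.proj x), D.fibration q = D.fibration (D.proj x) → k q = 0)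
    {v : TangentSpace model (D.proj x)} (hv : mfderiv model 𝓘(ℂ) D.fibration (D.proj x) v = 0) :
    mvfderiv model k (D.proj x) v = 0 := by
  obtain ⟨s, rfl⟩ : ∃ s : ℂ × ℂ, D.projDeriv x (0, s) = v := by
    refine ⟨(coordDeriv model (D.sheet x) (D.proj x) v).2, ?_⟩
    rw [← (mfderiv_fibration_eq_zero_iff (D.proj_mem_sheet_source x) v).1 hv]
    exact projDeriv_coordDeriv_sheet x v
  let fiberMap : ℂ × ℂ → Cover := fun z => (x.1, z)
  have hfiber : MDifferentiableAt 𝓘(ℂ, ℂ × ℂ) model fiberMap x.2 :=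
    mdifferentiableAt_const.prodMk mdifferentiableAt_id
  have hproj : MDifferentiableAt 𝓘(ℂ, ℂ × ℂ) model (D.proj ∘ fiberMap) x.2 :=
    (mdifferentiableAt_proj x).comp x.2 hfiber
  have hconst : k ∘ (D.proj ∘ fiberMap) =ᶠ[𝓝 x.2] fun _ => (0 : ℂ) := by
    filter_upwards [hproj.continuousAt.eventually hzero] with z hz
    exact hz rfl
  have hchain := mfderiv_comp x.2
    (show MDifferentiableAt model 𝓘(ℂ) k ((D.proj ∘ fiberMap) x.2) from hk) hproj
  rw [hconst.mfderiv_eq, mfderiv_const, mfderiv_comp x.2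
    (show MDifferentiableAt model model D.proj (fiberMap x.2) from mdifferentiableAt_proj x) hfiber,
    mfderiv_prod_right] at hchain
  exact (congrArg (fun L : ℂ × ℂ →L[ℂ] ℂ => L s) hchain).symm

theorem mfderiv_fibration_sheetConnection_cov_eq_zero {x : Cover}
    {Y : Π p : D.Threefold, TangentSpace model p}
    (hY : MDifferentiableAt model model.tangent (T% Y) (D.proj x))
    (hYt : ∀ᶠ q in 𝓝 (D.proj x), D.fibration q = D.fibration (D.proj x) →
      mfderiv model 𝓘(ℂ) D.fibration q (Y q) = 0)
    {v : TangentSpace model (D.proj x)} (hv : mfderiv model 𝓘(ℂ) D.fibration (D.proj x) v = 0) :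
    mfderiv model 𝓘(ℂ) D.fibration (D.proj x) ((D.sheetConnection x).cov Y (D.proj x) v) = 0 := by
  have hx := D.proj_mem_sheet_source x
  have hYcoord := mdifferentiableAt_coordDeriv_apply (D.sheet_mem x) hx hY
  have hfst := mvfderiv_comp_of_hasFDerivAt (hasFDerivAt_fst (𝕜 := ℂ)) hYcoord v
  rw [mfderiv_fibration_eq_zero_iff hx]
  refine (congrArg Prod.fst (coordDeriv_coordInv (D.sheet_mem x) hx _)).trans
    (hfst.symm.trans (mvfderiv_eq_zero_of_eqOn_fiber ?_ ?_ hv))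
  · exact (hasFDerivAt_fst (𝕜 := ℂ)).hasMFDerivAt.mdifferentiableAt.comp _ hYcoord
  · filter_upwards [hYt, (D.sheet x).open_source.mem_nhds hx] with q hq hqx hfiber
    exact (mfderiv_fibration_eq_zero_iff hqx _).1 (hq hfiber)

theorem sectionTensor_eq_zero_of_vertical (c : D.SectionPairs) {p : D.Threefold}
    {v : TangentSpace model p} (hv : mfderiv model 𝓘(ℂ) D.fibration p v = 0)
    (w : TangentSpace model p) : sectionTensor c p v w = 0 := by
  obtain ⟨x, rfl⟩ := D.proj_surjective p
  have hx := D.proj_mem_sheet_source x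
  rw [sectionTensor_eq c hx, squareTensor_apply, (mfderiv_fibration_eq_zero_iff hx v).1 hv,
    zero_mul, zero_smul]
  exact map_zero _

theorem fibersTotallyGeodesic (φ : HolProjConnection model D.Threefold) :
    φ.FibersTotallyGeodesic 𝓘(ℂ) D.fibration := by
  obtain ⟨c, hc⟩ := exists_isTranslate_standardConnection φ
  intro r hr p hp Y hY hYt v hv
  obtain ⟨x, rfl⟩ := D.proj_surjective p
  have hx := D.proj_mem_sheet_source x
  obtain ⟨θ, hθ⟩ := isTranslate_iff_isPureTensor.1 hc _ ⟨x, rfl⟩ r hr (D.proj x) ⟨hx, hp⟩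
  have hYv : mfderiv model 𝓘(ℂ) D.fibration (D.proj x) (Y (D.proj x)) = 0 :=
    hYt.self_of_nhds rfl
  have hdiff : r.cov Y (D.proj x) v - (D.sheetConnection x).cov Y (D.proj x) v -
      sectionTensor c (D.proj x) (Y (D.proj x)) v =
        θ (Y (D.proj x)) • v + θ v • Y (D.proj x) := by
    rw [← sub_apply, ← LocalAffineConnection.diff_apply hp (s := D.sheetConnection x) hx hY]
    exact hθ (Y (D.proj x)) v
  rw [sectionTensor_eq_zero_of_vertical c hYv, sub_zero, sub_eq_iff_eq_add] at hdiff
  rw [hdiff, map_add, map_add, map_smul, map_smul, hYv, hv,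
    mfderiv_fibration_sheetConnection_cov_eq_zero hY hYt hv]
  simp only [smul_zero, add_zero]

end KugaShimuraDatum

theorem mainTheorem2 (D : KugaShimuraDatum) :
    (∃ _ : AddTorsor D.SectionPairs (ProjClass KugaShimuraDatum.model D.Threefold),
      ∀ (c : D.SectionPairs) (φ ψ : HolProjConnection KugaShimuraDatum.model D.Threefold),
        c +ᵥ φ.toClass = ψ.toClass ↔ KugaShimuraDatum.IsTranslate c φ ψ) ∧
    (∀ φ : HolProjConnection KugaShimuraDatum.model D.Threefold, φ.IsFlat) ∧
    (∀ φ : HolProjConnection KugaShimuraDatum.model D.Threefold,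
      φ.FibersTotallyGeodesic 𝓘(ℂ) D.fibration) :=
  ⟨D.exists_addTorsor, KugaShimuraDatum.isFlat, KugaShimuraDatum.fibersTotallyGeodesic⟩
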